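/- **Setting.** Let $n\ge 2$ and let $\rho:\mathbb R^n\to[0,\infty)$ be one of the following probability densities: (1) the density $\rho=|\mathcal X|^{-1}\mathbf 1_{\mathcal X}$ of the uniform distribution on a nonempty, bounded, convex, open set $\mathcal X\subset\mathbb R^n$; (2) the density of the standard normal distribution $\mathcal N(0,I)$, with $\mathcal X=\mathbb R^n$. Let $f:\mathcal X\to\mathbb R$ be measurable with partial derivatives that exist on $\mathcal X$ and are square integrable with respect to $\rho$. Let $$\int_{\mathcal X}\nabla f(x)\,\nabla f(x)^\top\rho(x)\,dx=W\,\mathrm{diag}(\lambda_1,\dots,\lambda_n)\,W^\top,\qquad \lambda_1\ge\dots\ge\lambda_n,$$ with $W$ orthogonal, and let $\hat W$ be an orthogonal $n\times n$ matrix with $\|W-\hat W\|\le\varepsilon$ for some $\varepsilon>0$, where $\|\cdot\|$ is the operator norm induced by the Euclidean norm. For $1\le k\le n-1$ write $\hat W=[\hat W_1\ \hat W_2]$, where $\hat W_1$ consists of the first $k$ columns. Let $(\Omega,\mathcal A,\mathbb P)$ be a probability space, let $X:\Omega\to\mathbb R^n$ be a random vector with density $\rho$, and put $\hat Y=\hat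 W_1^\top X$ and $\hat{\mathcal Y}=\hat W_1^\top\mathcal X$. For $y\in\hat{\mathcal Y}$ and $z\in\mathbb R^{n-k}$ let $$\hat\rho(z\mid y)=\frac{\rho(\hat W_1y+\hat W_2z)}{\int_{\mathbb R^{n-k}}\rho(\hat W_1y+\hat W_2z')\,dz'},\qquad \hat g(y)=\int_{\mathbb R^{n-k}} f(\hat W_1y+\hat W_2z)\,\hat\rho(z\mid y)\,dz .$$ Let $N\ge1$ and, for each $y\in\hat{\mathcal Y}$, let $\hat Z^y_1,\dots,\hat Z^y_N:\Omega\to\mathbb R^{n-k}$ be independent random vectors with density $\hat\rho(\cdot\mid y)$, such that each map $(y,\omega)\mapsto\hat Z^y_j(\omega)$ is measurable on $\hat{\mathcal Y}\times\Omega$. Put $$\hat g_N(y,\omega)=\frac1N\sum_{j=1}^N f\big(\hat W_1y+\hat W_2\hat Z^y_j(\omega)\big),\qquad f_{\hat g}(x)=\hat g(\hat W_1^\top x),\qquad f_{\hat g_N}(x,\omega)=\hat g_N(\hat W_1^\top x,\omega).$$ Write $\mathbb E_X$ and $\mathbb E_Y$ for integration with respect to the laws of $X$ and of $\hat Y$ at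 fixed $\omega$, and $\mathbb E$ for integration over $\omega$ with respect to $\mathbb P$. **Theorem.** There is a constant $C>0$ that depends only on $\rho$ (and not on $f,W,\hat W,k,\varepsilon,N$ or the random variables), with $C=1$ in case (2), such that in the above setting the integral defining $\hat g(y)$ converges absolutely for almost every $y$ with respect to the law of $\hat Y$, the function $(x,\omega)\mapsto (f_{\hat g}(x)-f_{\hat g_N}(x,\omega))^2$ is integrable with respect to the product of the law of $X$ and $\mathbb P$, and $$\mathbb E\Big[\mathbb E_X\big[(f_{\hat g}(X)-f_{\hat g_N}(X,\cdot))^2\big]\Big]=\mathbb E\Big[\mathbb E_Y\big[(\hat g(\hat Y)-\hat g_N(\hat Y,\cdot))^2\big]\Big]\le\frac CN\Big(\varepsilon(\lambda_1+\dots+\lambda_k)^{1/2}+(\lambda_{k+1}+\dots+\lambda_n)^{1/2}\Big)^2 .$$ -/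

import Mathlib

open MeasureTheory ProbabilityTheory
open scoped Matrix

noncomputable section

namespace ActiveSubspace

/-- `ℝⁿ` with its Euclidean norm and Lebesgue measure `volume`. -/
abbrev Vec (n : ℕ) : Type := EuclideanSpace ℝ (Fin n)

/-- The domain `𝒳`: the points with positive density. -/
def domain {n : ℕ} (ρ : Vec n → ℝ) : Set (Vec n) := {x | 0 < ρ x}

/-- `ρ` is the density of the uniform distribution on `𝒳 = {ρ > 0}`, where `𝒳` is a nonempty,
bounded, convex, open set. -/
structure IsUniformOnConvex {n : ℕ} (ρ : Vec n → ℝ) : Prop where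
  nonempty : (domain ρ).Nonempty
  isOpen : IsOpen (domain ρ)
  bounded : Bornology.IsBounded (domain ρ)
  convex : Convex ℝ (domain ρ)
  eq_indicator : ρ = (domain ρ).indicator (fun _ => (volume.real (domain ρ))⁻¹)

/-- `ρ` is the density of the standard normal distribution `𝒩(0, I)` on `ℝⁿ`. -/
def IsStdNormal {n : ℕ} (ρ : Vec n → ℝ) : Prop :=
  ∀ x, ρ x = (Real.sqrt (2 * Real.pi) ^ n)⁻¹ * Real.exp (-‖x‖ ^ 2 / 2)

/-- The measure with Lebesgue density `ρ`. -/
def densityMeasure {n : ℕ} (ρ : Vec n → ℝ) : Measure (Vec n) :=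
  volume.withDensity (fun x => ENNReal.ofReal (ρ x))

/-- The `i`-th classical partial derivative. -/
def partialDeriv {n : ℕ} (i : Fin n) (f : Vec n → ℝ) (x : Vec n) : ℝ :=
  lineDeriv ℝ f x (EuclideanSpace.single i 1)

/-- The standing assumptions on the function of interest `f : 𝒳 → ℝ` (only its values on `𝒳`
matter): it is measurable, and its partial derivatives exist on `𝒳` and are square integrable
with respect to the weight `ρ`. -/
structure IsAdmissible {n : ℕ} (ρ f : Vec n → ℝ) : Prop where
  measurable : Measurable fun x : domain ρ => f x
  hasPartials : ∀ x ∈ domain ρ, ∀ i : Fin n,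
    LineDifferentiableAt ℝ f x (EuclideanSpace.single i 1)
  sq_integrable : ∀ i : Fin n,
    IntegrableOn (fun x => partialDeriv i f x ^ 2 * ρ x) (domain ρ)

/-- The averaged outer product of the gradient,
`C = ∫_𝒳 ∇f(x) ∇f(x)ᵀ ρ(x) dx`. -/
def gradMatrix {n : ℕ} (ρ f : Vec n → ℝ) : Matrix (Fin n) (Fin n) ℝ :=
  Matrix.of fun i j => ∫ x in domain ρ, partialDeriv i f x * partialDeriv j f x * ρ x

/-- `W` is an orthogonal matrix of eigenvectors of `C` (its columns), with the eigenvalues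
`lam` in descending order: `C = W diag(lam) Wᵀ`. -/
structure IsEigenbasis {n : ℕ} (ρ f : Vec n → ℝ) (W : Matrix (Fin n) (Fin n) ℝ)
    (lam : Fin n → ℝ) : Prop where
  orthogonal : W ∈ Matrix.orthogonalGroup (Fin n) ℝ
  antitone : Antitone lam
  eigen : gradMatrix ρ f = W * Matrix.diagonal lam * Wᵀ

/-- The first `k` columns of `W`. -/
def cols₁ {n k : ℕ} (hk : k ≤ n) (W : Matrix (Fin n) (Fin n) ℝ) : Matrix (Fin n) (Fin k) ℝ :=
  W.submatrix id (Fin.castLE hk)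

/-- The last `n - k` columns of `W`. -/
def cols₂ {n k : ℕ} (hk : k ≤ n) (W : Matrix (Fin n) (Fin n) ℝ) :
    Matrix (Fin n) (Fin (n - k)) ℝ :=
  W.submatrix id (fun j => ⟨k + j, by omega⟩)

/-- Matrix times vector, between Euclidean spaces. -/
def mulE {m n : ℕ} (A : Matrix (Fin m) (Fin n) ℝ) (v : Vec n) : Vec m :=
  WithLp.toLp 2 (A *ᵥ v.ofLp)

/-- The active variable `y = W₁ᵀ x`. -/
def active {n k : ℕ} (hk : k ≤ n) (W : Matrix (Fin n) (Fin n) ℝ) (x : Vec n) : Vec k :=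
  mulE (cols₁ hk W)ᵀ x

/-- The point `W₁ y + W₂ z`. -/
def assemble {n k : ℕ} (hk : k ≤ n) (W : Matrix (Fin n) (Fin n) ℝ) (y : Vec k)
    (z : Vec (n - k)) : Vec n :=
  mulE (cols₁ hk W) y + mulE (cols₂ hk W) z

/-- The set `𝒴 = W₁ᵀ 𝒳`. -/
def activeDomain {n k : ℕ} (hk : k ≤ n) (W : Matrix (Fin n) (Fin n) ℝ) (ρ : Vec n → ℝ) :
    Set (Vec k) :=
  active hk W '' domain ρ

/-- The marginal density `ρ_Y(y) = ∫ ρ(W₁ y + W₂ z) dz`. -/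
def marginalDensity {n k : ℕ} (hk : k ≤ n) (W : Matrix (Fin n) (Fin n) ℝ) (ρ : Vec n → ℝ)
    (y : Vec k) : ℝ :=
  ∫ z, ρ (assemble hk W y z)

open Classical in
/-- The conditional density `ρ_{Z|Y}(z|y)`, set to zero for `y ∉ 𝒴`. -/
def condDensity {n k : ℕ} (hk : k ≤ n) (W : Matrix (Fin n) (Fin n) ℝ) (ρ : Vec n → ℝ)
    (y : Vec k) (z : Vec (n - k)) : ℝ :=
  if y ∈ activeDomain hk W ρ then ρ (assemble hk W y z) / marginalDensity hk W ρ y else 0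

/-- The conditional expectation `g(y) = ∫ f(W₁ y + W₂ z) ρ_{Z|Y}(z|y) dz`. -/
def condExpect {n k : ℕ} (hk : k ≤ n) (W : Matrix (Fin n) (Fin n) ℝ) (ρ f : Vec n → ℝ)
    (y : Vec k) : ℝ :=
  ∫ z, f (assemble hk W y z) * condDensity hk W ρ y z

/-- `Z j y : Ω → ℝⁿ⁻ᵏ`, `j = 1, …, N`, are, for each `y ∈ 𝒴`, independent random variables with
the conditional distribution of density `ρ_{Z|Y}(·|y)`, and depend on `(y, ω) ∈ 𝒴 × Ω` in a
(product) measurable way.  Nothing is assumed on the dependence between different `y`. -/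
structure IsConditionalSample {n k N : ℕ} (hk : k ≤ n) (W : Matrix (Fin n) (Fin n) ℝ)
    (ρ : Vec n → ℝ) {Ω : Type*} [MeasurableSpace Ω] (P : Measure Ω)
    (Z : Fin N → Vec k → Ω → Vec (n - k)) : Prop where
  measurable : ∀ j, Measurable fun p : activeDomain hk W ρ × Ω => Z j p.1 p.2
  law : ∀ j, ∀ y ∈ activeDomain hk W ρ,
    P.map (Z j y) = densityMeasure (condDensity hk W ρ y)
  indep : ∀ y ∈ activeDomain hk W ρ, iIndepFun (fun j => Z j y) P

/-- The Monte Carlo sum `g_N(y, ω) = (1/N) ∑ⱼ f(W₁ y + W₂ Zⱼ^y(ω))`. -/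
def monteCarlo {n k N : ℕ} (hk : k ≤ n) (W : Matrix (Fin n) (Fin n) ℝ) (f : Vec n → ℝ)
    {Ω : Type*} (Z : Fin N → Vec k → Ω → Vec (n - k)) (y : Vec k) (ω : Ω) : ℝ :=
  (1 / (N : ℝ)) * ∑ j, f (assemble hk W y (Z j y ω))

/-- The ridge function `f_g(x) = g(W₁ᵀ x)` on the full space. -/
def ridge {n k : ℕ} (hk : k ≤ n) (W : Matrix (Fin n) (Fin n) ℝ) (g : Vec k → ℝ)
    (x : Vec n) : ℝ :=
  g (active hk W x)

end ActiveSubspace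

end

open ActiveSubspace

/-!
The error of the Monte Carlo average at a point `y` of the active domain is that of a sample mean:
its mean square is `Var(f | y) / N`, the conditional variance being taken over the slice
`z ↦ W₁ y + W₂ z` (`lintegral_sq_sub_sampleMean`). Everything else bounds the expected conditional
variance. Twice this quantity is the `pairEnergy`, the expected value of `(f x - f x')²` for two
points drawn independently from the same slice. In this form it is an extended nonnegative number
that makes sense for every measurable `f`; its finiteness is what shows that almost every slice
of `f` is square integrable (`ae_memLp_slice`), so that the conditional expectation converges.

On each slice a Poincaré inequality holds with a constant independent of the slice
(`SlicePoincare`). For the uniform distribution the slices are convex sets of bounded diameter, and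
the inequality follows by integrating the gradient along the segments joining pairs of points
(`convex_poincare`). For the normal distribution the slices are again normal and the constant is `1`
(`IsStdNormal.poincare`): the function `θ ↦ 𝔼[u(x) u(x cos θ + y sin θ)]`, for independent normal
`x` and `y`, interpolates between `𝔼[u²]` and `𝔼[u]²`, and its derivative is controlled by Stein's
identity and the rotation invariance of the normal distribution.

The function `f` only has partial derivatives at every point of the domain: it need not be
continuous, and local integrability is not known to begin with. It is therefore truncated by
`a arctan(f / a)`, which preserves the existence of partial derivatives, and multiplied by a smooth
cutoff function. The result is integrable with square integrable classical partial derivatives,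
which are weak derivatives because integration by parts is available along lines, so that
mollification applies (`pairEnergy_le_of_hasLineDerivAt`). The pair energy is lower
semicontinuous by Fatou's lemma, and the limits can be taken on the side of the gradient by
dominated convergence; the cutoffs are chosen so that the product of their gradients with the
truncation height tends to zero (`CutoffExhaustion`, `CutoffExhaustion.pairEnergy_le`).

This bounds the conditional variance by the mean square of the gradient in the inactive directions,
which is the trace of `V₂ᵀ (∫ ∇f ∇fᵀ ρ) V₂` for the perturbed basis `V`, that is, the sum of the
eigenvalues weighted by the squared lengths of the rows of `Wᵀ V₂`. These lengths are at most `1`,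
and those of the leading `k` rows are at most `ε`, since these rows vanish in `Wᵀ W₂`
(`lintegral_inactiveGrad_le`).
-/

namespace ActiveSubspace
open scoped ENNReal Topology ContDiff
open Filter

/-! ### The orthogonal splitting of the space -/

section Splitting

variable {n k : ℕ} (hk : k ≤ n) {W : Matrix (Fin n) (Fin n) ℝ}

lemma mulE_add {p q : ℕ} (A : Matrix (Fin p) (Fin q) ℝ) (v w : Vec q) :
    mulE A (v + w) = mulE A v + mulE A w := by
  ext i; simp [mulE, Matrix.mulVec_add]

lemma mulE_smul {p q : ℕ} (A : Matrix (Fin p) (Fin q) ℝ) (c : ℝ) (v : Vec q) :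
    mulE A (c • v) = c • mulE A v := by
  ext i; simp [mulE, Matrix.mulVec_smul]

lemma mulE_mulE {p q r : ℕ} (A : Matrix (Fin p) (Fin q) ℝ) (B : Matrix (Fin q) (Fin r) ℝ)
    (v : Vec r) : mulE A (mulE B v) = mulE (A * B) v := by
  ext i; simp [mulE, Matrix.mulVec_mulVec]

lemma mulE_one {p : ℕ} (v : Vec p) : mulE (1 : Matrix (Fin p) (Fin p) ℝ) v = v := by
  ext i; simp [mulE]

lemma mulE_zero_matrix {p q : ℕ} (v : Vec q) : mulE (0 : Matrix (Fin p) (Fin q) ℝ) v = 0 := by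
  ext i; simp [mulE]

lemma inner_mulE {p q : ℕ} (A : Matrix (Fin p) (Fin q) ℝ) (v : Vec q) (w : Vec p) :
    inner ℝ (mulE A v) w = inner ℝ v (mulE Aᵀ w) := by
  simp only [mulE, PiLp.inner_apply, Matrix.mulVec, dotProduct, Matrix.transpose_apply,
    RCLike.inner_apply, conj_trivial, Finset.mul_sum, Finset.sum_mul]
  rw [Finset.sum_comm]
  exact Finset.sum_congr rfl fun _ _ => Finset.sum_congr rfl fun _ _ => by ring

variable (hW : W ∈ Matrix.orthogonalGroup (Fin n) ℝ)
include hW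

lemma sum_mul_of_orthogonal (i j : Fin n) : ∑ a, W a i * W a j = if i = j then 1 else 0 := by
  have h := congrFun (congrFun (Matrix.mem_orthogonalGroup_iff' (Fin n) ℝ |>.1 hW) i) j
  simpa [Matrix.mul_apply, Matrix.one_apply, Matrix.star_apply] using h

lemma cols₁_transpose_mul : (cols₁ hk W)ᵀ * cols₁ hk W = 1 := by
  ext i j
  have := sum_mul_of_orthogonal hW (Fin.castLE hk i) (Fin.castLE hk j)
  simpa [Matrix.mul_apply, cols₁, Matrix.one_apply] using this

lemma cols₂_transpose_mul : (cols₂ hk W)ᵀ * cols₂ hk W = 1 := by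
  ext i j
  have := sum_mul_of_orthogonal hW ⟨k + i, by omega⟩ ⟨k + j, by omega⟩
  simpa [Matrix.mul_apply, cols₂, Matrix.one_apply, Fin.ext_iff] using this

lemma cols₁_transpose_mul_cols₂ : (cols₁ hk W)ᵀ * cols₂ hk W = 0 := by
  ext i j
  have := sum_mul_of_orthogonal hW (Fin.castLE hk i) ⟨k + j, by omega⟩
  have h2 : Fin.castLE hk i ≠ ⟨k + j, by omega⟩ := by
    intro h; have := congrArg Fin.val h; simp at this; omega
  simpa [Matrix.mul_apply, cols₁, cols₂, h2] using this

lemma active_assemble (y : Vec k) (z : Vec (n - k)) :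
    active hk W (assemble hk W y z) = y := by
  simp [active, assemble, mulE_add, mulE_mulE, cols₁_transpose_mul hk hW,
    cols₁_transpose_mul_cols₂ hk hW, mulE_one, mulE_zero_matrix]

lemma norm_sq_assemble (y : Vec k) (z : Vec (n - k)) :
    ‖assemble hk W y z‖ ^ 2 = ‖y‖ ^ 2 + ‖z‖ ^ 2 := by
  rw [assemble, norm_add_sq_real, ← real_inner_self_eq_norm_sq, ← real_inner_self_eq_norm_sq,
    inner_mulE, inner_mulE, inner_mulE, mulE_mulE, mulE_mulE, mulE_mulE,
    cols₁_transpose_mul hk hW, cols₂_transpose_mul hk hW, cols₁_transpose_mul_cols₂ hk hW]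
  simp [mulE_one, mulE_zero_matrix]

omit hW in
lemma assemble_add (y y' : Vec k) (z z' : Vec (n - k)) :
    assemble hk W (y + y') (z + z') = assemble hk W y z + assemble hk W y' z' := by
  simp only [assemble, mulE_add]; abel

omit hW in
lemma assemble_smul (c : ℝ) (y : Vec k) (z : Vec (n - k)) :
    assemble hk W (c • y) (c • z) = c • assemble hk W y z := by
  simp only [assemble, mulE_smul, smul_add]

/-- The coordinates `(y, z)` of the splitting, as an isometry of the orthogonal sum onto `ℝⁿ`. -/
noncomputable def assembleIsometry : WithLp 2 (Vec k × Vec (n - k)) ≃ₗᵢ[ℝ] Vec n :=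
  LinearIsometry.toLinearIsometryEquiv
    { toFun := fun p => assemble hk W p.fst p.snd
      map_add' := fun p q => by simp [assemble_add]
      map_smul' := fun c p => by simp [assemble_smul]
      norm_map' := fun p => by
        have h := norm_sq_assemble hk hW p.fst p.snd
        rw [← sq_eq_sq₀ (norm_nonneg _) (norm_nonneg _)]
        simpa [WithLp.prod_norm_sq_eq_of_L2] using h }
    (by rw [(WithLp.linearEquiv 2 ℝ (Vec k × Vec (n - k))).finrank_eq]; simp; omega)

lemma measurePreserving_assemble :
    MeasurePreserving (fun p : Vec k × Vec (n - k) => assemble hk W p.1 p.2) := by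
  exact (assembleIsometry hk hW).measurePreserving.comp (WithLp.volume_preserving_toLp _ _)

omit hW in
lemma continuous_mulE {p q : ℕ} (A : Matrix (Fin p) (Fin q) ℝ) : Continuous (mulE A) := by
  have : IsLinearMap ℝ (mulE A) := ⟨mulE_add A, mulE_smul A⟩
  exact (this.mk' _).continuous_of_finiteDimensional

omit hW in
lemma continuous_assemble :
    Continuous fun p : Vec k × Vec (n - k) => assemble hk W p.1 p.2 := by
  unfold assemble
  exact ((continuous_mulE _).comp continuous_fst).add ((continuous_mulE _).comp continuous_snd)

omit hW in
lemma continuous_active : Continuous (active hk W) := continuous_mulE _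

/-- The inactive directions: the map `z ↦ W₂ z`. -/
noncomputable def inactive (W : Matrix (Fin n) (Fin n) ℝ) : Vec (n - k) →L[ℝ] Vec n :=
  LinearMap.toContinuousLinearMap
    { toFun := mulE (cols₂ hk W), map_add' := mulE_add _, map_smul' := mulE_smul _ }

omit hW in
lemma assemble_eq_add_inactive (y : Vec k) (z : Vec (n - k)) :
    assemble hk W y z = mulE (cols₁ hk W) y + inactive hk W z := rfl

omit hW in
lemma inactive_single (l : Fin (n - k)) :
    inactive hk W (EuclideanSpace.single l 1)
      = ∑ i, cols₂ hk W i l • EuclideanSpace.single i (1 : ℝ) := by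
  ext i
  simp [inactive, mulE, Finset.sum_apply, Pi.single_apply]

lemma norm_assemble_sub (y : Vec k) (z z' : Vec (n - k)) :
    ‖assemble hk W y z - assemble hk W y z'‖ = ‖z - z'‖ := by
  have h := norm_sq_assemble hk hW 0 (z - z')
  have h2 : assemble hk W y z - assemble hk W y z' = assemble hk W 0 (z - z') := by
    rw [sub_eq_iff_eq_add, ← assemble_add]; simp
  rw [h2, ← sq_eq_sq₀ (norm_nonneg _) (norm_nonneg _), h]; simp

end Splitting

/-! ### The Poincaré inequality on bounded convex sets -/

section Tonelli

variable {α β : Type*} [MeasurableSpace α] [MeasurableSpace β] (μ : Measure α) [SFinite μ]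
  (ν : Measure β) [SFinite ν]

lemma lintegral_lintegral_lintegral_rotate {F : α → α → β → ℝ≥0∞}
    (hF : Measurable fun p : (α × α) × β => F p.1.1 p.1.2 p.2) :
    ∫⁻ z, ∫⁻ z', ∫⁻ t, F z z' t ∂ν ∂μ ∂μ = ∫⁻ t, ∫⁻ z, ∫⁻ z', F z z' t ∂μ ∂μ ∂ν := by
  have h1 := lintegral_lintegral_swap (μ := μ.prod μ) (ν := ν)
    (f := fun p t => F p.1 p.2 t) hF.aemeasurable
  rw [lintegral_prod _ hF.lintegral_prod_right'.aemeasurable] at h1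
  rw [h1]
  refine lintegral_congr fun t => ?_
  rw [lintegral_prod]
  exact (hF.comp measurable_prodMk_right).aemeasurable

omit [SFinite μ] in
lemma lintegral_lintegral_const_mul (c : ℝ≥0∞) {F : α → β → ℝ≥0∞}
    (hF : Measurable fun p : α × β => F p.1 p.2) :
    ∫⁻ z, ∫⁻ z', c * F z z' ∂ν ∂μ = c * ∫⁻ z, ∫⁻ z', F z z' ∂ν ∂μ := by
  rw [← lintegral_const_mul _ hF.lintegral_prod_right']
  exact lintegral_congr fun z => lintegral_const_mul _ (hF.comp measurable_prodMk_left)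

end Tonelli

section ConvexPoincare

variable {m : ℕ}

lemma lintegral_comp_add_smul (h : Vec m → ℝ≥0∞) (a : Vec m) {t : ℝ} (ht : t ≠ 0) :
    ∫⁻ z, h (a + t • z) = ENNReal.ofReal |(t ^ m)⁻¹| * ∫⁻ z, h z := by
  have e : (fun z => h (a + t • z)) = (fun z => (fun w => h (a + w)) (t • z)) := rfl
  have h1 := (Homeomorph.smulOfNeZero t ht).toMeasurableEquiv.measurableEmbedding.lintegral_map
    (μ := (volume : Measure (Vec m))) (f := fun w => h (a + w))
  have h2 : Measure.map (⇑(Homeomorph.smulOfNeZero t ht).toMeasurableEquiv)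
      (volume : Measure (Vec m)) = ENNReal.ofReal |(t ^ m)⁻¹| • volume := by
    have := Measure.map_addHaar_smul (volume : Measure (Vec m)) ht
    simpa using this
  rw [h2] at h1
  rw [e, ← lintegral_add_left_eq_self h a, ← smul_eq_mul, ← lintegral_smul_measure, h1]
  rfl

/-- Averaging `h` over the points `(1 - t) z + t z'` with `t ≥ 1/2` costs a factor `2 ^ m`:
for fixed `z` these points sweep out a part of the convex set, contracted by `t`. -/
lemma lintegral_convexComb_le {S : Set (Vec m)} (hS : Convex ℝ S) (hSm : MeasurableSet S)
    {h : Vec m → ℝ≥0∞} {z : Vec m} (hz : z ∈ S) {t : ℝ} (ht : 1 / 2 ≤ t)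
    (ht1 : t ≤ 1) :
    ∫⁻ z' in S, h ((1 - t) • z + t • z') ≤ 2 ^ m * ∫⁻ x in S, h x := by
  have h0 : 0 < t := by linarith
  calc ∫⁻ z' in S, h ((1 - t) • z + t • z')
      ≤ ∫⁻ z', S.indicator h ((1 - t) • z + t • z') := by
        rw [← lintegral_indicator hSm]
        refine lintegral_mono fun z' => ?_
        by_cases hz' : z' ∈ S
        · rw [Set.indicator_of_mem hz', Set.indicator_of_mem]
          exact hS hz hz' (by linarith) h0.le (by ring)
        · simp [hz']
    _ = ENNReal.ofReal |(t ^ m)⁻¹| * ∫⁻ x in S, h x := by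
        rw [lintegral_comp_add_smul _ _ h0.ne', lintegral_indicator hSm]
    _ ≤ 2 ^ m * ∫⁻ x in S, h x := by
        gcongr
        rw [show (2 : ℝ≥0∞) ^ m = ENNReal.ofReal (2 ^ m) by
          rw [ENNReal.ofReal_pow (by norm_num)]; simp]
        refine ENNReal.ofReal_le_ofReal ?_
        rw [abs_of_pos (by positivity), ← inv_pow]
        gcongr
        rw [inv_le_comm₀ h0 (by norm_num)]; linarith

lemma lintegral_lintegral_convexComb_le {S : Set (Vec m)} (hS : Convex ℝ S)
    (hSm : MeasurableSet S) {h : Vec m → ℝ≥0∞} (hm : Measurable h) {t : ℝ} (ht : 0 ≤ t)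
    (ht1 : t ≤ 1) :
    ∫⁻ z in S, ∫⁻ z' in S, h ((1 - t) • z + t • z')
      ≤ 2 ^ m * volume S * ∫⁻ x in S, h x := by
  have key : ∀ s : ℝ, 1 / 2 ≤ s → s ≤ 1 →
      ∫⁻ z in S, ∫⁻ z' in S, h ((1 - s) • z + s • z')
        ≤ 2 ^ m * volume S * ∫⁻ x in S, h x := by
    intro s hs hs1
    calc ∫⁻ z in S, ∫⁻ z' in S, h ((1 - s) • z + s • z')
        ≤ ∫⁻ _ in S, 2 ^ m * ∫⁻ x in S, h x :=
          setLIntegral_mono measurable_const fun z hz => lintegral_convexComb_le hS hSm hz hs hs1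
      _ = 2 ^ m * volume S * ∫⁻ x in S, h x := by
          rw [setLIntegral_const]; ring
  -- for `t ≤ 1/2` the two points exchange their roles
  rcases le_total (1 / 2) t with h2 | h2
  · exact key t h2 ht1
  · rw [lintegral_lintegral_swap]
    · convert key (1 - t) (by linarith) (by linarith) using 6
      rw [sub_sub_cancel, add_comm]
    · exact (hm.comp (by fun_prop)).aemeasurable

/-- The fundamental theorem of calculus along the segment from `z` to `z'`, combined with the
Cauchy-Schwarz inequality. -/
lemma sq_sub_le_lintegral_segment {v : Vec m → ℝ} (hv : ContDiff ℝ 1 v) (z z' : Vec m) :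
    ENNReal.ofReal ((v z - v z') ^ 2) ≤ ENNReal.ofReal (‖z - z'‖ ^ 2) *
      ∫⁻ t in Set.Icc (0 : ℝ) 1,
        ENNReal.ofReal (‖fderiv ℝ v ((1 - t) • z + t • z')‖ ^ 2) := by
  have hc : Continuous (fderiv ℝ v) := hv.continuous_fderiv one_ne_zero
  have hd : ∀ t : ℝ, HasDerivAt (fun t : ℝ => v ((1 - t) • z + t • z'))
      (fderiv ℝ v ((1 - t) • z + t • z') (z' - z)) t := by
    intro t
    have h1 : HasDerivAt (fun t : ℝ => (1 - t) • z + t • z') (z' - z) t := by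
      have := (((hasDerivAt_id t).const_sub 1).smul_const z).add
        ((hasDerivAt_id t).smul_const z')
      convert! this using 1
      simp [sub_eq_neg_add]
    exact ((hv.differentiable one_ne_zero _).hasFDerivAt.comp_hasDerivAt t h1)
  have hcont : Continuous fun t : ℝ => fderiv ℝ v ((1 - t) • z + t • z') := by fun_prop
  have h1 : v z' - v z = ∫ t in (0 : ℝ)..1, fderiv ℝ v ((1 - t) • z + t • z') (z' - z) := by
    rw [intervalIntegral.integral_eq_sub_of_hasDerivAt (fun t _ => hd t)
      ((hcont.clm_apply continuous_const).intervalIntegrable _ _)]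
    simp
  have h2 : (v z - v z') ^ 2 ≤ ∫ t in Set.Icc (0 : ℝ) 1,
      (‖z - z'‖ ^ 2) * ‖fderiv ℝ v ((1 - t) • z + t • z')‖ ^ 2 := by
    rw [show (v z - v z') ^ 2 = (v z' - v z) ^ 2 by ring, h1,
      intervalIntegral.integral_of_le zero_le_one, ← integral_Icc_eq_integral_Ioc]
    have : IsProbabilityMeasure (volume.restrict (Set.Icc (0 : ℝ) 1)) := ⟨by simp⟩
    have hint : ∀ g : ℝ → ℝ, Continuous g → IntegrableOn g (Set.Icc (0 : ℝ) 1) :=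
      fun g hg => hg.continuousOn.integrableOn_compact isCompact_Icc
    refine (ConvexOn.map_integral_le (even_two.convexOn_pow : ConvexOn ℝ Set.univ fun x : ℝ => x ^ 2)
      (by fun_prop) isClosed_univ (by simp) (hint _ (by fun_prop))
      (hint _ (by fun_prop))).trans ?_
    refine integral_mono (hint _ (by fun_prop)) (hint _ (by fun_prop)) fun t => ?_
    have := (fderiv ℝ v ((1 - t) • z + t • z')).le_opNorm (z' - z)
    rw [← mul_pow, ← sq_abs, ← Real.norm_eq_abs, norm_sub_rev z, mul_comm]
    gcongr
  refine (ENNReal.ofReal_le_ofReal h2).trans_eq ?_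
  rw [integral_const_mul, ENNReal.ofReal_mul (by positivity),
    ofReal_integral_eq_lintegral_ofReal]
  · have : Continuous fun t : ℝ => ‖fderiv ℝ v ((1 - t) • z + t • z')‖ ^ 2 := by fun_prop
    exact this.continuousOn.integrableOn_compact isCompact_Icc
  · exact ae_of_all _ fun t => by positivity

/-- The Poincaré inequality on a convex set of diameter at most `d`, in terms of pairs of points.
The constant is not optimal, but depends on the dimension and on the diameter only. -/
lemma convex_poincare {S : Set (Vec m)} (hS : Convex ℝ S) (hSm : MeasurableSet S) {d : ℝ}
    (hd : ∀ z ∈ S, ∀ z' ∈ S, ‖z - z'‖ ≤ d) {v : Vec m → ℝ} (hv : ContDiff ℝ 1 v) :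
    ∫⁻ z in S, ∫⁻ z' in S, ENNReal.ofReal ((v z - v z') ^ 2)
      ≤ ENNReal.ofReal (d ^ 2 * 2 ^ m) * volume S *
        ∫⁻ z in S, ENNReal.ofReal (‖fderiv ℝ v z‖ ^ 2) := by
  have hc : Continuous (fderiv ℝ v) := hv.continuous_fderiv one_ne_zero
  set h : Vec m → ℝ≥0∞ := fun x => ENNReal.ofReal (‖fderiv ℝ v x‖ ^ 2) with hh
  have hm : Measurable h := by
    have : Continuous fun x => ‖fderiv ℝ v x‖ ^ 2 := by fun_prop
    exact this.measurable.ennreal_ofReal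
  calc ∫⁻ z in S, ∫⁻ z' in S, ENNReal.ofReal ((v z - v z') ^ 2)
      ≤ ∫⁻ z in S, ∫⁻ z' in S, ENNReal.ofReal (d ^ 2) *
          ∫⁻ t in Set.Icc (0 : ℝ) 1, h ((1 - t) • z + t • z') := by
        refine setLIntegral_mono' hSm fun z hz => setLIntegral_mono' hSm fun z' hz' => ?_
        refine (sq_sub_le_lintegral_segment hv z z').trans ?_
        gcongr
        exact hd z hz z' hz'
    _ = ENNReal.ofReal (d ^ 2) * ∫⁻ t in Set.Icc (0 : ℝ) 1, ∫⁻ z in S, ∫⁻ z' in S,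
          h ((1 - t) • z + t • z') := by
        have m3 : Measurable fun p : (Vec m × Vec m) × ℝ =>
            h ((1 - p.2) • p.1.1 + p.2 • p.1.2) := hm.comp (by fun_prop)
        rw [← lintegral_lintegral_lintegral_rotate _ _ m3]
        exact lintegral_lintegral_const_mul _ _ _ m3.lintegral_prod_right'
    _ ≤ ENNReal.ofReal (d ^ 2) * ∫⁻ _ in Set.Icc (0 : ℝ) 1,
          2 ^ m * volume S * ∫⁻ x in S, h x := by
        refine mul_le_mul_right (setLIntegral_mono measurable_const fun t ht => ?_) _
        exact lintegral_lintegral_convexComb_le hS hSm hm ht.1 ht.2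
    _ = _ := by
        rw [setLIntegral_const, Real.volume_Icc, ENNReal.ofReal_mul (by positivity),
          ENNReal.ofReal_pow (by norm_num) m]
        simp only [sub_zero, ENNReal.ofReal_one, mul_one, ENNReal.ofReal_ofNat]
        ring

end ConvexPoincare

/-! ### The Gaussian Poincaré inequality -/

lemma lintegral_lintegral_sq_sub {α : Type*} [MeasurableSpace α] (ν : Measure α)
    [IsProbabilityMeasure ν] {F : α → ℝ} (hF : MemLp F 2 ν) :
    ∫⁻ z, ∫⁻ z', ENNReal.ofReal ((F z - F z') ^ 2) ∂ν ∂ν = ENNReal.ofReal (2 * Var[F; ν]) := by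
  have hi : Integrable F ν := hF.integrable one_le_two
  have hi2 : Integrable (fun z => F z ^ 2) ν := hF.integrable_sq
  have hI : ∀ z, Integrable (fun z' => (F z - F z') ^ 2) ν := fun z =>
    (((memLp_const (F z)).sub hF).integrable_sq)
  have e1 : ∀ z, ∫ z', (F z - F z') ^ 2 ∂ν
      = F z ^ 2 - 2 * F z * ∫ z', F z' ∂ν + ∫ z', F z' ^ 2 ∂ν := by
    intro z
    have : ∀ z', (F z - F z') ^ 2 = F z ^ 2 - 2 * F z * F z' + F z' ^ 2 := fun z' => by ring
    simp_rw [this]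
    have j1 : Integrable (fun z' => 2 * F z * F z') ν := hi.const_mul _
    have j2 : Integrable (fun z' => F z ^ 2 - 2 * F z * F z') ν := (integrable_const _).sub j1
    rw [integral_add j2 hi2, integral_sub (integrable_const _) j1, integral_const_mul]
    simp
  have e2 : ∀ z, ∫⁻ z', ENNReal.ofReal ((F z - F z') ^ 2) ∂ν
      = ENNReal.ofReal (F z ^ 2 - 2 * F z * ∫ z', F z' ∂ν + ∫ z', F z' ^ 2 ∂ν) := fun z => by
    rw [← e1, ofReal_integral_eq_lintegral_ofReal (hI z) (ae_of_all _ fun _ => sq_nonneg _)]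
  simp_rw [e2]
  have i2 : Integrable (fun z => 2 * F z * ∫ z', F z' ∂ν) ν := (hi.const_mul 2).mul_const _
  have i3 : Integrable (fun z => F z ^ 2 - 2 * F z * ∫ z', F z' ∂ν) ν := hi2.sub i2
  have i4 : Integrable (fun z => F z ^ 2 - 2 * F z * ∫ z', F z' ∂ν + ∫ z', F z' ^ 2 ∂ν) ν :=
    i3.add (integrable_const _)
  rw [← ofReal_integral_eq_lintegral_ofReal i4
    (ae_of_all _ fun z => by
      beta_reduce; rw [← e1]; exact integral_nonneg fun _ => sq_nonneg _)]
  congr 1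
  rw [integral_add i3 (integrable_const _), integral_sub hi2 i2, integral_mul_const,
    integral_const_mul, variance_eq_sub hF]
  simp
  ring

section GaussianPoincare

variable {m : ℕ} {ρ : Vec m → ℝ}

lemma IsStdNormal.pos (h : IsStdNormal ρ) (x : Vec m) : 0 < ρ x := by
  rw [h x]; positivity

lemma IsStdNormal.contDiff (h : IsStdNormal ρ) : ContDiff ℝ ∞ ρ := by
  rw [show ρ = _ from funext h]
  exact contDiff_const.mul (((contDiff_norm_sq ℝ).neg.div_const 2).exp)

lemma IsStdNormal.integrable (h : IsStdNormal ρ) : Integrable ρ := by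
  rw [show ρ = _ from funext h]
  refine Integrable.const_mul ?_ _
  have := (GaussianFourier.integrable_cexp_neg_mul_sq_norm_add (V := Vec m)
    (b := 1 / 2) (by norm_num) 0 0).norm
  refine this.congr (ae_of_all _ fun x => ?_)
  simp only [Complex.norm_exp]
  congr 1
  simp [← Complex.ofReal_pow]
  ring

lemma integral_densityMeasure (hm : Measurable ρ) (h0 : ∀ x, 0 ≤ ρ x) (F : Vec m → ℝ) :
    ∫ x, F x ∂(densityMeasure ρ) = ∫ x, ρ x * F x := by
  rw [densityMeasure, integral_withDensity_eq_integral_toReal_smul hm.ennreal_ofReal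
    (ae_of_all _ fun _ => ENNReal.ofReal_lt_top)]
  simp [ENNReal.toReal_ofReal (h0 _)]

/-- The density is that of Mathlib's `stdGaussian`: the characteristic functions agree. -/
lemma IsStdNormal.densityMeasure_eq (h : IsStdNormal ρ) :
    densityMeasure ρ = stdGaussian (Vec m) := by
  have hm : Measurable ρ := h.contDiff.continuous.measurable
  have : IsFiniteMeasure (densityMeasure ρ) := by
    refine ⟨?_⟩
    rw [densityMeasure, withDensity_apply _ MeasurableSet.univ, setLIntegral_univ]
    exact (hasFiniteIntegral_iff_ofReal (ae_of_all _ fun x => (h.pos x).le)).1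
      h.integrable.hasFiniteIntegral
  refine Measure.ext_of_charFun (funext fun t => ?_)
  rw [charFun_stdGaussian, charFun_apply, densityMeasure,
    integral_withDensity_eq_integral_toReal_smul hm.ennreal_ofReal
    (ae_of_all _ fun _ => ENNReal.ofReal_lt_top)]
  have e : ∀ x : Vec m, (ENNReal.ofReal (ρ x)).toReal • Complex.exp (inner ℝ x t * Complex.I)
      = ((Real.sqrt (2 * Real.pi) ^ m)⁻¹ : ℂ) *
        Complex.exp (-(1 / 2 : ℂ) * ‖x‖ ^ 2 + Complex.I * inner ℝ t x) := by
    intro x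
    rw [ENNReal.toReal_ofReal (h.pos x).le, h x, Complex.exp_add, real_inner_comm,
      Complex.real_smul]
    push_cast
    rw [mul_assoc]
    congr 2
    · congr 1; ring
    · congr 1; ring
  simp_rw [e]
  rw [integral_const_mul, GaussianFourier.integral_cexp_neg_mul_sq_norm_add (by norm_num)]
  have e2 : ((Real.pi : ℂ) / (1 / 2)) ^ (Module.finrank ℝ (Vec m) / 2 : ℂ)
      = (Real.sqrt (2 * Real.pi) ^ m : ℂ) := by
    have hpi : (0 : ℝ) ≤ 2 * Real.pi := by positivity
    rw [show (Real.pi : ℂ) / (1 / 2) = ((2 * Real.pi : ℝ) : ℂ) by push_cast; ring,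
      show (Module.finrank ℝ (Vec m) / 2 : ℂ) = ((m / 2 : ℝ) : ℂ) by simp,
      ← Complex.ofReal_cpow hpi, ← Complex.ofReal_pow]
    congr 1
    rw [Real.sqrt_eq_rpow, ← Real.rpow_natCast, ← Real.rpow_mul hpi]
    congr 1; ring
  rw [e2, ← mul_assoc, inv_mul_cancel₀, one_mul]
  · congr 1
    rw [Complex.I_sq]; ring
  · have : (0 : ℝ) < Real.sqrt (2 * Real.pi) ^ m := by positivity
    exact_mod_cast this.ne'

lemma IsStdNormal.isProbabilityMeasure (h : IsStdNormal ρ) :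
    IsProbabilityMeasure (densityMeasure ρ) := by
  rw [h.densityMeasure_eq]; infer_instance

lemma IsStdNormal.fderiv_apply (h : IsStdNormal ρ) (x w : Vec m) :
    fderiv ℝ ρ x w = - inner ℝ w x * ρ x := by
  have h1 : HasFDerivAt (fun x : Vec m => -‖x‖ ^ 2 / 2) (-(innerSL ℝ x)) x := by
    have := ((hasStrictFDerivAt_norm_sq x).hasFDerivAt.neg).const_mul (1 / 2 : ℝ)
    convert! this using 1
    · ext y; simp only [Pi.neg_apply]; ring
    · ext y; simp
  have h2 := h1.exp.const_mul ((Real.sqrt (2 * Real.pi) ^ m)⁻¹)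
  have h3 : HasFDerivAt ρ _ x := h2.congr_of_eventuallyEq (Eventually.of_forall h)
  rw [h3.fderiv, h x]
  simp [real_inner_comm]
  ring

/-- Stein's identity, i.e. integration by parts against the Gaussian density. -/
lemma IsStdNormal.stein (h : IsStdNormal ρ) {F : Vec m → ℝ} (hF : ContDiff ℝ 1 F)
    {B : ℝ} (hB : ∀ x, ‖F x‖ ≤ B) {B' : ℝ} (hB' : ∀ x, ‖fderiv ℝ F x‖ ≤ B') (w : Vec m) :
    ∫ x, F x * inner ℝ w x ∂(densityMeasure ρ)
      = ∫ x, fderiv ℝ F x w ∂(densityMeasure ρ) := by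
  have hm : Measurable ρ := h.contDiff.continuous.measurable
  have h0 : ∀ x, 0 ≤ ρ x := fun x => (h.pos x).le
  have hid : Integrable (fun x => inner ℝ w x * ρ x) := by
    have h1 : Integrable (fun x : Vec m => inner ℝ w x) (densityMeasure ρ) := by
      rw [h.densityMeasure_eq]
      exact (IsGaussian.integrable_id (μ := stdGaussian (Vec m))).const_inner w
    rw [densityMeasure, integrable_withDensity_iff_integrable_smul' hm.ennreal_ofReal
      (ae_of_all _ fun _ => ENNReal.ofReal_lt_top)] at h1
    refine h1.congr (ae_of_all _ fun x => ?_)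
    simp [ENNReal.toReal_ofReal (h0 x), mul_comm]
  have hcF : Continuous F := hF.continuous
  have hcF' : Continuous (fderiv ℝ F) := hF.continuous_fderiv one_ne_zero
  have hibp := integral_mul_fderiv_eq_neg_fderiv_mul_of_integrable (μ := volume)
    (f := F) (g := ρ) (v := w) ?_ ?_ ?_ (fun x _ => hF.differentiable one_ne_zero x)
    (fun x _ => h.contDiff.differentiable (by simp) x)
  · rw [integral_densityMeasure hm h0, integral_densityMeasure hm h0]
    have e1 : ∫ x, ρ x * (F x * inner ℝ w x) = - ∫ x, F x * fderiv ℝ ρ x w := by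
      rw [← integral_neg]
      congr 1; ext x; rw [h.fderiv_apply]; ring
    rw [e1, hibp, neg_neg]
    congr 1; ext x; ring
  · refine Integrable.bdd_mul (c := B' * ‖w‖) h.integrable ?_ (ae_of_all _ fun x => ?_)
    · exact (hcF'.clm_apply continuous_const).aestronglyMeasurable
    · exact ((fderiv ℝ F x).le_opNorm w).trans (by gcongr; exact hB' x)
  · refine Integrable.bdd_mul (c := B) ?_ hcF.aestronglyMeasurable (ae_of_all _ hB)
    refine hid.neg.congr (ae_of_all _ fun x => ?_)
    simp [h.fderiv_apply]
  · exact Integrable.bdd_mul (c := B) h.integrable hcF.aestronglyMeasurable (ae_of_all _ hB)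

lemma IsStdNormal.measurePreserving_rotation (h : IsStdNormal ρ) (θ : ℝ) :
    MeasurePreserving (ContinuousLinearMap.rotation (E := Vec m) θ)
      ((densityMeasure ρ).prod (densityMeasure ρ))
      ((densityMeasure ρ).prod (densityMeasure ρ)) := by
  rw [h.densityMeasure_eq]
  exact ⟨(ContinuousLinearMap.rotation θ).continuous.measurable,
    IsGaussian.map_rotation_eq_self (by simp) θ⟩

/-- The pairing of the two gradients, in the form in which it occurs after integrating by parts. -/
lemma abs_fderiv_toDual_symm_le (A B : Vec m →L[ℝ] ℝ) :
    |A ((InnerProductSpace.toDual ℝ (Vec m)).symm B)| ≤ (‖A‖ ^ 2 + ‖B‖ ^ 2) / 2 := by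
  have h1 := A.le_opNorm ((InnerProductSpace.toDual ℝ (Vec m)).symm B)
  rw [LinearIsometryEquiv.norm_map, Real.norm_eq_abs] at h1
  nlinarith [sq_nonneg (‖A‖ - ‖B‖)]

lemma integrable_fderiv_toDual_symm {u : Vec m → ℝ} (hu : ContDiff ℝ 1 u) {B' : ℝ}
    (hB' : ∀ x, ‖fderiv ℝ u x‖ ≤ B') (θ : ℝ) {μ : Measure (Vec m × Vec m)} [IsFiniteMeasure μ] :
    Integrable (fun p : Vec m × Vec m => fderiv ℝ u (Real.cos θ • p.1 - Real.sin θ • p.2)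
      ((InnerProductSpace.toDual ℝ (Vec m)).symm (fderiv ℝ u p.1))) μ := by
  have hcu' : Continuous (fderiv ℝ u) := hu.continuous_fderiv one_ne_zero
  refine Integrable.of_bound (C := (B' ^ 2 + B' ^ 2) / 2) ?_ (ae_of_all _ fun p => ?_)
  · exact ((hcu'.comp (by fun_prop)).clm_apply ((LinearIsometryEquiv.continuous _).comp
      (hcu'.comp continuous_fst))).aestronglyMeasurable
  · refine (abs_fderiv_toDual_symm_le _ _).trans ?_
    gcongr <;> exact hB' _

/-- The derivative of the rotational interpolation `θ ↦ 𝔼[u(x) u(x cos θ + y sin θ)]`: rotating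
`(x, y)` makes `∇u(x cos θ + y sin θ)` depend on the first variable alone, so that Stein's
identity applies in the second one. -/
lemma IsStdNormal.hasDerivAt_interpolation (h : IsStdNormal ρ) {u : Vec m → ℝ}
    (hu : ContDiff ℝ 1 u) {B : ℝ} (hB : ∀ x, ‖u x‖ ≤ B) {B' : ℝ}
    (hB' : ∀ x, ‖fderiv ℝ u x‖ ≤ B') (θ : ℝ) :
    HasDerivAt (fun θ : ℝ => ∫ p : Vec m × Vec m, u p.1 * u (Real.cos θ • p.1 + Real.sin θ • p.2)
        ∂((densityMeasure ρ).prod (densityMeasure ρ)))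
      (-Real.sin θ * ∫ p : Vec m × Vec m, fderiv ℝ u (Real.cos θ • p.1 - Real.sin θ • p.2)
          ((InnerProductSpace.toDual ℝ (Vec m)).symm (fderiv ℝ u p.1))
        ∂((densityMeasure ρ).prod (densityMeasure ρ))) θ := by
  have hP := h.isProbabilityMeasure
  set μ := densityMeasure ρ with hμ
  have hcu : Continuous u := hu.continuous
  have hcu' : Continuous (fderiv ℝ u) := hu.continuous_fderiv one_ne_zero
  have hB0 : 0 ≤ B := (norm_nonneg _).trans (hB 0)
  have hB0' : 0 ≤ B' := (norm_nonneg _).trans (hB' 0)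
  have hnorm : Integrable (fun x : Vec m => ‖x‖) μ := by
    rw [hμ, h.densityMeasure_eq]
    exact (IsGaussian.integrable_id (μ := stdGaussian (Vec m))).norm
  have hd := hasDerivAt_integral_of_dominated_loc_of_deriv_le (μ := μ.prod μ) (x₀ := θ)
    (F := fun θ p => u p.1 * u (Real.cos θ • p.1 + Real.sin θ • p.2))
    (F' := fun θ p => u p.1 * fderiv ℝ u (Real.cos θ • p.1 + Real.sin θ • p.2)
      (-Real.sin θ • p.1 + Real.cos θ • p.2))
    (bound := fun p => B * (B' * (‖p.1‖ + ‖p.2‖))) univ_mem ?_ ?_ ?_ ?_ ?_ ?_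
  · convert! hd.2 using 1
    set G : Vec m × Vec m → ℝ := fun q =>
      u (Real.cos θ • q.1 - Real.sin θ • q.2) * fderiv ℝ u q.1 q.2 with hG
    have hGc : Continuous G := by
      rw [hG]; exact (hcu.comp (by fun_prop)).mul
        ((hcu'.comp continuous_fst).clm_apply continuous_snd)
    have e1 : ∀ p : Vec m × Vec m, u p.1 * fderiv ℝ u (Real.cos θ • p.1 + Real.sin θ • p.2)
        (-Real.sin θ • p.1 + Real.cos θ • p.2) = G (ContinuousLinearMap.rotation θ p) := by
      intro p
      simp only [hG, ContinuousLinearMap.rotation_apply]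
      congr 2
      have hcs := Real.cos_sq_add_sin_sq θ
      rw [show Real.cos θ • (Real.cos θ • p.1 + Real.sin θ • p.2)
        - Real.sin θ • (-Real.sin θ • p.1 + Real.cos θ • p.2)
        = (Real.cos θ ^ 2 + Real.sin θ ^ 2) • p.1 by module, hcs, one_smul]
    have hGi : Integrable G (μ.prod μ) := by
      refine Integrable.mono' ((hnorm.comp_snd μ).const_mul (B * B')) hGc.aestronglyMeasurable
        (ae_of_all _ fun q => ?_)
      rw [hG, norm_mul, mul_assoc]
      exact mul_le_mul (hB _) (((fderiv ℝ u q.1).le_opNorm _).trans (by gcongr; exact hB' _))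
        (norm_nonneg _) hB0
    have e3 := integrable_fderiv_toDual_symm (μ := μ.prod μ) hu hB' θ
    rw [integral_congr_ae (ae_of_all _ e1),
      ← integral_map (f := G) (ContinuousLinearMap.rotation θ).continuous.aemeasurable
        hGc.aestronglyMeasurable, (h.measurePreserving_rotation θ).map_eq, integral_prod _ hGi,
      integral_prod _ e3, ← integral_const_mul]
    refine integral_congr_ae (ae_of_all _ fun x => ?_)
    set w := (InnerProductSpace.toDual ℝ (Vec m)).symm (fderiv ℝ u x) with hw
    have hFd : ∀ y, HasFDerivAt (fun y => u (Real.cos θ • x - Real.sin θ • y))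
        (-Real.sin θ • fderiv ℝ u (Real.cos θ • x - Real.sin θ • y)) y := by
      intro y
      have h1 : HasFDerivAt (fun y : Vec m => Real.cos θ • x - Real.sin θ • y)
          (-(Real.sin θ • ContinuousLinearMap.id ℝ (Vec m))) y :=
        ((hasFDerivAt_id y).const_smul (Real.sin θ)).const_sub _
      have h2 := ((hu.differentiable one_ne_zero _).hasFDerivAt).comp y h1
      convert! h2 using 1
      ext v; simp
    have hst := h.stein (F := fun y => u (Real.cos θ • x - Real.sin θ • y))
      (hu.comp (contDiff_const.sub (contDiff_id.const_smul _))) (fun y => hB _)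
      (B' := |Real.sin θ| * B') (fun y => by
        rw [(hFd y).fderiv, norm_smul, norm_neg, Real.norm_eq_abs]; gcongr; exact hB' _) w
    have e4 : ∀ y, G (x, y) = u (Real.cos θ • x - Real.sin θ • y) * inner ℝ w y := by
      intro y
      rw [hw, InnerProductSpace.toDual_symm_apply]
    beta_reduce
    rw [← integral_const_mul, integral_congr_ae (ae_of_all _ e4), hst]
    refine integral_congr_ae (ae_of_all _ fun y => ?_)
    simp [(hFd y).fderiv, hw]
  · exact Eventually.of_forall fun θ =>
      ((hcu.comp continuous_fst).mul (hcu.comp (by fun_prop))).aestronglyMeasurable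
  · refine Integrable.of_bound (C := B * B) ?_ (ae_of_all _ fun p => ?_)
    · exact ((hcu.comp continuous_fst).mul (hcu.comp (by fun_prop))).aestronglyMeasurable
    · rw [norm_mul]; exact mul_le_mul (hB _) (hB _) (norm_nonneg _) hB0
  · exact ((hcu.comp continuous_fst).mul ((hcu'.comp (by fun_prop)).clm_apply
      (by fun_prop))).aestronglyMeasurable
  · refine ae_of_all _ fun p θ _ => ?_
    rw [norm_mul]
    refine mul_le_mul (hB _) (((fderiv ℝ u _).le_opNorm _).trans ?_) (norm_nonneg _) hB0
    refine mul_le_mul (hB' _) ((norm_add_le _ _).trans ?_) (norm_nonneg _) hB0'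
    rw [norm_smul, norm_smul, norm_neg]
    exact add_le_add (mul_le_of_le_one_left (norm_nonneg _) (Real.abs_sin_le_one _))
      (mul_le_of_le_one_left (norm_nonneg _) (Real.abs_cos_le_one _))
  · exact (((hnorm.comp_fst μ).add (hnorm.comp_snd μ)).const_mul _).const_mul _
  · refine ae_of_all _ fun p θ _ => ?_
    refine HasDerivAt.const_mul _ ?_
    have h1 : HasDerivAt (fun θ : ℝ => Real.cos θ • p.1 + Real.sin θ • p.2)
        (-Real.sin θ • p.1 + Real.cos θ • p.2) θ :=
      ((Real.hasDerivAt_cos θ).smul_const p.1).add ((Real.hasDerivAt_sin θ).smul_const p.2)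
    exact (hu.differentiable one_ne_zero _).hasFDerivAt.comp_hasDerivAt θ h1

lemma IsStdNormal.integral_sq_sub_sq_integral_le (h : IsStdNormal ρ) {u : Vec m → ℝ}
    (hu : ContDiff ℝ 1 u) {B : ℝ} (hB : ∀ x, ‖u x‖ ≤ B) {B' : ℝ}
    (hB' : ∀ x, ‖fderiv ℝ u x‖ ≤ B') :
    ∫ x, u x * u x ∂(densityMeasure ρ)
      - (∫ x, u x ∂(densityMeasure ρ)) * ∫ x, u x ∂(densityMeasure ρ)
      ≤ ∫ x, ‖fderiv ℝ u x‖ ^ 2 ∂(densityMeasure ρ) := by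
  have hP := h.isProbabilityMeasure
  have hder := h.hasDerivAt_interpolation hu hB hB'
  set μ := densityMeasure ρ with hμ
  have hcu : Continuous u := hu.continuous
  have hcu' : Continuous (fderiv ℝ u) := hu.continuous_fderiv one_ne_zero
  set A := ∫ x, ‖fderiv ℝ u x‖ ^ 2 ∂μ with hA
  set Ψ : ℝ → ℝ := fun θ => ∫ p : Vec m × Vec m,
    u p.1 * u (Real.cos θ • p.1 + Real.sin θ • p.2) ∂(μ.prod μ) with hΨ
  have hsq : ∀ L : Vec m × Vec m → Vec m, Continuous L →
      Integrable (fun p => ‖fderiv ℝ u (L p)‖ ^ 2) (μ.prod μ) := by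
    intro L hL
    refine Integrable.of_bound (C := B' ^ 2) ?_ (ae_of_all _ fun p => ?_)
    · exact ((hcu'.comp hL).norm.pow 2).aestronglyMeasurable
    · rw [norm_pow, norm_norm]; gcongr; exact hB' _
  have hfst : ∫ p : Vec m × Vec m, ‖fderiv ℝ u p.1‖ ^ 2 ∂(μ.prod μ) = A := by
    rw [integral_fun_fst (fun x => ‖fderiv ℝ u x‖ ^ 2)]; simp [hA]
  -- a rotated Gaussian vector is Gaussian
  have hrot : ∀ θ : ℝ, ∫ p : Vec m × Vec m,
      ‖fderiv ℝ u (Real.cos θ • p.1 - Real.sin θ • p.2)‖ ^ 2 ∂(μ.prod μ) = A := by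
    intro θ
    have h1 := integral_map (μ := μ.prod μ) (φ := ContinuousLinearMap.rotation (-θ))
      (f := fun p : Vec m × Vec m => ‖fderiv ℝ u p.1‖ ^ 2)
      (ContinuousLinearMap.rotation (-θ)).continuous.aemeasurable
      ((hcu'.comp continuous_fst).norm.pow 2).aestronglyMeasurable
    rw [(h.measurePreserving_rotation (-θ)).map_eq, hfst] at h1
    rw [h1]
    simp [ContinuousLinearMap.rotation_apply, sub_eq_add_neg]
  have hbound : ∀ θ : ℝ, ∫ p : Vec m × Vec m,
      fderiv ℝ u (Real.cos θ • p.1 - Real.sin θ • p.2)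
        ((InnerProductSpace.toDual ℝ (Vec m)).symm (fderiv ℝ u p.1)) ∂(μ.prod μ) ≤ A := by
    intro θ
    have i1 := hsq (fun p => Real.cos θ • p.1 - Real.sin θ • p.2) (by fun_prop)
    have i2 := hsq (fun p => p.1) continuous_fst
    calc _ ≤ ∫ p : Vec m × Vec m, (‖fderiv ℝ u (Real.cos θ • p.1 - Real.sin θ • p.2)‖ ^ 2
            + ‖fderiv ℝ u p.1‖ ^ 2) / 2 ∂(μ.prod μ) := by
          refine integral_mono (integrable_fderiv_toDual_symm hu hB' θ)
            ((i1.add i2).div_const 2) fun p => ?_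
          exact (le_abs_self _).trans (abs_fderiv_toDual_symm_le _ _)
      _ = A := by
          rw [integral_div, integral_add i1 i2, hrot, hfst]; ring
  -- the derivative of the interpolation is at least `-A sin θ`, that of `A cos θ`
  have hmono : MonotoneOn (fun θ => Ψ θ - A * Real.cos θ) (Set.Icc 0 (Real.pi / 2)) := by
    have hd : ∀ θ, HasDerivAt (fun θ => Ψ θ - A * Real.cos θ) _ θ := fun θ =>
      (hder θ).sub ((Real.hasDerivAt_cos θ).const_mul A)
    refine monotoneOn_of_deriv_nonneg (convex_Icc _ _)
      (fun θ _ => (hd θ).continuousAt.continuousWithinAt)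
      (fun θ _ => (hd θ).differentiableAt.differentiableWithinAt) fun θ hθ => ?_
    rw [interior_Icc] at hθ
    rw [(hd θ).deriv]
    have hs : 0 ≤ Real.sin θ := Real.sin_nonneg_of_nonneg_of_le_pi hθ.1.le
      (by linarith [hθ.2, Real.pi_pos])
    nlinarith [hbound θ]
  have h0 := hmono (Set.left_mem_Icc.2 (by positivity)) (Set.right_mem_Icc.2 (by positivity))
    (by positivity : (0 : ℝ) ≤ Real.pi / 2)
  have e0 : Ψ 0 = ∫ x, u x * u x ∂μ := by
    simp only [hΨ, Real.cos_zero, Real.sin_zero, one_smul, zero_smul, add_zero]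
    rw [integral_fun_fst (fun x => u x * u x)]; simp
  have e1 : Ψ (Real.pi / 2) = (∫ x, u x ∂μ) * ∫ x, u x ∂μ := by
    simp only [hΨ, Real.cos_pi_div_two, Real.sin_pi_div_two, one_smul, zero_smul, zero_add]
    exact integral_prod_mul u u
  simp only [e0, e1, Real.cos_zero, Real.cos_pi_div_two] at h0
  linarith

/-- The Gaussian Poincaré inequality with its optimal constant, in terms of pairs of points. -/
lemma IsStdNormal.poincare (h : IsStdNormal ρ) {u : Vec m → ℝ}
    (hu : ContDiff ℝ 1 u) (hs : HasCompactSupport u) :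
    ∫⁻ z, ∫⁻ z', ENNReal.ofReal ((u z - u z') ^ 2) ∂(densityMeasure ρ) ∂(densityMeasure ρ)
      ≤ 2 * ∫⁻ z, ENNReal.ofReal (‖fderiv ℝ u z‖ ^ 2) ∂(densityMeasure ρ) := by
  have hP := h.isProbabilityMeasure
  have hcu : Continuous u := hu.continuous
  have hcu' : Continuous (fderiv ℝ u) := hu.continuous_fderiv one_ne_zero
  obtain ⟨B, hB⟩ := hs.exists_bound_of_continuous hcu
  obtain ⟨B', hB'⟩ := (hs.fderiv (𝕜 := ℝ)).exists_bound_of_continuous hcu'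
  have hmem : MemLp u 2 (densityMeasure ρ) :=
    MemLp.of_bound hcu.aestronglyMeasurable B (ae_of_all _ hB)
  have hint : Integrable (fun z => ‖fderiv ℝ u z‖ ^ 2) (densityMeasure ρ) := by
    refine Integrable.of_bound (C := B' ^ 2) ((hcu'.norm.pow 2).aestronglyMeasurable)
      (ae_of_all _ fun p => ?_)
    rw [norm_pow, norm_norm]; gcongr; exact hB' _
  rw [lintegral_lintegral_sq_sub _ hmem,
    ← ofReal_integral_eq_lintegral_ofReal hint (ae_of_all _ fun _ => by positivity),
    ENNReal.ofReal_mul (by norm_num), ENNReal.ofReal_ofNat]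
  gcongr
  have := h.integral_sq_sub_sq_integral_le hu hB hB'
  rw [variance_eq_sub hmem]
  simpa [pow_two] using this

end GaussianPoincare

/-! ### The pair energy along the inactive directions -/

section PairEnergy

variable {n k : ℕ} (hk : k ≤ n) (W : Matrix (Fin n) (Fin n) ℝ)

/-- The marginal density `∫ ρ(W₁ y + W₂ z) dz` as an extended nonnegative number. -/
noncomputable def sliceMass (ρ : Vec n → ℝ) (y : Vec k) : ℝ≥0∞ :=
  ∫⁻ z, ENNReal.ofReal (ρ (assemble hk W y z))

/-- The integrand of `pairEnergy`. -/
noncomputable def pairIntegrand (ρ u : Vec n → ℝ) (p : Vec k × Vec (n - k) × Vec (n - k)) : ℝ≥0∞ :=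
  (sliceMass hk W ρ p.1)⁻¹ *
    (ENNReal.ofReal ((u (assemble hk W p.1 p.2.1) - u (assemble hk W p.1 p.2.2)) ^ 2) *
      (ENNReal.ofReal (ρ (assemble hk W p.1 p.2.1)) *
        ENNReal.ofReal (ρ (assemble hk W p.1 p.2.2))))

/-- The expected squared difference of `u` at two points of the same slice `W₁ᵀ x = y`, drawn
independently from the conditional distribution; this is twice the expected conditional
variance of `u` given the active variable. -/
noncomputable def pairEnergy (ρ u : Vec n → ℝ) : ℝ≥0∞ :=
  ∫⁻ p, pairIntegrand hk W ρ u p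

/-- The Poincaré inequality with constant `C`, for smooth functions, on each slice
`{z | W₁ y + W₂ z}` with the weight induced by `ρ`. -/
def SlicePoincare (ρ : Vec n → ℝ) (C : ℝ) : Prop :=
  ∀ (y : Vec k) (v : Vec (n - k) → ℝ), ContDiff ℝ 1 v → HasCompactSupport v →
    ∫⁻ z, ∫⁻ z', ENNReal.ofReal ((v z - v z') ^ 2) *
        (ENNReal.ofReal (ρ (assemble hk W y z)) * ENNReal.ofReal (ρ (assemble hk W y z')))
      ≤ ENNReal.ofReal (2 * C) * sliceMass hk W ρ y *
        ∫⁻ z, ENNReal.ofReal (‖fderiv ℝ v z‖ ^ 2) * ENNReal.ofReal (ρ (assemble hk W y z))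

variable {hk W}

lemma measurable_assemble₂ {δ : Type*} [MeasurableSpace δ] {g₁ : δ → Vec k}
    {g₂ : δ → Vec (n - k)} (h₁ : Measurable g₁) (h₂ : Measurable g₂) :
    Measurable fun x => assemble hk W (g₁ x) (g₂ x) :=
  (continuous_assemble hk).measurable.comp (h₁.prodMk h₂)

lemma measurable_sliceMass {ρ : Vec n → ℝ} (hρ : Measurable ρ) :
    Measurable (sliceMass hk W ρ) :=
  Measurable.lintegral_prod_right' (f := fun p : Vec k × Vec (n - k) =>
    ENNReal.ofReal (ρ (assemble hk W p.1 p.2)))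
    (hρ.comp (measurable_assemble₂ measurable_fst measurable_snd)).ennreal_ofReal

lemma measurable_pairIntegrand_right {ρ u : Vec n → ℝ} (hρ : Measurable ρ) (hu : Measurable u) :
    Measurable fun p : Vec k × Vec (n - k) × Vec (n - k) =>
      ENNReal.ofReal ((u (assemble hk W p.1 p.2.1) - u (assemble hk W p.1 p.2.2)) ^ 2) *
      (ENNReal.ofReal (ρ (assemble hk W p.1 p.2.1)) *
        ENNReal.ofReal (ρ (assemble hk W p.1 p.2.2))) := by
  have m1 : Measurable fun p : Vec k × Vec (n - k) × Vec (n - k) => assemble hk W p.1 p.2.1 :=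
    measurable_assemble₂ (by fun_prop) (by fun_prop)
  have m2 : Measurable fun p : Vec k × Vec (n - k) × Vec (n - k) => assemble hk W p.1 p.2.2 :=
    measurable_assemble₂ (by fun_prop) (by fun_prop)
  exact (((hu.comp m1).sub (hu.comp m2)).pow_const 2).ennreal_ofReal.mul
    ((hρ.comp m1).ennreal_ofReal.mul (hρ.comp m2).ennreal_ofReal)

lemma measurable_pairIntegrand {ρ u : Vec n → ℝ} (hρ : Measurable ρ) (hu : Measurable u) :
    Measurable (pairIntegrand hk W ρ u) :=
  ((measurable_sliceMass hρ).comp measurable_fst).inv.mul (measurable_pairIntegrand_right hρ hu)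

lemma pairEnergy_eq {ρ u : Vec n → ℝ} (hρ : Measurable ρ) (hu : Measurable u) :
    pairEnergy hk W ρ u = ∫⁻ y, (sliceMass hk W ρ y)⁻¹ * ∫⁻ z, ∫⁻ z',
      ENNReal.ofReal ((u (assemble hk W y z) - u (assemble hk W y z')) ^ 2) *
        (ENNReal.ofReal (ρ (assemble hk W y z)) * ENNReal.ofReal (ρ (assemble hk W y z'))) := by
  have hm := measurable_pairIntegrand_right (hk := hk) (W := W) hρ hu
  rw [pairEnergy, Measure.volume_eq_prod,
    lintegral_prod _ (measurable_pairIntegrand hρ hu).aemeasurable]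
  refine lintegral_congr fun y => ?_
  have hy := hm.comp (measurable_prodMk_left (x := y))
  simp only [Function.comp_def] at hy
  simp only [pairIntegrand]
  rw [lintegral_const_mul _ hy, Measure.volume_eq_prod, lintegral_prod _ hy.aemeasurable]

variable (hW : W ∈ Matrix.orthogonalGroup (Fin n) ℝ)
include hW

lemma lintegral_lintegral_assemble {F : Vec n → ℝ≥0∞} (hF : Measurable F) :
    ∫⁻ y, ∫⁻ z, F (assemble hk W y z) = ∫⁻ x, F x := by
  rw [← (measurePreserving_assemble hk hW).lintegral_comp hF, Measure.volume_eq_prod,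
    lintegral_prod]
  exact (hF.comp (measurable_assemble₂ measurable_fst measurable_snd)).aemeasurable

/-- On smooth functions the slicewise Poincaré inequalities integrate to a bound on the pair
energy. -/
lemma pairEnergy_le_of_contDiff {ρ : Vec n → ℝ} {C : ℝ} (hρ : Measurable ρ)
    (hC : SlicePoincare hk W ρ C) {u : Vec n → ℝ} (hu : ContDiff ℝ 1 u)
    (hs : HasCompactSupport u) :
    pairEnergy hk W ρ u ≤ ENNReal.ofReal (2 * C) *
      ∫⁻ x, ENNReal.ofReal (∑ l, fderiv ℝ u x (inactive hk W (EuclideanSpace.single l 1)) ^ 2) *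
        ENNReal.ofReal (ρ x) := by
  have hcu' : Continuous (fderiv ℝ u) := hu.continuous_fderiv one_ne_zero
  have hm : Measurable fun x => ENNReal.ofReal
      (∑ l, fderiv ℝ u x (inactive hk W (EuclideanSpace.single l 1)) ^ 2) *
        ENNReal.ofReal (ρ x) := by
    refine Measurable.mul (Measurable.ennreal_ofReal ?_) hρ.ennreal_ofReal
    have : Continuous fun x =>
        ∑ l, fderiv ℝ u x (inactive hk W (EuclideanSpace.single l 1)) ^ 2 := by fun_prop
    exact this.measurable
  have hm' := (hm.comp (measurable_assemble₂ (hk := hk) (W := W)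
    measurable_fst measurable_snd)).lintegral_prod_right' (ν := volume)
  simp only [Function.comp_def] at hm'
  rw [pairEnergy_eq hρ hu.continuous.measurable, ← lintegral_lintegral_assemble (hk := hk) hW hm,
    ← lintegral_const_mul _ hm']
  refine lintegral_mono fun y => ?_
  have hd : ∀ z, HasFDerivAt (fun z => u (assemble hk W y z))
      ((fderiv ℝ u (assemble hk W y z)).comp (inactive hk W)) z := by
    intro z
    have h1 : HasFDerivAt (fun z => assemble hk W y z) (inactive hk W) z := by
      simp_rw [assemble_eq_add_inactive]
      exact ((inactive hk W).hasFDerivAt).const_add _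
    exact (hu.differentiable one_ne_zero _).hasFDerivAt.comp z h1
  have hcd : ContDiff ℝ 1 fun z => u (assemble hk W y z) := by
    have h1 : ContDiff ℝ 1 fun z => assemble hk W y z :=
      contDiff_const.add (inactive hk W).contDiff
    exact hu.comp h1
  have hcs : HasCompactSupport fun z => u (assemble hk W y z) := by
    have hiso : Isometry fun z => assemble hk W y z :=
      Isometry.of_dist_eq fun z z' => by
        rw [dist_eq_norm, dist_eq_norm, norm_assemble_sub hk hW]
    exact hs.comp_isClosedEmbedding hiso.isClosedEmbedding
  have hn : ∀ z, ‖fderiv ℝ (fun z => u (assemble hk W y z)) z‖ ^ 2 = ∑ l,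
      fderiv ℝ u (assemble hk W y z) (inactive hk W (EuclideanSpace.single l 1)) ^ 2 := by
    intro z
    rw [(hd z).fderiv, (EuclideanSpace.basisFun (Fin (n - k)) ℝ).norm_dual]
    simp
  have hy := hC y _ hcd hcs
  simp_rw [hn] at hy
  refine (mul_le_mul_right hy _).trans ?_
  rw [← mul_assoc, ← mul_assoc, mul_right_comm _ (ENNReal.ofReal (2 * C)), mul_assoc]
  exact mul_le_of_le_one_left zero_le (ENNReal.inv_mul_le_one _)

/-- A property that holds almost everywhere holds at both points of almost every pair. -/
lemma ae_pair_of_ae {P : Vec n → Prop} (hP : ∀ᵐ x, P x) :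
    ∀ᵐ p : Vec k × Vec (n - k) × Vec (n - k),
      P (assemble hk W p.1 p.2.1) ∧ P (assemble hk W p.1 p.2.2) := by
  have q := (measurePreserving_assemble hk hW).quasiMeasurePreserving
  have q1 : Measure.QuasiMeasurePreserving
      (Prod.map id Prod.fst : Vec k × Vec (n - k) × Vec (n - k) → Vec k × Vec (n - k)) := by
    simp only [Measure.volume_eq_prod]
    exact QuasiMeasurePreserving.prodMap (Measure.QuasiMeasurePreserving.id _)
      Measure.quasiMeasurePreserving_fst
  have q2 : Measure.QuasiMeasurePreserving
      (Prod.map id Prod.snd : Vec k × Vec (n - k) × Vec (n - k) → Vec k × Vec (n - k)) := by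
    simp only [Measure.volume_eq_prod]
    exact QuasiMeasurePreserving.prodMap (Measure.QuasiMeasurePreserving.id _)
      Measure.quasiMeasurePreserving_snd
  exact ((q.comp q1).ae hP).and ((q.comp q2).ae hP)

/-- Lower semicontinuity of the pair energy. -/
lemma pairEnergy_le_liminf {ρ f : Vec n → ℝ} {ρ' f' : ℕ → Vec n → ℝ}
    (hρm : ∀ j, Measurable (ρ' j)) (hfm : ∀ j, Measurable (f' j))
    (hle : ∀ j x, ρ' j x ≤ ρ x)
    (hconv : ∀ᵐ x, 0 < ρ x → Tendsto (fun j => f' j x) atTop (𝓝 (f x)) ∧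
      ∀ᶠ j in atTop, ρ' j x = ρ x) :
    pairEnergy hk W ρ f ≤ liminf (fun j => pairEnergy hk W (ρ' j) (f' j)) atTop := by
  refine le_trans ?_ (lintegral_liminf_le fun j => measurable_pairIntegrand (hρm j) (hfm j))
  refine lintegral_mono_ae ?_
  filter_upwards [ae_pair_of_ae hW hconv] with p hp
  set x := assemble hk W p.1 p.2.1 with hx
  set x' := assemble hk W p.1 p.2.2 with hx'
  by_cases h0 : 0 < ρ x ∧ 0 < ρ x'
  · obtain ⟨c1, e1⟩ := hp.1 h0.1
    obtain ⟨c2, e2⟩ := hp.2 h0.2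
    set q := (sliceMass hk W ρ p.1)⁻¹ *
      (ENNReal.ofReal (ρ x) * ENNReal.ofReal (ρ x')) with hq
    have hlim : Tendsto (fun j => ENNReal.ofReal ((f' j x - f' j x') ^ 2)) atTop
        (𝓝 (ENNReal.ofReal ((f x - f x') ^ 2))) :=
      ENNReal.tendsto_ofReal ((c1.sub c2).pow 2)
    have hge : ∀ᶠ j in atTop, q * ENNReal.ofReal ((f' j x - f' j x') ^ 2)
        ≤ pairIntegrand hk W (ρ' j) (f' j) p := by
      filter_upwards [e1, e2] with j h1 h2
      have hmass : sliceMass hk W (ρ' j) p.1 ≤ sliceMass hk W ρ p.1 :=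
        lintegral_mono fun z => ENNReal.ofReal_le_ofReal (hle j _)
      rw [pairIntegrand, ← hx, ← hx', h1, h2, hq, mul_assoc, mul_comm (_ * _) (ENNReal.ofReal _)]
      exact mul_le_mul_left (ENNReal.inv_le_inv.2 hmass) _
    have e3 : pairIntegrand hk W ρ f p = q * ENNReal.ofReal ((f x - f x') ^ 2) := by
      rw [pairIntegrand, ← hx, ← hx', hq]; ring
    rw [e3]
    by_cases hz : ENNReal.ofReal ((f x - f x') ^ 2) = 0
    · rw [hz, mul_zero]; exact zero_le
    · rw [← (ENNReal.Tendsto.const_mul hlim (Or.inl hz)).liminf_eq]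
      exact liminf_le_liminf hge
  · have : pairIntegrand hk W ρ f p = 0 := by
      rw [pairIntegrand, ← hx, ← hx']
      rcases not_and_or.1 h0 with h | h
      · rw [ENNReal.ofReal_of_nonpos (not_lt.1 h)]; simp
      · rw [ENNReal.ofReal_of_nonpos (not_lt.1 h)]; simp
    rw [this]; exact zero_le

end PairEnergy

/-! ### Mollification -/

section Mollification

open scoped Convolution
open ContinuousLinearMap (lsmul)

variable {n : ℕ}

/-- A function that is everywhere differentiable in the direction `v` with integrable derivative
`h` has the weak derivative `h`; hence mollification commutes with differentiation. -/
lemma fderiv_mollify_apply {φ f h : Vec n → ℝ} {v : Vec n} (hφ : ContDiff ℝ ∞ φ)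
    (hφs : HasCompactSupport φ) (hf : Integrable f) (hh : Integrable h)
    (hd : ∀ x, HasLineDerivAt ℝ f (h x) x v) (x : Vec n) :
    fderiv ℝ (φ ⋆[lsmul ℝ ℝ] f) x v = (φ ⋆[lsmul ℝ ℝ] h) x := by
  have hφ1 : ContDiff ℝ 1 φ := hφ.of_le (by simp)
  have hcφ' : Continuous (fderiv ℝ φ) := hφ1.continuous_fderiv one_ne_zero
  have hfx : Integrable fun t => f (x - t) := hf.comp_sub_left x
  have hhx : Integrable fun t => h (x - t) := hh.comp_sub_left x
  obtain ⟨B, hB⟩ := hφs.exists_bound_of_continuous hφ.continuous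
  obtain ⟨B', hB'⟩ := (hφs.fderiv (𝕜 := ℝ)).exists_bound_of_continuous hcφ'
  have hvc : Continuous fun t => fderiv ℝ φ t v := by fun_prop
  rw [(hφs.hasFDerivAt_convolution_left (lsmul ℝ ℝ) hφ1 hf.locallyIntegrable x).fderiv]
  have hce := ((hφs.fderiv (𝕜 := ℝ)).convolutionExists_left
    ((lsmul ℝ ℝ : ℝ →L[ℝ] ℝ →L[ℝ] ℝ).precompL (Vec n)) hcφ' hf.locallyIntegrable) x
  rw [convolution_def, ContinuousLinearMap.integral_apply hce, convolution_def]
  simp only [ContinuousLinearMap.precompL_apply, ContinuousLinearMap.lsmul_apply, smul_eq_mul]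
  have hline : ∀ t, HasLineDerivAt ℝ (fun t => f (x - t)) (-h (x - t)) t v := by
    intro t
    have h1 : HasDerivAt (fun s : ℝ => f (x - t + s • v)) (h (x - t)) (-0) := by
      rw [neg_zero]; exact hd (x - t)
    have h2 := h1.comp_of_eq (0 : ℝ) (hasDerivAt_neg 0) rfl
    have h3 : HasDerivAt (fun s : ℝ => f (x - (t + s • v))) (-h (x - t)) 0 := by
      convert! h2 using 1
      · ext s; simp only [Function.comp]; congr 1; module
      · ring
    exact h3
  have ibp := integral_bilinear_hasLineDerivAt_right_eq_neg_left_of_integrable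
    (μ := (volume : Measure (Vec n))) (f := fun t => f (x - t)) (f' := fun t => -h (x - t))
    (g := φ) (g' := fun t => fderiv ℝ φ t v) (v := v) (B := ContinuousLinearMap.mul ℝ ℝ)
    (hhx.neg.mul_bdd (c := B) hφ.continuous.aestronglyMeasurable (ae_of_all _ hB))
    (hfx.mul_bdd (c := B' * ‖v‖) hvc.aestronglyMeasurable
      (ae_of_all _ fun t => ((fderiv ℝ φ t).le_opNorm v).trans (by gcongr; exact hB' t)))
    (hfx.mul_bdd (c := B) hφ.continuous.aestronglyMeasurable (ae_of_all _ hB))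
    (fun t _ => hline t)
    (fun t _ => (hφ1.differentiable one_ne_zero t).hasFDerivAt.hasLineDerivAt v)
  simp only [ContinuousLinearMap.mul_apply'] at ibp
  calc ∫ t, fderiv ℝ φ t v * f (x - t) = ∫ t, f (x - t) * fderiv ℝ φ t v := by
        simp_rw [mul_comm]
    _ = ∫ t, φ t * h (x - t) := by
        rw [ibp, ← integral_neg]; congr 1; ext t; ring

lemma ofReal_sq_integral_le {α : Type*} [MeasurableSpace α] (ν : Measure α)
    [IsProbabilityMeasure ν] {G : α → ℝ} (hG : AEStronglyMeasurable G ν) :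
    ENNReal.ofReal ((∫ t, G t ∂ν) ^ 2) ≤ ∫⁻ t, ENNReal.ofReal (G t ^ 2) ∂ν := by
  by_cases h : MemLp G 2 ν
  · rw [← ofReal_integral_eq_lintegral_ofReal h.integrable_sq (ae_of_all _ fun _ => sq_nonneg _)]
    refine ENNReal.ofReal_le_ofReal ?_
    have := variance_nonneg G ν
    rw [variance_eq_sub h] at this
    simpa using this
  · have h2 : ¬ Integrable (fun t => G t ^ 2) ν := fun hi =>
      h ((memLp_two_iff_integrable_sq hG).2 hi)
    have h3 : ∫⁻ t, ENNReal.ofReal (G t ^ 2) ∂ν = ⊤ := by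
      by_contra hne
      exact h2 ⟨hG.pow 2, (hasFiniteIntegral_iff_ofReal (ae_of_all _ fun _ => sq_nonneg _)).2
        (lt_top_iff_ne_top.2 hne)⟩
    rw [h3]; exact le_top

lemma ofReal_sq_convolution_le {φ H : Vec n → ℝ} (hφc : Continuous φ) (hφ0 : ∀ t, 0 ≤ φ t)
    (hφ1 : ∫⁻ t, ENNReal.ofReal (φ t) = 1) (hH : Measurable H) (x : Vec n) :
    ENNReal.ofReal ((φ ⋆[lsmul ℝ ℝ] H) x ^ 2)
      ≤ ∫⁻ t, ENNReal.ofReal (φ t) * ENNReal.ofReal (H (x - t) ^ 2) := by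
  have hm : Measurable fun t => H (x - t) := hH.comp (by fun_prop)
  have : IsProbabilityMeasure (densityMeasure φ) := ⟨by
    rw [densityMeasure, withDensity_apply _ MeasurableSet.univ, setLIntegral_univ, hφ1]⟩
  have h1 := ofReal_sq_integral_le (densityMeasure φ) hm.aestronglyMeasurable
  rw [integral_densityMeasure hφc.measurable hφ0] at h1
  rw [convolution_def]
  refine h1.trans_eq ?_
  rw [densityMeasure, lintegral_withDensity_eq_lintegral_mul _ hφc.measurable.ennreal_ofReal
    (hm.pow_const 2).ennreal_ofReal]
  rfl

/-- By Jensen's inequality, mollifying the gradient is dominated by mollifying the weight. -/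
lemma lintegral_sum_sq_convolution_le {ι : Type*} [Fintype ι] {φ ρ : Vec n → ℝ}
    (hφc : Continuous φ) (hφs : HasCompactSupport φ) (hφ0 : ∀ t, 0 ≤ φ t)
    (hφ1 : ∫⁻ t, ENNReal.ofReal (φ t) = 1) (hφe : ∀ t, φ (-t) = φ t)
    (hρ : Measurable ρ) (hρ0 : ∀ x, 0 ≤ ρ x) (hρi : Integrable ρ) {H : ι → Vec n → ℝ}
    (hH : ∀ l, Measurable (H l)) :
    ∫⁻ x, ENNReal.ofReal (∑ l, (φ ⋆[lsmul ℝ ℝ] H l) x ^ 2) * ENNReal.ofReal (ρ x)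
      ≤ ∫⁻ x, ENNReal.ofReal (∑ l, H l x ^ 2) * ENNReal.ofReal ((φ ⋆[lsmul ℝ ℝ] ρ) x) := by
  set S : Vec n → ℝ≥0∞ := fun x => ENNReal.ofReal (∑ l, H l x ^ 2) with hS
  have hSm : Measurable S :=
    (Finset.measurable_sum _ fun l _ => (hH l).pow_const 2).ennreal_ofReal
  have hφm : Measurable fun t => ENNReal.ofReal (φ t) := hφc.measurable.ennreal_ofReal
  calc ∫⁻ x, ENNReal.ofReal (∑ l, (φ ⋆[lsmul ℝ ℝ] H l) x ^ 2) * ENNReal.ofReal (ρ x)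
      ≤ ∫⁻ x, ∫⁻ t, ENNReal.ofReal (φ (x - t)) * S t * ENNReal.ofReal (ρ x) := by
        refine lintegral_mono fun x => ?_
        have e1 : ∫⁻ t, ENNReal.ofReal (φ (x - t)) * S t * ENNReal.ofReal (ρ x)
            = (∫⁻ t, ENNReal.ofReal (φ t) * S (x - t)) * ENNReal.ofReal (ρ x) := by
          have hm : Measurable fun t => ENNReal.ofReal (φ (x - t)) * S t :=
            (hφm.comp (by fun_prop : Measurable fun t => x - t)).mul hSm
          rw [lintegral_mul_const _ hm, ← lintegral_sub_left_eq_self (μ := volume)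
              (fun t => ENNReal.ofReal (φ (x - t)) * S t) x]
          simp
        rw [e1]
        refine mul_le_mul_left ?_ _
        rw [ENNReal.ofReal_sum_of_nonneg fun _ _ => sq_nonneg _]
        refine (Finset.sum_le_sum fun l _ =>
          ofReal_sq_convolution_le hφc hφ0 hφ1 (hH l) x).trans_eq ?_
        rw [← lintegral_finsetSum]
        · refine lintegral_congr fun t => ?_
          simp only [hS]
          rw [← Finset.mul_sum, ENNReal.ofReal_sum_of_nonneg fun _ _ => sq_nonneg _]
        · intro l _
          exact hφm.mul (((hH l).comp (by fun_prop : Measurable fun t => x - t)).pow_const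
            2).ennreal_ofReal
    _ = ∫⁻ t, ∫⁻ x, ENNReal.ofReal (φ (x - t)) * S t * ENNReal.ofReal (ρ x) := by
        rw [lintegral_lintegral_swap]
        exact (((hφm.comp (by fun_prop : Measurable fun p : Vec n × Vec n => p.1 - p.2)).mul
          (hSm.comp measurable_snd)).mul (hρ.ennreal_ofReal.comp measurable_fst)).aemeasurable
    _ = ∫⁻ t, S t * ENNReal.ofReal ((φ ⋆[lsmul ℝ ℝ] ρ) t) := by
        refine lintegral_congr fun t => ?_
        have e1 : ∀ x, ENNReal.ofReal (φ (x - t)) * S t * ENNReal.ofReal (ρ x)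
            = S t * ENNReal.ofReal (φ (t - x) * ρ x) := by
          intro x
          rw [ENNReal.ofReal_mul (hφ0 _), ← hφe (t - x), neg_sub]; ring
        simp_rw [e1]
        have hm : Measurable fun x => φ (t - x) * ρ x :=
          (hφc.measurable.comp (by fun_prop : Measurable fun x => t - x)).mul hρ
        rw [lintegral_const_mul _ hm.ennreal_ofReal,
          ← lintegral_sub_left_eq_self (μ := volume)
            (fun x => ENNReal.ofReal (φ (t - x) * ρ x)) t]
        congr 1
        have hce := hφs.convolutionExists_left (μ := volume) (lsmul ℝ ℝ) hφc hρi.locallyIntegrable t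
        rw [convolution_def, ofReal_integral_eq_lintegral_ofReal hce
          (ae_of_all _ fun s => mul_nonneg (hφ0 _) (hρ0 _))]
        simp

variable {k : ℕ} {hk : k ≤ n} {W : Matrix (Fin n) (Fin n) ℝ}
  (hW : W ∈ Matrix.orthogonalGroup (Fin n) ℝ)
include hW

/-- The slicewise Poincaré inequalities bound the pair energy of every integrable function whose
partial derivatives exist everywhere, and are integrable and square integrable. The gradient
in the inactive directions is formed from the partial derivatives, although `f` need not be
differentiable in these directions. -/
lemma pairEnergy_le_of_hasLineDerivAt {ρ : Vec n → ℝ} {C : ℝ} (hρ : Measurable ρ)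
    (hρ0 : ∀ x, 0 ≤ ρ x) (hρi : Integrable ρ) {M : ℝ} (hρM : ∀ x, ρ x ≤ M)
    (hC : SlicePoincare hk W ρ C) {f : Vec n → ℝ} (hf : Integrable f)
    (hfs : HasCompactSupport f) {h : Fin n → Vec n → ℝ}
    (hhm : ∀ i, Measurable (h i)) (hhi : ∀ i, Integrable (h i)) (hh2 : ∀ i, MemLp (h i) 2)
    (hd : ∀ i x, HasLineDerivAt ℝ f (h i x) x (EuclideanSpace.single i 1)) :
    pairEnergy hk W ρ f ≤ ENNReal.ofReal (2 * C) *
      ∫⁻ x, ENNReal.ofReal (∑ l, (∑ i, cols₂ hk W i l * h i x) ^ 2) * ENNReal.ofReal (ρ x) := by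
  let φ : ℕ → ContDiffBump (0 : Vec n) := fun j =>
    ⟨1 / ((j : ℝ) + 1), 2 / ((j : ℝ) + 1), by positivity, by gcongr; norm_num⟩
  have hφr : Tendsto (fun j => (φ j).rOut) atTop (𝓝 0) := by
    have := (tendsto_one_div_add_atTop_nhds_zero_nat (𝕜 := ℝ)).const_mul 2
    simpa [φ, div_eq_mul_inv] using this
  have hφK : ∀ᶠ j in atTop, (φ j).rOut ≤ 2 * (φ j).rIn :=
    Eventually.of_forall fun j => le_of_eq (by simp [φ]; ring)
  set ψ : ℕ → Vec n → ℝ := fun j => (φ j).normed volume with hψ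
  have hψd : ∀ j, ContDiff ℝ ∞ (ψ j) := fun j => (φ j).contDiff_normed
  have hψs : ∀ j, HasCompactSupport (ψ j) := fun j => (φ j).hasCompactSupport_normed
  have hψ0 : ∀ j t, 0 ≤ ψ j t := fun j t => (φ j).nonneg_normed t
  have hψ1 : ∀ j, ∫⁻ t, ENNReal.ofReal (ψ j t) = 1 := fun j => by
    rw [← ofReal_integral_eq_lintegral_ofReal (φ j).integrable_normed (ae_of_all _ (hψ0 j)),
      (φ j).integral_normed, ENNReal.ofReal_one]
  have hψe : ∀ j t, ψ j (-t) = ψ j t := fun j t => (φ j).normed_neg t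
  set H : Fin (n - k) → Vec n → ℝ := fun l x => ∑ i, cols₂ hk W i l * h i x with hH
  have hHm : ∀ l, Measurable (H l) := fun l =>
    Finset.measurable_sum _ fun i _ => (hhm i).const_mul _
  have hH2 : ∀ l, MemLp (H l) 2 := fun l =>
    memLp_finsetSum _ fun i _ => (hh2 i).const_mul _
  -- the mollified functions
  have hsm : ∀ j, ContDiff ℝ 1 (ψ j ⋆[lsmul ℝ ℝ] f) := fun j =>
    (hψs j).contDiff_convolution_left (n := 1) (lsmul ℝ ℝ) ((hψd j).of_le (by simp))
      hf.locallyIntegrable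
  have hgrad : ∀ j l x, fderiv ℝ (ψ j ⋆[lsmul ℝ ℝ] f) x
      (inactive hk W (EuclideanSpace.single l 1)) = (ψ j ⋆[lsmul ℝ ℝ] H l) x := by
    intro j l x
    rw [inactive_single, map_sum]
    simp only [map_smul, fderiv_mollify_apply (hψd j) (hψs j) hf (hhi _) (hd _), smul_eq_mul]
    simp only [convolution_def, hH, ContinuousLinearMap.lsmul_apply, smul_eq_mul, Finset.mul_sum]
    rw [integral_finsetSum]
    · refine Finset.sum_congr rfl fun i _ => ?_
      rw [← integral_const_mul]
      congr 1; ext t; ring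
    · intro i _
      have hce := (hψs j).convolutionExists_left (μ := volume) (lsmul ℝ ℝ) (hψd j).continuous
        (hhi i).locallyIntegrable x
      have hce' : Integrable fun t => ψ j t * h i (x - t) := hce
      refine (hce'.const_mul (cols₂ hk W i l)).congr (ae_of_all _ fun t => ?_)
      ring
  -- the mollified weights
  have hρj : ∀ j x, (ψ j ⋆[lsmul ℝ ℝ] ρ) x ≤ M := by
    intro j x
    have hce : Integrable fun t => ψ j t * ρ (x - t) :=
      (hψs j).convolutionExists_left (μ := volume) (lsmul ℝ ℝ) (hψd j).continuous
        hρi.locallyIntegrable x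
    calc ∫ t, ψ j t * ρ (x - t) ≤ ∫ t, ψ j t * M :=
          integral_mono hce ((φ j).integrable_normed.mul_const M) fun t =>
            mul_le_mul_of_nonneg_left (hρM _) (hψ0 j t)
      _ = M := by rw [integral_mul_const, (φ j).integral_normed, one_mul]
  set S : Vec n → ℝ≥0∞ := fun x => ENNReal.ofReal (∑ l, H l x ^ 2) with hS
  have hSm : Measurable S :=
    (Finset.measurable_sum _ fun l _ => (hHm l).pow_const 2).ennreal_ofReal
  have hSfin : ∫⁻ x, S x ≠ ⊤ := by
    have hi : Integrable fun x => ∑ l, H l x ^ 2 :=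
      integrable_finsetSum _ fun l _ => (hH2 l).integrable_sq
    exact ((hasFiniteIntegral_iff_ofReal (ae_of_all _ fun x =>
      Finset.sum_nonneg fun _ _ => sq_nonneg _)).1 hi.hasFiniteIntegral).ne
  have hlim : Tendsto (fun j => ∫⁻ x, S x * ENNReal.ofReal ((ψ j ⋆[lsmul ℝ ℝ] ρ) x)) atTop
      (𝓝 (∫⁻ x, S x * ENNReal.ofReal (ρ x))) := by
    refine tendsto_lintegral_of_dominated_convergence (fun x => S x * ENNReal.ofReal M)
      (fun j => ?_) (fun j => ae_of_all _ fun x => ?_) ?_ ?_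
    · exact hSm.mul ((hψs j).contDiff_convolution_left (n := 0) (lsmul ℝ ℝ)
        ((hψd j).of_le (by simp)) hρi.locallyIntegrable).continuous.measurable.ennreal_ofReal
    · exact mul_le_mul_right (ENNReal.ofReal_le_ofReal (hρj j x)) _
    · rw [lintegral_mul_const _ hSm]
      exact ENNReal.mul_ne_top hSfin ENNReal.ofReal_ne_top
    · filter_upwards [ContDiffBump.ae_convolution_tendsto_right_of_locallyIntegrable hφr hφK
        hρi.locallyIntegrable] with x hx
      exact ENNReal.Tendsto.const_mul (ENNReal.tendsto_ofReal hx) (Or.inr ENNReal.ofReal_ne_top)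
  have hle : ∀ j, pairEnergy hk W ρ (ψ j ⋆[lsmul ℝ ℝ] f)
      ≤ ENNReal.ofReal (2 * C) * ∫⁻ x, S x * ENNReal.ofReal ((ψ j ⋆[lsmul ℝ ℝ] ρ) x) := by
    intro j
    refine (pairEnergy_le_of_contDiff hW hρ hC (hsm j)
      ((hψs j).convolution (lsmul ℝ ℝ) hfs)).trans ?_
    refine mul_le_mul_right ?_ _
    simp_rw [hgrad]
    exact lintegral_sum_sq_convolution_le (hψd j).continuous (hψs j) (hψ0 j) (hψ1 j) (hψe j)
      hρ hρ0 hρi hHm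
  refine (pairEnergy_le_liminf hW (ρ' := fun _ => ρ) (f' := fun j => ψ j ⋆[lsmul ℝ ℝ] f)
    (fun _ => hρ) (fun j => (hsm j).continuous.measurable) (fun _ _ => le_rfl) ?_).trans ?_
  · filter_upwards [ContDiffBump.ae_convolution_tendsto_right_of_locallyIntegrable hφr hφK
      hf.locallyIntegrable] with x hx _
    exact ⟨hx, Eventually.of_forall fun _ => rfl⟩
  · refine (liminf_le_liminf (Eventually.of_forall hle)).trans_eq ?_
    exact (ENNReal.Tendsto.const_mul hlim (Or.inr ENNReal.ofReal_ne_top)).liminf_eq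

end Mollification

/-! ### Truncation and cutoff -/

section Cutoff

variable {n k : ℕ}

/-- The regularity of a density that the approximation argument needs. -/
structure IsRegularDensity (ρ : Vec n → ℝ) : Prop where
  measurable : Measurable ρ
  nonneg : ∀ x, 0 ≤ ρ x
  integrable : Integrable ρ
  bounded : ∃ M, ∀ x, ρ x ≤ M
  isOpen : IsOpen (domain ρ)
  bounded_below : ∀ K ⊆ domain ρ, IsCompact K → ∃ δ > 0, ∀ x ∈ K, δ ≤ ρ x

/-- An exhaustion of the domain by sets `K j` that support slicewise Poincaré inequalities with a
common constant, together with smooth cutoff functions `χ j` whose gradients on `K j` decay fast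
enough to be absorbed by a truncation of the function of interest at height `j + 1`. -/
structure CutoffExhaustion (hk : k ≤ n) (W : Matrix (Fin n) (Fin n) ℝ) (ρ : Vec n → ℝ)
    (C : ℝ) where
  K : ℕ → Set (Vec n)
  χ : ℕ → Vec n → ℝ
  c : ℝ
  measurableSet : ∀ j, MeasurableSet (K j)
  contDiff : ∀ j, ContDiff ℝ ∞ (χ j)
  hasCompactSupport : ∀ j, HasCompactSupport (χ j)
  tsupport_subset : ∀ j, tsupport (χ j) ⊆ domain ρ
  nonneg : ∀ j x, 0 ≤ χ j x
  le_one : ∀ j x, χ j x ≤ 1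
  norm_fderiv_le : ∀ j, ∀ x ∈ K j, ‖fderiv ℝ (χ j) x‖ ≤ c / ((j : ℝ) + 1) ^ 2
  eventually : ∀ x ∈ domain ρ, ∀ᶠ j in atTop, x ∈ K j ∧ χ j x = 1
  poincare : ∀ j, SlicePoincare hk W ((K j).indicator ρ) C

/-- The partial derivative of `f`, extended by zero outside the domain. -/
noncomputable def gradExt (ρ f : Vec n → ℝ) (i : Fin n) : Vec n → ℝ :=
  (domain ρ).indicator (partialDeriv i f)

lemma measurableSet_domain {ρ : Vec n → ℝ} (hρ : Measurable ρ) : MeasurableSet (domain ρ) :=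
  measurableSet_lt measurable_const hρ

lemma IsAdmissible.measurable_indicator {ρ f : Vec n → ℝ} (hρ : Measurable ρ)
    (hf : IsAdmissible ρ f) : Measurable ((domain ρ).indicator f) := by
  refine measurable_of_restrict_of_restrict_compl (measurableSet_domain hρ) ?_ ?_
  · convert! hf.measurable using 1
    ext x; simp
  · convert! (measurable_const : Measurable fun _ : ((domain ρ)ᶜ : Set (Vec n)) => (0 : ℝ)) using 1
    ext x; simp [Set.indicator_of_notMem x.2]

lemma IsAdmissible.hasLineDerivAt {ρ f : Vec n → ℝ} (hρ : IsRegularDensity ρ)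
    (hf : IsAdmissible ρ f) {x : Vec n} (hx : x ∈ domain ρ) (i : Fin n) :
    HasLineDerivAt ℝ ((domain ρ).indicator f) (gradExt ρ f i x) x
      (EuclideanSpace.single i 1) := by
  rw [gradExt, Set.indicator_of_mem hx]
  refine (hf.hasPartials x hx i).hasLineDerivAt.congr_of_eventuallyEq ?_
  filter_upwards [hρ.isOpen.mem_nhds hx] with y hy
  exact Set.indicator_of_mem hy f

/-- The partial derivatives are measurable as limits of difference quotients along `1 / (j + 1)`. -/
lemma IsAdmissible.measurable_gradExt {ρ f : Vec n → ℝ} (hρ : IsRegularDensity ρ)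
    (hf : IsAdmissible ρ f) (i : Fin n) : Measurable (gradExt ρ f i) := by
  have hF := hf.measurable_indicator hρ.measurable
  set F := (domain ρ).indicator f with hFdef
  set e : Vec n := EuclideanSpace.single i 1
  refine measurable_of_tendsto_metrizable (f := fun (j : ℕ) => (domain ρ).indicator fun x =>
    (1 / ((j : ℝ) + 1))⁻¹ • (F (x + (1 / ((j : ℝ) + 1)) • e) - F x)) (fun j => ?_) ?_
  · refine Measurable.indicator ?_ (measurableSet_domain hρ.measurable)
    have h1 : Measurable fun x => F (x + (1 / ((j : ℝ) + 1)) • e) := hF.comp (by fun_prop)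
    exact (h1.sub hF).const_mul (1 / ((j : ℝ) + 1))⁻¹
  · rw [tendsto_pi_nhds]
    intro x
    by_cases hx : x ∈ domain ρ
    · have h1 := hasLineDerivAt_iff_tendsto_slope_zero.1 (hf.hasLineDerivAt hρ hx i)
      have h2 : Tendsto (fun j : ℕ => 1 / ((j : ℝ) + 1)) atTop (𝓝[≠] 0) :=
        tendsto_nhdsWithin_iff.2 ⟨tendsto_one_div_add_atTop_nhds_zero_nat,
          Eventually.of_forall fun j => by
            have : (0 : ℝ) < 1 / ((j : ℝ) + 1) := by positivity
            exact this.ne'⟩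
      simp only [Set.indicator_of_mem hx (f := fun x => _)]
      exact h1.comp h2
    · simp [gradExt, Set.indicator_of_notMem hx]

lemma IsAdmissible.integrable_gradExt_sq {ρ f : Vec n → ℝ} (hρ : Measurable ρ)
    (hf : IsAdmissible ρ f) (i : Fin n) : Integrable fun x => gradExt ρ f i x ^ 2 * ρ x := by
  have h := (integrable_indicator_iff (measurableSet_domain hρ)).2 (hf.sq_integrable i)
  refine h.congr (ae_of_all _ fun x => ?_)
  by_cases hx : x ∈ domain ρ <;> simp [gradExt, hx]

/-- The truncated and cut off function: `a arctan(F / a)` is bounded, and `arctan` keeps the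
partial derivatives. -/
noncomputable def cutTrunc (χ F : Vec n → ℝ) (a : ℝ) (x : Vec n) : ℝ :=
  χ x * (a * Real.arctan (F x / a))

/-- The derivative of `cutTrunc χ F a` in the direction `v`, where `g` is that of `F`. -/
noncomputable def cutTruncDeriv (χ F : Vec n → ℝ) (a : ℝ) (v : Vec n) (g : Vec n → ℝ)
    (x : Vec n) : ℝ :=
  χ x * (1 / (1 + (F x / a) ^ 2) * g x) + fderiv ℝ χ x v * (a * Real.arctan (F x / a))

lemma abs_mul_arctan_le {a : ℝ} (ha : 0 < a) (t : ℝ) : |a * Real.arctan t| ≤ 2 * a := by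
  rw [abs_mul, abs_of_pos ha, mul_comm]
  have h1 : |Real.arctan t| ≤ Real.pi / 2 :=
    abs_le.2 ⟨(Real.neg_pi_div_two_lt_arctan t).le, (Real.arctan_lt_pi_div_two t).le⟩
  have := Real.pi_lt_four
  gcongr
  linarith

lemma tendsto_mul_arctan_div (t : ℝ) :
    Tendsto (fun j : ℕ => ((j : ℝ) + 1) * Real.arctan (t / ((j : ℝ) + 1))) atTop (𝓝 t) := by
  have h1 : HasDerivAt (fun s : ℝ => Real.arctan (t * s)) t 0 := by
    have := ((hasDerivAt_id (0 : ℝ)).const_mul t).arctan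
    simpa using this
  have h2 : Tendsto (fun j : ℕ => 1 / ((j : ℝ) + 1)) atTop (𝓝[≠] 0) :=
    tendsto_nhdsWithin_iff.2 ⟨tendsto_one_div_add_atTop_nhds_zero_nat,
      Eventually.of_forall fun j => by
        have : (0 : ℝ) < 1 / ((j : ℝ) + 1) := by positivity
        exact this.ne'⟩
  have h3 := (hasDerivAt_iff_tendsto_slope_zero.1 h1).comp h2
  refine h3.congr fun j => ?_
  simp [div_eq_mul_inv]

lemma abs_cutTruncDeriv_le {χ F : Vec n → ℝ} {a : ℝ} (ha : 0 < a) {v : Vec n} {g : Vec n → ℝ}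
    {x : Vec n} (h0 : 0 ≤ χ x) (h1 : χ x ≤ 1) :
    |cutTruncDeriv χ F a v g x| ≤ |g x| + ‖fderiv ℝ χ x‖ * ‖v‖ * (2 * a) := by
  refine (abs_add_le _ _).trans (add_le_add ?_ ?_)
  · have h2 : |1 / (1 + (F x / a) ^ 2)| ≤ 1 := by
      rw [abs_of_pos (by positivity), div_le_one (by positivity)]
      nlinarith [sq_nonneg (F x / a)]
    rw [abs_mul, abs_mul, abs_of_nonneg h0, ← mul_assoc]
    exact mul_le_of_le_one_left (abs_nonneg _) (mul_le_one₀ h1 (abs_nonneg _) h2)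
  · rw [abs_mul]
    exact mul_le_mul ((fderiv ℝ χ x).le_opNorm v) (abs_mul_arctan_le ha _) (abs_nonneg _)
      (by positivity)

lemma IsAdmissible.hasLineDerivAt_cutTrunc {ρ f : Vec n → ℝ} (hρ : IsRegularDensity ρ)
    (hf : IsAdmissible ρ f) {χ : Vec n → ℝ} (hχ : ContDiff ℝ ∞ χ)
    (hχD : tsupport χ ⊆ domain ρ) {a : ℝ} (ha : 0 < a) (i : Fin n) (x : Vec n) :
    HasLineDerivAt ℝ (cutTrunc χ ((domain ρ).indicator f) a)
      (cutTruncDeriv χ ((domain ρ).indicator f) a (EuclideanSpace.single i 1)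
        (gradExt ρ f i) x) x (EuclideanSpace.single i 1) := by
  set F := (domain ρ).indicator f with hF
  by_cases hx : x ∈ domain ρ
  · have h1 : HasDerivAt (fun s : ℝ => F (x + s • EuclideanSpace.single i (1 : ℝ)))
      (gradExt ρ f i x) 0 := hf.hasLineDerivAt hρ hx i
    have h2 : HasDerivAt (fun s : ℝ => χ (x + s • EuclideanSpace.single i (1 : ℝ)))
      (fderiv ℝ χ x (EuclideanSpace.single i 1)) 0 :=
      (hχ.differentiable (by simp) x).hasFDerivAt.hasLineDerivAt _
    have h3 := h2.mul (((h1.div_const a).arctan).const_mul a)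
    have h4 : HasDerivAt (fun s : ℝ => cutTrunc χ F a (x + s • EuclideanSpace.single i (1 : ℝ)))
      (cutTruncDeriv χ F a (EuclideanSpace.single i 1) (gradExt ρ f i) x) 0 := by
      convert! h3 using 1
      simp only [cutTruncDeriv, zero_smul, add_zero]
      field_simp
      ring
    exact h4
  · have h0 : χ =ᶠ[𝓝 x] 0 := notMem_tsupport_iff_eventuallyEq.1 fun h => hx (hχD h)
    have h1 : cutTruncDeriv χ F a (EuclideanSpace.single i 1) (gradExt ρ f i) x = 0 := by
      simp [cutTruncDeriv, hF, gradExt, Set.indicator_of_notMem hx]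
    rw [h1]
    have h2 := (hasFDerivAt_const (𝕜 := ℝ) (0 : ℝ) x).hasLineDerivAt (EuclideanSpace.single i 1)
    refine HasLineDerivAt.congr_of_eventuallyEq h2 ?_
    filter_upwards [h0] with y hy
    simp [cutTrunc, hy]

lemma measurable_cutTruncDeriv {χ F : Vec n → ℝ} (hχ : ContDiff ℝ ∞ χ) (hF : Measurable F)
    (a : ℝ) (v : Vec n) {g : Vec n → ℝ} (hg : Measurable g) :
    Measurable (cutTruncDeriv χ F a v g) := by
  have h1 : Continuous (fderiv ℝ χ) := hχ.continuous_fderiv (by simp)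
  have h2 : Continuous fun x => fderiv ℝ χ x v := by fun_prop
  have h3 : Measurable fun x => Real.arctan (F x / a) :=
    Real.continuous_arctan.measurable.comp (hF.div_const a)
  exact (hχ.continuous.measurable.mul ((((hF.div_const a).pow_const 2).const_add 1).const_div 1
    |>.mul hg)).add (h2.measurable.mul (h3.const_mul a))

/-- On the support of the cutoff the density is bounded below, so that square integrability with
respect to the density implies square integrability with respect to Lebesgue measure. -/
lemma IsAdmissible.memLp_cutTruncDeriv {ρ f : Vec n → ℝ} (hρ : IsRegularDensity ρ)
    (hf : IsAdmissible ρ f) {χ : Vec n → ℝ} (hχ : ContDiff ℝ ∞ χ) (hχs : HasCompactSupport χ)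
    (hχD : tsupport χ ⊆ domain ρ) (h0 : ∀ x, 0 ≤ χ x) (h1 : ∀ x, χ x ≤ 1) {a : ℝ} (ha : 0 < a)
    (i : Fin n) (v : Vec n) :
    MemLp (cutTruncDeriv χ ((domain ρ).indicator f) a v (gradExt ρ f i)) 2 ∧
      Integrable (cutTruncDeriv χ ((domain ρ).indicator f) a v (gradExt ρ f i)) := by
  set F := (domain ρ).indicator f with hF
  set T := tsupport χ with hT
  have hTc : IsCompact T := hχs
  have hTm : MeasurableSet T := hTc.measurableSet
  have : IsFiniteMeasure (volume.restrict T) :=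
    isFiniteMeasure_restrict.2 hTc.measure_lt_top.ne
  have hgm := hf.measurable_gradExt hρ i
  have hm := measurable_cutTruncDeriv hχ (hf.measurable_indicator hρ.measurable) a v hgm
  obtain ⟨δ, hδ, hδρ⟩ := hρ.bounded_below T hχD hTc
  obtain ⟨B, hB⟩ := (hχs.fderiv (𝕜 := ℝ)).exists_bound_of_continuous
    (hχ.continuous_fderiv (by simp))
  have hg2 : MemLp (gradExt ρ f i) 2 (volume.restrict T) := by
    rw [memLp_two_iff_integrable_sq hgm.aestronglyMeasurable]
    refine Integrable.mono' ((hf.integrable_gradExt_sq hρ.measurable i).const_mul δ⁻¹).restrict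
      (hgm.pow_const 2).aestronglyMeasurable ?_
    filter_upwards [ae_restrict_mem hTm] with x hx
    rw [Real.norm_of_nonneg (sq_nonneg _), mul_left_comm]
    refine le_mul_of_one_le_right (sq_nonneg _) ?_
    rw [← div_eq_inv_mul, one_le_div hδ]
    exact hδρ x hx
  have hd2 : MemLp (cutTruncDeriv χ F a v (gradExt ρ f i)) 2 (volume.restrict T) := by
    refine MemLp.mono (hg2.norm.add (memLp_const (B * ‖v‖ * (2 * a)))) hm.aestronglyMeasurable
      (ae_of_all _ fun x => ?_)
    refine (abs_cutTruncDeriv_le ha (h0 x) (h1 x)).trans ((le_abs_self _).trans' ?_)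
    simp only [Pi.add_apply, Real.norm_eq_abs]
    gcongr
    exact hB x
  have hsupp : T.indicator (cutTruncDeriv χ F a v (gradExt ρ f i))
      = cutTruncDeriv χ F a v (gradExt ρ f i) := by
    refine Set.indicator_eq_self.2 fun x hx => ?_
    by_contra hxT
    have e : χ =ᶠ[𝓝 x] 0 := notMem_tsupport_iff_eventuallyEq.1 hxT
    have e1 : χ x = 0 := e.eq_of_nhds
    have e2 : fderiv ℝ χ x = 0 := by
      rw [e.fderiv_eq]; exact fderiv_const_apply 0
    exact hx (by simp [cutTruncDeriv, e1, e2])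
  rw [← hsupp]
  exact ⟨(memLp_indicator_iff_restrict hTm).2 hd2,
    (integrable_indicator_iff hTm).2 (hd2.integrable one_le_two)⟩

end Cutoff

/-! ### The pair energy of an admissible function -/

section Admissible

variable {n k : ℕ} {hk : k ≤ n} {W : Matrix (Fin n) (Fin n) ℝ}

variable (hk W) in
/-- The `l`-th component of `W₂ᵀ ∇f`, extended by zero outside the domain. -/
noncomputable def inactiveGrad (ρ f : Vec n → ℝ) (l : Fin (n - k)) (x : Vec n) : ℝ :=
  ∑ i, cols₂ hk W i l * gradExt ρ f i x

lemma measurable_inactiveGrad {ρ f : Vec n → ℝ} (hρ : IsRegularDensity ρ)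
    (hf : IsAdmissible ρ f) (l : Fin (n - k)) : Measurable (inactiveGrad hk W ρ f l) :=
  Finset.measurable_sum _ fun i _ => (hf.measurable_gradExt hρ i).const_mul _

lemma sum_cols₂_mul_cutTruncDeriv (χ F : Vec n → ℝ) (a : ℝ) (ρ f : Vec n → ℝ)
    (l : Fin (n - k)) (x : Vec n) :
    ∑ i, cols₂ hk W i l *
        cutTruncDeriv χ F a (EuclideanSpace.single i 1) (gradExt ρ f i) x
      = cutTruncDeriv χ F a (inactive hk W (EuclideanSpace.single l 1))
        (inactiveGrad hk W ρ f l) x := by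
  simp only [cutTruncDeriv, inactive_single, inactiveGrad, map_sum, map_smul, smul_eq_mul,
    Finset.mul_sum, Finset.sum_mul, ← Finset.sum_add_distrib]
  exact Finset.sum_congr rfl fun i _ => by ring

lemma integrable_inactiveGrad_sq {ρ f : Vec n → ℝ} (hρ : IsRegularDensity ρ)
    (hf : IsAdmissible ρ f) (l : Fin (n - k)) :
    Integrable fun x => inactiveGrad hk W ρ f l x ^ 2 * ρ x := by
  have h1 : MemLp (fun x => inactiveGrad hk W ρ f l x * √(ρ x)) 2 := by
    have e : (fun x => inactiveGrad hk W ρ f l x * √(ρ x))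
        = fun x => ∑ i, cols₂ hk W i l * (gradExt ρ f i x * √(ρ x)) := by
      ext x; simp only [inactiveGrad, Finset.sum_mul, mul_assoc]
    rw [e]
    refine memLp_finsetSum _ fun i _ => MemLp.const_mul ?_ _
    have hm : Measurable fun x => gradExt ρ f i x * √(ρ x) :=
      (hf.measurable_gradExt hρ i).mul hρ.measurable.sqrt
    rw [memLp_two_iff_integrable_sq hm.aestronglyMeasurable]
    simp_rw [mul_pow, Real.sq_sqrt (hρ.nonneg _)]
    exact hf.integrable_gradExt_sq hρ.measurable i
  have h2 := h1.integrable_sq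
  simpa only [mul_pow, Real.sq_sqrt (hρ.nonneg _)] using h2

/-- Given a cutoff exhaustion, the slicewise Poincaré inequalities extend from smooth to
admissible functions. -/
lemma CutoffExhaustion.pairEnergy_le (hW : W ∈ Matrix.orthogonalGroup (Fin n) ℝ)
    {ρ f : Vec n → ℝ} {C : ℝ} (E : CutoffExhaustion hk W ρ C) (hρ : IsRegularDensity ρ)
    (hf : IsAdmissible ρ f) :
    pairEnergy hk W ρ ((domain ρ).indicator f) ≤ ENNReal.ofReal (2 * C) *
      ∫⁻ x, ENNReal.ofReal (∑ l, inactiveGrad hk W ρ f l x ^ 2) * ENNReal.ofReal (ρ x) := by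
  have hFm := hf.measurable_indicator hρ.measurable
  set F := (domain ρ).indicator f with hF
  have ha : ∀ j : ℕ, (0 : ℝ) < (j : ℝ) + 1 := fun j => by positivity
  set a : ℕ → ℝ := fun j => (j : ℝ) + 1 with had
  set fj : ℕ → Vec n → ℝ := fun j => cutTrunc (E.χ j) F (a j) with hfj
  set G : Fin (n - k) → Vec n → ℝ := inactiveGrad hk W ρ f with hG
  set ρj : ℕ → Vec n → ℝ := fun j => (E.K j).indicator ρ with hρj
  have hGm : ∀ l, Measurable (G l) := fun l => measurable_inactiveGrad hρ hf l
  have hρjle : ∀ j x, ρj j x ≤ ρ x := fun j x =>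
    Set.indicator_le_self' (fun _ _ => hρ.nonneg _) x
  have hρjm : ∀ j, Measurable (ρj j) := fun j => hρ.measurable.indicator (E.measurableSet j)
  obtain ⟨M, hM⟩ := hρ.bounded
  have hfjm : ∀ j, Measurable (fj j) := fun j =>
    (E.contDiff j).continuous.measurable.mul
      ((Real.continuous_arctan.measurable.comp (hFm.div_const _)).const_mul _)
  have hfjs : ∀ j, HasCompactSupport (fj j) := fun j => (E.hasCompactSupport j).mul_right
  have hfji : ∀ j, Integrable (fj j) := fun j => by
    have h1 : Integrable (E.χ j) :=
      (E.contDiff j).continuous.integrable_of_hasCompactSupport (E.hasCompactSupport j)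
    exact h1.mul_bdd (c := 2 * a j)
      ((Real.continuous_arctan.measurable.comp (hFm.div_const _)).const_mul
        (a j)).aestronglyMeasurable
      (ae_of_all _ fun x => abs_mul_arctan_le (ha j) _)
  -- the bound for the truncated functions
  have hbound : ∀ j, pairEnergy hk W (ρj j) (fj j) ≤ ENNReal.ofReal (2 * C) *
      ∫⁻ x, ENNReal.ofReal (∑ l, (|G l x| + 2 * E.c / (j + 1)) ^ 2) * ENNReal.ofReal (ρ x) := by
    intro j
    have hmem := fun i v => hf.memLp_cutTruncDeriv hρ (E.contDiff j) (E.hasCompactSupport j)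
      (E.tsupport_subset j) (E.nonneg j) (E.le_one j) (ha j) i v
    refine (pairEnergy_le_of_hasLineDerivAt hW (hρjm j)
      (fun x => Set.indicator_nonneg (fun _ _ => hρ.nonneg _) x)
      (hρ.integrable.indicator (E.measurableSet j)) (fun x => (hρjle j x).trans (hM x))
      (E.poincare j) (hfji j) (hfjs j)
      (h := fun i => cutTruncDeriv (E.χ j) F (a j) (EuclideanSpace.single i 1) (gradExt ρ f i))
      (fun i => measurable_cutTruncDeriv (E.contDiff j) hFm _ _ (hf.measurable_gradExt hρ i))
      (fun i => (hmem i _).2) (fun i => (hmem i _).1)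
      (fun i x => hf.hasLineDerivAt_cutTrunc hρ (E.contDiff j) (E.tsupport_subset j) (ha j)
        i x)).trans ?_
    refine mul_le_mul_right (lintegral_mono fun x => ?_) _
    by_cases hx : x ∈ E.K j
    · simp only [hρj, Set.indicator_of_mem hx]
      refine mul_le_mul_left (ENNReal.ofReal_le_ofReal (Finset.sum_le_sum fun l _ => ?_)) _
      rw [sum_cols₂_mul_cutTruncDeriv, sq_le_sq]
      refine (abs_cutTruncDeriv_le (ha j) (E.nonneg j x) (E.le_one j x)).trans
        ((le_abs_self _).trans' ?_)
      have hn : ‖inactive hk W (EuclideanSpace.single l 1)‖ = 1 := by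
        have := norm_sq_assemble hk hW 0 (EuclideanSpace.single l (1 : ℝ))
        rw [assemble_eq_add_inactive] at this
        have e0 : mulE (cols₁ hk W) 0 = 0 := by ext; simp [mulE]
        rw [e0, zero_add] at this
        rw [← sq_eq_sq₀ (norm_nonneg _) zero_le_one, this]; simp
      rw [hn, mul_one]
      refine add_le_add le_rfl ?_
      calc ‖fderiv ℝ (E.χ j) x‖ * (2 * a j) ≤ E.c / ((j : ℝ) + 1) ^ 2 * (2 * a j) := by
            have := (ha j).le
            gcongr
            exact E.norm_fderiv_le j x hx
        _ = 2 * E.c / (j + 1) := by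
            have := (ha j).ne'
            simp only [had] at *
            field_simp
    · simp [hρj, hx]
  -- dominated convergence removes the error terms
  have hlim : Tendsto (fun j : ℕ => ∫⁻ x, ENNReal.ofReal (∑ l, (|G l x| + 2 * E.c / (j + 1)) ^ 2)
      * ENNReal.ofReal (ρ x)) atTop
      (𝓝 (∫⁻ x, ENNReal.ofReal (∑ l, G l x ^ 2) * ENNReal.ofReal (ρ x))) := by
    refine tendsto_lintegral_of_dominated_convergence
      (fun x => ENNReal.ofReal (∑ l, (|G l x| + 2 * |E.c|) ^ 2) * ENNReal.ofReal (ρ x))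
      (fun j => ?_) (fun j => ae_of_all _ fun x => ?_) ?_ (ae_of_all _ fun x => ?_)
    · exact (Finset.measurable_sum _ fun l _ =>
        (((hGm l).abs).add_const _).pow_const 2).ennreal_ofReal.mul hρ.measurable.ennreal_ofReal
    · refine mul_le_mul_left (ENNReal.ofReal_le_ofReal (Finset.sum_le_sum fun l _ => ?_)) _
      rw [sq_le_sq]
      refine (abs_add_le _ _).trans ((le_abs_self _).trans' ?_)
      rw [abs_abs]
      refine add_le_add le_rfl ?_
      rw [abs_div, abs_mul, abs_of_pos (ha j), abs_two]
      exact div_le_self (by positivity) (by linarith [(Nat.cast_nonneg j : (0 : ℝ) ≤ j)])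
    · have hi : Integrable fun x => ∑ l : Fin (n - k), 2 * (G l x ^ 2 * ρ x
          + (2 * |E.c|) ^ 2 * ρ x) :=
        integrable_finsetSum _ fun l _ => ((integrable_inactiveGrad_sq hρ hf l).add
          (hρ.integrable.const_mul _)).const_mul 2
      have hlt := (hasFiniteIntegral_iff_ofReal (ae_of_all _ fun x =>
        Finset.sum_nonneg fun l _ => mul_nonneg zero_le_two (add_nonneg
          (mul_nonneg (sq_nonneg _) (hρ.nonneg x))
          (mul_nonneg (sq_nonneg _) (hρ.nonneg x))))).1 hi.hasFiniteIntegral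
      refine ((lintegral_mono fun x => ?_).trans_lt hlt).ne
      rw [← ENNReal.ofReal_mul (Finset.sum_nonneg fun _ _ => sq_nonneg _), Finset.sum_mul]
      refine ENNReal.ofReal_le_ofReal (Finset.sum_le_sum fun l _ => ?_)
      rw [← add_mul, ← mul_assoc]
      refine mul_le_mul_of_nonneg_right ?_ (hρ.nonneg x)
      nlinarith [sq_nonneg (|G l x| - 2 * |E.c|), sq_abs (G l x)]
    · have h1 : Tendsto (fun j : ℕ => 2 * E.c / ((j : ℝ) + 1)) atTop (𝓝 0) := by
        have := (tendsto_one_div_add_atTop_nhds_zero_nat (𝕜 := ℝ)).const_mul (2 * E.c)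
        simpa [div_eq_mul_inv] using this
      have h2 : Tendsto (fun j : ℕ => ∑ l, (|G l x| + 2 * E.c / (j + 1)) ^ 2) atTop
          (𝓝 (∑ l, G l x ^ 2)) := by
        refine tendsto_finsetSum _ fun l _ => ?_
        have := (h1.const_add (|G l x|)).pow 2
        simpa using this
      exact ENNReal.Tendsto.mul_const (ENNReal.tendsto_ofReal h2) (Or.inr ENNReal.ofReal_ne_top)
  refine (pairEnergy_le_liminf hW (ρ' := ρj) (f' := fj) hρjm hfjm hρjle
    (ae_of_all _ fun x hx => ⟨?_, ?_⟩)).trans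
    ((liminf_le_liminf (Eventually.of_forall hbound)).trans_eq
      (ENNReal.Tendsto.const_mul hlim (Or.inr ENNReal.ofReal_ne_top)).liminf_eq)
  · refine (tendsto_mul_arctan_div (F x)).congr' ?_
    filter_upwards [E.eventually x hx] with j hj
    simp [hfj, cutTrunc, hj.2, had]
  · filter_upwards [E.eventually x hx] with j hj
    exact Set.indicator_of_mem hj.1 ρ

end Admissible

/-! ### Poincaré inequalities on the slices of the two densities -/

section Slices

variable {n k : ℕ} {hk : k ≤ n} {W : Matrix (Fin n) (Fin n) ℝ}

lemma IsUniformOnConvex.isRegularDensity {ρ : Vec n → ℝ} (h : IsUniformOnConvex ρ) :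
    IsRegularDensity ρ := by
  have hD : MeasurableSet (domain ρ) := h.isOpen.measurableSet
  have hc : 0 ≤ (volume.real (domain ρ))⁻¹ := inv_nonneg.2 measureReal_nonneg
  refine ⟨?_, fun x => ?_, ?_, ⟨(volume.real (domain ρ))⁻¹, fun x => ?_⟩, h.isOpen,
    fun K hK _ => ?_⟩
  · rw [h.eq_indicator]; exact measurable_const.indicator hD
  · rw [h.eq_indicator]; exact Set.indicator_nonneg (fun _ _ => hc) x
  · rw [h.eq_indicator, integrable_indicator_iff hD]
    exact integrableOn_const h.bounded.measure_lt_top.ne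
  · conv_lhs => rw [h.eq_indicator]
    exact Set.indicator_le_self' (fun _ _ => hc) x
  · obtain ⟨x₀, hx₀⟩ := h.nonempty
    refine ⟨ρ x₀, hx₀, fun x hx => ?_⟩
    have e : ∀ y ∈ domain ρ, ρ y = (volume.real (domain ρ))⁻¹ := fun y hy => by
      conv_lhs => rw [h.eq_indicator]
      exact Set.indicator_of_mem hy _
    rw [e x (hK hx), e x₀ hx₀]

lemma IsStdNormal.isRegularDensity {ρ : Vec n → ℝ} (h : IsStdNormal ρ) :
    IsRegularDensity ρ := by
  have hu : domain ρ = Set.univ := Set.eq_univ_of_forall h.pos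
  have hc := h.contDiff.continuous
  refine ⟨hc.measurable, fun x => (h.pos x).le, h.integrable,
    ⟨(Real.sqrt (2 * Real.pi) ^ n)⁻¹, fun x => ?_⟩, hu ▸ isOpen_univ, fun K _ hK => ?_⟩
  · rw [h x]
    refine mul_le_of_le_one_right (by positivity) (Real.exp_le_one_iff.2 ?_)
    have := sq_nonneg ‖x‖
    linarith
  · rcases K.eq_empty_or_nonempty with rfl | hne
    · exact ⟨1, one_pos, by simp⟩
    · obtain ⟨x₀, _, hmin⟩ := hK.exists_isMinOn hne hc.continuousOn
      exact ⟨ρ x₀, h.pos x₀, fun x hx => hmin hx⟩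

/-- The slices of a bounded convex set are convex and no wider than the set itself. -/
lemma slicePoincare_indicator_const (hW : W ∈ Matrix.orthogonalGroup (Fin n) ℝ)
    {K : Set (Vec n)} (hK : Convex ℝ K) (hKm : MeasurableSet K) {d C : ℝ}
    (hd : ∀ x ∈ K, ∀ x' ∈ K, ‖x - x'‖ ≤ d) (hC : d ^ 2 * 2 ^ n ≤ 2 * C) (c : ℝ) :
    SlicePoincare hk W (K.indicator fun _ => c) C := by
  intro y v hv _
  set S : Set (Vec (n - k)) := {z | assemble hk W y z ∈ K} with hS
  have hSm : MeasurableSet S := hKm.preimage (measurable_assemble₂ measurable_const measurable_id)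
  have hSc : Convex ℝ S := by
    intro z hz z' hz' s t hs ht hst
    have h1 := hK hz hz' hs ht hst
    rw [← assemble_smul, ← assemble_smul, ← assemble_add, ← add_smul, hst, one_smul] at h1
    exact h1
  have hSd : ∀ z ∈ S, ∀ z' ∈ S, ‖z - z'‖ ≤ d := fun z hz z' hz' => by
    rw [← norm_assemble_sub hk hW y]; exact hd _ hz _ hz'
  have hw : ∀ z, ENNReal.ofReal (K.indicator (fun _ => c) (assemble hk W y z))
      = S.indicator (fun _ => ENNReal.ofReal c) z := by
    intro z
    by_cases hz : z ∈ S
    · rw [Set.indicator_of_mem hz, Set.indicator_of_mem (show assemble hk W y z ∈ K from hz)]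
    · rw [Set.indicator_of_notMem hz, Set.indicator_of_notMem (show assemble hk W y z ∉ K from hz),
        ENNReal.ofReal_zero]
  have hmul : ∀ (F : Vec (n - k) → ℝ≥0∞), ∫⁻ z, F z * S.indicator (fun _ => ENNReal.ofReal c) z
      = (∫⁻ z in S, F z) * ENNReal.ofReal c := by
    intro F
    rw [← lintegral_mul_const' _ _ ENNReal.ofReal_ne_top, ← lintegral_indicator hSm]
    refine lintegral_congr fun z => ?_
    by_cases hz : z ∈ S <;> simp [hz]
  have hmass : sliceMass hk W (K.indicator fun _ => c) y = volume S * ENNReal.ofReal c := by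
    have := hmul 1
    simpa [sliceMass, hw] using this
  have hLHS : ∫⁻ z, ∫⁻ z', ENNReal.ofReal ((v z - v z') ^ 2) *
      (S.indicator (fun _ => ENNReal.ofReal c) z * S.indicator (fun _ => ENNReal.ofReal c) z')
      = (∫⁻ z in S, ∫⁻ z' in S, ENNReal.ofReal ((v z - v z') ^ 2)) * ENNReal.ofReal c
        * ENNReal.ofReal c := by
    rw [← lintegral_mul_const' _ _ ENNReal.ofReal_ne_top, ← hmul]
    refine lintegral_congr fun z => ?_
    rw [← hmul, ← lintegral_mul_const']
    · exact lintegral_congr fun z' => by ring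
    · by_cases hz : z ∈ S <;> simp [hz]
  simp_rw [hw, hLHS, hmul, hmass]
  have h2 : ENNReal.ofReal (d ^ 2 * 2 ^ (n - k)) ≤ ENNReal.ofReal (2 * C) := by
    refine ENNReal.ofReal_le_ofReal (le_trans ?_ hC)
    gcongr
    · norm_num
    · omega
  calc _ ≤ (ENNReal.ofReal (2 * C) * volume S *
          ∫⁻ z in S, ENNReal.ofReal (‖fderiv ℝ v z‖ ^ 2)) * ENNReal.ofReal c * ENNReal.ofReal c := by
        gcongr
        refine (convex_poincare hSc hSm hSd hv).trans ?_
        gcongr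
    _ = _ := by ring

/-- The slices of the standard normal distribution are standard normal up to normalization. -/
lemma IsStdNormal.slicePoincare (hW : W ∈ Matrix.orthogonalGroup (Fin n) ℝ) {ρ : Vec n → ℝ}
    (h : IsStdNormal ρ) : SlicePoincare hk W ρ 1 := by
  intro y v hv hvs
  set g : Vec (n - k) → ℝ := fun z =>
    (Real.sqrt (2 * Real.pi) ^ (n - k))⁻¹ * Real.exp (-‖z‖ ^ 2 / 2) with hg
  have hgn : IsStdNormal g := fun z => rfl
  have hgm : Measurable fun z => ENNReal.ofReal (g z) :=
    hgn.contDiff.continuous.measurable.ennreal_ofReal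
  set b : ℝ≥0∞ :=
    ENNReal.ofReal ((Real.sqrt (2 * Real.pi) ^ k)⁻¹ * Real.exp (-‖y‖ ^ 2 / 2)) with hb
  have hbt : b ≠ ⊤ := ENNReal.ofReal_ne_top
  have hw : ∀ z, ENNReal.ofReal (ρ (assemble hk W y z)) = ENNReal.ofReal (g z) * b := by
    intro z
    rw [hb, ← ENNReal.ofReal_mul (hgn.pos z).le, h, hg, norm_sq_assemble hk hW,
      neg_add, add_div, Real.exp_add,
      show Real.sqrt (2 * Real.pi) ^ n
        = Real.sqrt (2 * Real.pi) ^ k * Real.sqrt (2 * Real.pi) ^ (n - k) by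
        rw [← pow_add]; congr 1; omega, mul_inv]
    congr 1; ring
  have hden : ∀ F : Vec (n - k) → ℝ≥0∞, Measurable F →
      ∫⁻ z, F z * ENNReal.ofReal (g z) = ∫⁻ z, F z ∂(densityMeasure g) := by
    intro F hF
    rw [densityMeasure, lintegral_withDensity_eq_lintegral_mul _ hgm hF]
    exact lintegral_congr fun z => by rw [Pi.mul_apply, mul_comm]
  have hprob := hgn.isProbabilityMeasure
  have hmass : sliceMass hk W ρ y = b := by
    rw [sliceMass]
    simp_rw [hw]
    rw [lintegral_mul_const' _ _ hbt]
    have := hden 1 measurable_one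
    simp only [Pi.one_apply, one_mul, lintegral_one, measure_univ] at this
    rw [this, one_mul]
  have hvm : Measurable v := hv.continuous.measurable
  have hpm : Measurable fun p : Vec (n - k) × Vec (n - k) =>
      ENNReal.ofReal ((v p.1 - v p.2) ^ 2) :=
    (((hvm.comp measurable_fst).sub (hvm.comp measurable_snd)).pow_const 2).ennreal_ofReal
  have hLHS : ∫⁻ z, ∫⁻ z', ENNReal.ofReal ((v z - v z') ^ 2) *
      (ENNReal.ofReal (g z) * b * (ENNReal.ofReal (g z') * b))
      = (∫⁻ z, ∫⁻ z', ENNReal.ofReal ((v z - v z') ^ 2) ∂(densityMeasure g)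
        ∂(densityMeasure g)) * b * b := by
    rw [← hden _ hpm.lintegral_prod_right', ← lintegral_mul_const' _ _ hbt,
      ← lintegral_mul_const' _ _ hbt]
    refine lintegral_congr fun z => ?_
    have hz : Measurable fun z' => ENNReal.ofReal ((v z - v z') ^ 2) :=
      hpm.comp measurable_prodMk_left
    rw [← hden _ hz, ← lintegral_mul_const' _ _ ENNReal.ofReal_ne_top,
      ← lintegral_mul_const' _ _ hbt, ← lintegral_mul_const' _ _ hbt]
    exact lintegral_congr fun z' => by ring
  have hcm : Measurable fun z => ENNReal.ofReal (‖fderiv ℝ v z‖ ^ 2) :=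
    ((hv.continuous_fderiv one_ne_zero).norm.pow 2).measurable.ennreal_ofReal
  simp_rw [hw, hLHS, hmass, ← mul_assoc]
  rw [lintegral_mul_const' _ _ hbt, hden _ hcm, mul_one, ENNReal.ofReal_ofNat]
  calc _ ≤ (2 * ∫⁻ z, ENNReal.ofReal (‖fderiv ℝ v z‖ ^ 2) ∂(densityMeasure g)) * b * b := by
        gcongr
        exact hgn.poincare hv hvs
    _ = _ := by ring

end Slices

/-! ### Cutoff exhaustions for the two densities -/

section Exhaustions

variable {n k : ℕ} {hk : k ≤ n} {W : Matrix (Fin n) (Fin n) ℝ}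

/-- A smooth cutoff function which is `1` near a given compact subset of an open set and has
compact support inside the open set. -/
lemma exists_cutoff {K D : Set (Vec n)} (hK : IsCompact K) (hD : IsOpen D) (hKD : K ⊆ D) :
    ∃ χ : Vec n → ℝ, ContDiff ℝ ∞ χ ∧ HasCompactSupport χ ∧ tsupport χ ⊆ D ∧
      (∀ x, 0 ≤ χ x) ∧ (∀ x, χ x ≤ 1) ∧ ∀ x ∈ K, χ =ᶠ[𝓝 x] 1 := by
  obtain ⟨T, hT, hKT, hTD⟩ := exists_compact_between hK hD hKD
  obtain ⟨χ, h1, h0, h01⟩ := exists_contMDiffMap_one_nhds_of_subset_interior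
    (n := (⊤ : ℕ∞)) (modelWithCornersSelf ℝ (Vec n)) hK.isClosed hKT
  have hsupp : Function.support χ ⊆ T := fun x hx => by
    by_contra h; exact hx (h0 x h)
  refine ⟨χ, χ.contMDiff.contDiff, HasCompactSupport.of_support_subset_isCompact hT hsupp,
    (closure_minimal hsupp hT.isClosed).trans hTD, fun x => (h01 x).1, fun x => (h01 x).2,
    fun x hx => ?_⟩
  exact (eventually_nhdsSet_iff_forall.1 h1) x hx

/-- Contracting the closure towards an interior point exhausts a bounded convex open set. -/
lemma exists_compact_convex_exhaustion {D : Set (Vec n)} (hD : IsOpen D) (hDc : Convex ℝ D)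
    (hDb : Bornology.IsBounded D) (hDn : D.Nonempty) :
    ∃ K : ℕ → Set (Vec n), (∀ j, IsCompact (K j)) ∧ (∀ j, Convex ℝ (K j)) ∧ (∀ j, K j ⊆ D) ∧
      ∀ x ∈ D, ∀ᶠ j in atTop, x ∈ K j := by
  obtain ⟨x₀, hx₀⟩ := hDn
  set s : ℕ → ℝ := fun j => 1 + 1 / ((j : ℝ) + 1) with hs
  have hs1 : ∀ j, 1 < s j := fun j => by
    have : (0 : ℝ) < 1 / ((j : ℝ) + 1) := by positivity
    simp only [hs]; linarith
  have hs0 : ∀ j, s j ≠ 0 := fun j => by linarith [hs1 j]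
  have hcomp : ∀ j (x : Vec n), AffineMap.homothety x₀ (s j)⁻¹ (AffineMap.homothety x₀ (s j) x)
      = x := fun j x => by
    rw [← AffineMap.homothety_mul_apply, inv_mul_cancel₀ (hs0 j), AffineMap.homothety_one]; rfl
  refine ⟨fun j => AffineMap.homothety x₀ (s j)⁻¹ '' closure D, fun j => ?_, fun j => ?_,
    fun j => ?_, fun x hx => ?_⟩
  · exact hDb.isCompact_closure.image (AffineMap.homothety_continuous x₀ _)
  · exact hDc.closure.affine_image _
  · rintro _ ⟨z, hz, rfl⟩
    obtain ⟨w, hw, rfl⟩ := hDc.closure_subset_image_homothety_interior_of_one_lt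
      (hD.interior_eq.symm ▸ hx₀) (s j) (hs1 j) hz
    rw [hcomp]; exact interior_subset hw
  · have hlim : Tendsto (fun j => AffineMap.homothety x₀ (s j) x) atTop (𝓝 x) := by
      have h1 : Tendsto s atTop (𝓝 (1 + 0)) :=
        tendsto_one_div_add_atTop_nhds_zero_nat.const_add 1
      have h2 := (h1.smul_const (x - x₀)).add_const x₀
      simpa [AffineMap.homothety_apply] using h2
    filter_upwards [hlim.eventually (hD.mem_nhds hx)] with j hj
    exact ⟨_, subset_closure hj, hcomp j x⟩

lemma IsUniformOnConvex.exists_cutoffExhaustion (hW : W ∈ Matrix.orthogonalGroup (Fin n) ℝ)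
    {ρ : Vec n → ℝ} (h : IsUniformOnConvex ρ) {C : ℝ}
    (hC : Metric.diam (domain ρ) ^ 2 * 2 ^ n ≤ 2 * C) :
    Nonempty (CutoffExhaustion hk W ρ C) := by
  obtain ⟨K, hKc, hKconv, hKD, hKe⟩ :=
    exists_compact_convex_exhaustion h.isOpen h.convex h.bounded h.nonempty
  choose χ hχd hχs hχD hχ0 hχ1 hχK using fun j => exists_cutoff (hKc j) h.isOpen (hKD j)
  -- the cutoff is constant near `K j`, so the error bound holds with constant `0`
  refine ⟨⟨K, χ, 0, fun j => (hKc j).measurableSet, hχd, hχs, hχD, hχ0, hχ1, fun j x hx => ?_,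
    fun x hx => ?_, fun j => ?_⟩⟩
  · rw [(hχK j x hx).fderiv_eq]
    simp
  · filter_upwards [hKe x hx] with j hj
    exact ⟨hj, (hχK j x hj).eq_of_nhds⟩
  · have e : (K j).indicator ρ = (K j).indicator fun _ => (volume.real (domain ρ))⁻¹ := by
      refine Set.indicator_congr fun x hx => ?_
      conv_lhs => rw [h.eq_indicator]
      exact Set.indicator_of_mem (hKD j hx) _
    rw [e]
    refine slicePoincare_indicator_const hW (hKconv j) (hKc j).measurableSet
      (d := Metric.diam (domain ρ)) (fun x hx x' hx' => ?_) hC _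
    rw [← dist_eq_norm]
    exact Metric.dist_le_diam_of_mem h.bounded (hKD j hx) (hKD j hx')

lemma IsStdNormal.exists_cutoffExhaustion (hW : W ∈ Matrix.orthogonalGroup (Fin n) ℝ)
    {ρ : Vec n → ℝ} (h : IsStdNormal ρ) : Nonempty (CutoffExhaustion hk W ρ 1) := by
  have hu : domain ρ = Set.univ := Set.eq_univ_of_forall h.pos
  -- dilating by `(j + 1)²` makes the gradients decay faster than the truncation height `j + 1` grows
  let η : ContDiffBump (0 : Vec n) := ⟨1, 2, one_pos, one_lt_two⟩
  have hη : ContDiff ℝ ∞ η := η.contDiff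
  obtain ⟨B, hB⟩ := (η.hasCompactSupport.fderiv (𝕜 := ℝ)).exists_bound_of_continuous
    (hη.continuous_fderiv (by simp))
  set r : ℕ → ℝ := fun j => (((j : ℝ) + 1) ^ 2)⁻¹ with hr
  have hr0 : ∀ j, 0 < r j := fun j => by simp only [hr]; positivity
  refine ⟨⟨fun _ => Set.univ, fun j x => η (r j • x), B, fun _ => MeasurableSet.univ,
    fun j => hη.comp (contDiff_id.const_smul _),
    fun j => η.hasCompactSupport.comp_homeomorph (Homeomorph.smulOfNeZero (r j) (hr0 j).ne'),
    fun j => by rw [hu]; exact Set.subset_univ _, fun _ _ => η.nonneg, fun _ _ => η.le_one,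
    fun j x _ => ?_, fun x _ => ?_, fun j => ?_⟩⟩
  · have h1 : HasFDerivAt (fun x : Vec n => r j • x) (r j • ContinuousLinearMap.id ℝ (Vec n)) x :=
      (r j • ContinuousLinearMap.id ℝ (Vec n)).hasFDerivAt
    have h2 := (hη.differentiable (by simp) (r j • x)).hasFDerivAt.comp x h1
    have h3 : fderiv ℝ (fun x => η (r j • x)) x = r j • fderiv ℝ η (r j • x) := by
      rw [show (fun x => η (r j • x)) = (η : Vec n → ℝ) ∘ fun x => r j • x from rfl, h2.fderiv]
      ext v; simp
    rw [h3, norm_smul, Real.norm_of_nonneg (hr0 j).le, div_eq_mul_inv, mul_comm]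
    exact mul_le_mul_of_nonneg_right (hB _) (hr0 j).le
  · have h1 : Tendsto (fun j => r j • x) atTop (𝓝 0) := by
      have h2 : Tendsto (fun j : ℕ => 1 / ((j : ℝ) + 1)) atTop (𝓝 0) :=
        tendsto_one_div_add_atTop_nhds_zero_nat
      have h3 := ((h2.pow 2).smul_const x)
      simpa [hr] using h3
    filter_upwards [h1.eventually (Metric.closedBall_mem_nhds 0 one_pos)] with j hj
    exact ⟨Set.mem_univ x, η.one_of_mem_closedBall hj⟩
  · rw [Set.indicator_univ]; exact h.slicePoincare hW

end Exhaustions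

/-! ### The energy in the inactive directions and the eigenvalues -/

section Spectral

lemma sum_inactive_le {n k : ℕ} {g : Fin n → ℝ} (hg : ∀ i, 0 ≤ g i) :
    ∑ l : Fin (n - k), g ⟨k + l, by omega⟩ ≤ ∑ i, g i := by
  have hinj : Function.Injective fun l : Fin (n - k) => (⟨k + l, by omega⟩ : Fin n) :=
    fun l l' h => by simpa [Fin.ext_iff] using h
  refine (Finset.sum_map Finset.univ ⟨_, hinj⟩ g).symm.trans_le ?_
  exact Finset.sum_le_univ_sum_of_nonneg hg

variable {n k : ℕ} {hk : k ≤ n} {W V : Matrix (Fin n) (Fin n) ℝ}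

lemma integrable_gradExt_mul {ρ f : Vec n → ℝ} (hρ : IsRegularDensity ρ)
    (hf : IsAdmissible ρ f) (i j : Fin n) :
    Integrable fun x => gradExt ρ f i x * gradExt ρ f j x * ρ x := by
  have hi := hf.integrable_gradExt_sq hρ.measurable i
  have hj := hf.integrable_gradExt_sq hρ.measurable j
  refine (hi.add hj).mono' ((((hf.measurable_gradExt hρ i).mul (hf.measurable_gradExt hρ j)).mul
    hρ.measurable).aestronglyMeasurable) (ae_of_all _ fun x => ?_)
  rw [norm_mul, Real.norm_of_nonneg (hρ.nonneg x), Real.norm_eq_abs, abs_mul, Pi.add_apply,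
    ← add_mul]
  refine mul_le_mul_of_nonneg_right ?_ (hρ.nonneg x)
  nlinarith [sq_nonneg (|gradExt ρ f i x| - |gradExt ρ f j x|), sq_abs (gradExt ρ f i x),
    sq_abs (gradExt ρ f j x), sq_nonneg (|gradExt ρ f i x| + |gradExt ρ f j x|)]

lemma gradMatrix_apply {ρ f : Vec n → ℝ} (hρ : Measurable ρ) (i j : Fin n) :
    gradMatrix ρ f i j = ∫ x, gradExt ρ f i x * gradExt ρ f j x * ρ x := by
  rw [gradMatrix, Matrix.of_apply, ← integral_indicator (measurableSet_domain hρ)]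
  congr 1; ext x
  by_cases hx : x ∈ domain ρ <;> simp [gradExt, hx]

/-- The quadratic form of the gradient matrix. -/
lemma integral_sq_sum_gradExt {ρ f : Vec n → ℝ} (hρ : IsRegularDensity ρ)
    (hf : IsAdmissible ρ f) (w : Fin n → ℝ) :
    ∫ x, (∑ i, w i * gradExt ρ f i x) ^ 2 * ρ x = w ⬝ᵥ (gradMatrix ρ f *ᵥ w) := by
  have e : ∀ x, (∑ i, w i * gradExt ρ f i x) ^ 2 * ρ x
      = ∑ i, ∑ j, w i * w j * (gradExt ρ f i x * gradExt ρ f j x * ρ x) := fun x => by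
    rw [pow_two, Finset.sum_mul_sum, Finset.sum_mul]
    refine Finset.sum_congr rfl fun i _ => ?_
    rw [Finset.sum_mul]
    exact Finset.sum_congr rfl fun j _ => by ring
  simp_rw [e]
  rw [integral_finsetSum _ fun i _ => integrable_finsetSum _ fun j _ =>
    (integrable_gradExt_mul hρ hf i j).const_mul _]
  simp only [dotProduct, Matrix.mulVec, Finset.mul_sum]
  refine Finset.sum_congr rfl fun i _ => ?_
  rw [integral_finsetSum _ fun j _ => (integrable_gradExt_mul hρ hf i j).const_mul _]
  refine Finset.sum_congr rfl fun j _ => ?_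
  rw [integral_const_mul, gradMatrix_apply hρ.measurable]
  ring

/-- In the eigenbasis the quadratic form of the gradient matrix is diagonal. -/
lemma IsEigenbasis.dotProduct_gradMatrix {ρ f : Vec n → ℝ} {lam : Fin n → ℝ}
    (h : IsEigenbasis ρ f W lam) (w : Fin n → ℝ) :
    w ⬝ᵥ (gradMatrix ρ f *ᵥ w) = ∑ j, lam j * ((Wᵀ *ᵥ w) j) ^ 2 := by
  rw [h.eigen, ← Matrix.mulVec_mulVec, ← Matrix.mulVec_mulVec, Matrix.dotProduct_mulVec,
    ← Matrix.mulVec_transpose, dotProduct]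
  refine Finset.sum_congr rfl fun j _ => ?_
  rw [Matrix.mulVec_diagonal]; ring

lemma IsEigenbasis.nonneg {ρ f : Vec n → ℝ} {lam : Fin n → ℝ} (hρ : IsRegularDensity ρ)
    (hf : IsAdmissible ρ f) (h : IsEigenbasis ρ f W lam) (j : Fin n) : 0 ≤ lam j := by
  have hW : Wᵀ * W = 1 := by
    have := (Matrix.mem_orthogonalGroup_iff' (Fin n) ℝ).1 h.orthogonal
    simpa [Matrix.star_eq_conjTranspose] using this
  have h1 := h.dotProduct_gradMatrix (W *ᵥ Pi.single j 1)
  rw [← integral_sq_sum_gradExt hρ hf, Matrix.mulVec_mulVec, hW, Matrix.one_mulVec] at h1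
  have h2 : ∑ i, lam i * (Pi.single j (1 : ℝ) : Fin n → ℝ) i ^ 2 = lam j := by
    rw [Finset.sum_eq_single j] <;> simp +contextual
  rw [h2] at h1
  rw [← h1]
  exact integral_nonneg fun x => mul_nonneg (sq_nonneg _) (hρ.nonneg x)

/-- The row `j` of `Wᵀ V₂` is at most as long as the row `j` of the orthogonal matrix `Wᵀ V`. -/
lemma sum_sq_row_le_one (hW : W ∈ Matrix.orthogonalGroup (Fin n) ℝ)
    (hV : V ∈ Matrix.orthogonalGroup (Fin n) ℝ) (j : Fin n) :
    ∑ l, ((Wᵀ *ᵥ (cols₂ hk V).col l) j) ^ 2 ≤ 1 := by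
  have hU : (Wᵀ * V) * (Wᵀ * V)ᵀ = 1 := by
    have h1 : Wᵀ * W = 1 := by
      simpa [Matrix.star_eq_conjTranspose] using (Matrix.mem_orthogonalGroup_iff' (Fin n) ℝ).1 hW
    have h2 : V * Vᵀ = 1 := by
      simpa [Matrix.star_eq_conjTranspose] using (Matrix.mem_orthogonalGroup_iff (Fin n) ℝ).1 hV
    rw [Matrix.transpose_mul, Matrix.transpose_transpose, Matrix.mul_assoc, ← Matrix.mul_assoc V,
      h2, Matrix.one_mul, h1]
  have h3 := congrFun (congrFun hU j) j
  rw [Matrix.mul_apply, Matrix.one_apply_eq] at h3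
  rw [← h3]
  refine le_trans (le_of_eq ?_) (sum_inactive_le (k := k)
    (g := fun i => (Wᵀ * V) j i * (Wᵀ * V)ᵀ i j) fun i => mul_self_nonneg _)
  refine Finset.sum_congr rfl fun l _ => ?_
  rw [Matrix.transpose_apply, ← pow_two]
  rfl

/-- If `V` is close to `W`, then the leading rows of `Wᵀ V₂ = Wᵀ (V₂ - W₂) + Wᵀ W₂` are short:
there the second summand vanishes. -/
lemma sum_sq_row_le (hW : W ∈ Matrix.orthogonalGroup (Fin n) ℝ)
    {ε : ℝ} (hε : ‖Matrix.toEuclideanCLM (n := Fin n) (𝕜 := ℝ) (W - V)‖ ≤ ε) {j : Fin n}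
    (hj : (j : ℕ) < k) :
    ∑ l, ((Wᵀ *ᵥ (cols₂ hk V).col l) j) ^ 2 ≤ ε ^ 2 := by
  set w : Vec n := WithLp.toLp 2 fun a => W a j with hw
  have hw1 : ‖w‖ = 1 := by
    rw [← sq_eq_sq₀ (norm_nonneg _) zero_le_one, EuclideanSpace.norm_sq_eq]
    have := sum_mul_of_orthogonal hW j j
    simpa [hw, pow_two] using this
  set T := Matrix.toEuclideanCLM (n := Fin n) (𝕜 := ℝ) (star (W - V)) with hT
  have hTn : ‖T‖ ≤ ε := by
    rw [hT, map_star, ContinuousLinearMap.star_eq_adjoint, LinearIsometryEquiv.norm_map]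
    exact hε
  have hTw : ‖T w‖ ≤ ε := (T.le_opNorm w).trans (by rw [hw1, mul_one]; exact hTn)
  have hTi : ∀ i, (T w) i = ∑ a, (W a i - V a i) * W a j := fun i => by
    simp [hT, hw, Matrix.toEuclideanCLM_toLp, Matrix.mulVec, dotProduct, sub_mul]
  have h1 : ‖T w‖ ^ 2 ≤ ε ^ 2 := by gcongr
  rw [EuclideanSpace.norm_sq_eq] at h1
  refine le_trans (le_trans (le_of_eq ?_) (sum_inactive_le (k := k)
    (g := fun i => ‖(T w) i‖ ^ 2) fun i => sq_nonneg _)) h1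
  refine Finset.sum_congr rfl fun l _ => ?_
  have h0 := sum_mul_of_orthogonal hW ⟨k + l, by omega⟩ j
  rw [if_neg (by intro h; have := congrArg Fin.val h; simp at this; omega)] at h0
  rw [Real.norm_eq_abs, sq_abs, hTi]
  simp only [sub_mul, Finset.sum_sub_distrib, h0, zero_sub, neg_sq]
  congr 1
  simp only [Matrix.mulVec, dotProduct, Matrix.transpose_apply, Matrix.col_apply, cols₂,
    Matrix.submatrix_apply, id]
  exact Finset.sum_congr rfl fun a _ => mul_comm _ _

/-- The mean squared gradient in the inactive directions of the perturbed basis, in terms of the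
eigenvalues. -/
lemma lintegral_inactiveGrad_le {ρ f : Vec n → ℝ} (hρ : IsRegularDensity ρ)
    (hf : IsAdmissible ρ f) {lam : Fin n → ℝ} (h : IsEigenbasis ρ f W lam)
    (hV : V ∈ Matrix.orthogonalGroup (Fin n) ℝ) {ε : ℝ} (hε0 : 0 ≤ ε)
    (hε : ‖Matrix.toEuclideanCLM (n := Fin n) (𝕜 := ℝ) (W - V)‖ ≤ ε) :
    ∫⁻ x, ENNReal.ofReal (∑ l, inactiveGrad hk V ρ f l x ^ 2) * ENNReal.ofReal (ρ x)
      ≤ ENNReal.ofReal ((ε * √(∑ i ∈ {i : Fin n | (i : ℕ) < k}, lam i)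
            + √(∑ i ∈ {i : Fin n | k ≤ (i : ℕ)}, lam i)) ^ 2) := by
  have hlam := h.nonneg hρ hf
  set S₁ := ∑ i ∈ {i : Fin n | (i : ℕ) < k}, lam i with hS₁
  set S₂ := ∑ i ∈ {i : Fin n | k ≤ (i : ℕ)}, lam i with hS₂
  have hS₁0 : 0 ≤ S₁ := Finset.sum_nonneg fun i _ => hlam i
  have hS₂0 : 0 ≤ S₂ := Finset.sum_nonneg fun i _ => hlam i
  have hint : ∀ l, Integrable fun x => inactiveGrad hk V ρ f l x ^ 2 * ρ x :=
    integrable_inactiveGrad_sq hρ hf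
  have e : ∀ x, ENNReal.ofReal (∑ l, inactiveGrad hk V ρ f l x ^ 2) * ENNReal.ofReal (ρ x)
      = ENNReal.ofReal (∑ l, inactiveGrad hk V ρ f l x ^ 2 * ρ x) := fun x => by
    rw [← ENNReal.ofReal_mul (Finset.sum_nonneg fun _ _ => sq_nonneg _), Finset.sum_mul]
  simp_rw [e]
  rw [← ofReal_integral_eq_lintegral_ofReal (integrable_finsetSum _ fun l _ => hint l)
    (ae_of_all _ fun x => Finset.sum_nonneg fun l _ => mul_nonneg (sq_nonneg _) (hρ.nonneg x)),
    integral_finsetSum _ fun l _ => hint l]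
  refine ENNReal.ofReal_le_ofReal ?_
  have e2 : ∀ l, ∫ x, inactiveGrad hk V ρ f l x ^ 2 * ρ x
      = ∑ j, lam j * ((Wᵀ *ᵥ (cols₂ hk V).col l) j) ^ 2 := fun l => by
    rw [← h.dotProduct_gradMatrix, ← integral_sq_sum_gradExt hρ hf]; rfl
  simp_rw [e2]
  rw [Finset.sum_comm]
  simp_rw [← Finset.mul_sum]
  have hsplit : ∀ g : Fin n → ℝ, ∑ j, g j = ∑ j ∈ {i : Fin n | (i : ℕ) < k}, g j
      + ∑ j ∈ {i : Fin n | k ≤ (i : ℕ)}, g j := fun g => by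
    rw [← Finset.sum_filter_add_sum_filter_not Finset.univ (fun i : Fin n => (i : ℕ) < k)]
    simp only [not_lt]
  calc _ ≤ ε ^ 2 * S₁ + S₂ := by
        rw [hsplit, hS₁, hS₂, Finset.mul_sum]
        refine add_le_add (Finset.sum_le_sum fun j hj => ?_) (Finset.sum_le_sum fun j _ => ?_)
        · rw [mul_comm]
          exact mul_le_mul_of_nonneg_right (sum_sq_row_le h.orthogonal hε (by simpa using hj))
            (hlam j)
        · exact mul_le_of_le_one_right (hlam j) (sum_sq_row_le_one h.orthogonal hV j)
    _ = (ε * √S₁) ^ 2 + √S₂ ^ 2 := by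
        rw [mul_pow, Real.sq_sqrt hS₁0, Real.sq_sqrt hS₂0]
    _ ≤ (ε * √S₁ + √S₂) ^ 2 := by
        have h3 : 0 ≤ (ε * √S₁) * √S₂ := by positivity
        linarith [add_sq (ε * √S₁) √S₂]

end Spectral

/-! ### Conditional distributions -/

section Conditional

variable {n k : ℕ} {hk : k ≤ n} {V : Matrix (Fin n) (Fin n) ℝ} {ρ f : Vec n → ℝ}

/-- A point `y` of the active domain whose slice has finite positive mass. -/
structure IsRegularPoint (hk : k ≤ n) (V : Matrix (Fin n) (Fin n) ℝ) (ρ : Vec n → ℝ)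
    (y : Vec k) : Prop where
  mem : y ∈ activeDomain hk V ρ
  ne_zero : sliceMass hk V ρ y ≠ 0
  ne_top : sliceMass hk V ρ y ≠ ⊤

lemma condDensity_eq_zero (hρ : ∀ x, 0 ≤ ρ x) {y : Vec k} {z : Vec (n - k)}
    (h : assemble hk V y z ∉ domain ρ) : condDensity hk V ρ y z = 0 := by
  have h0 : ρ (assemble hk V y z) = 0 := le_antisymm (not_lt.1 h) (hρ _)
  simp [condDensity, h0]

lemma mul_condDensity_indicator (hρ : ∀ x, 0 ≤ ρ x) (y : Vec k) (z : Vec (n - k)) :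
    (domain ρ).indicator f (assemble hk V y z) * condDensity hk V ρ y z
      = f (assemble hk V y z) * condDensity hk V ρ y z := by
  by_cases h : assemble hk V y z ∈ domain ρ
  · rw [Set.indicator_of_mem h]
  · rw [condDensity_eq_zero hρ h, mul_zero, mul_zero]

lemma condExpect_indicator (hρ : ∀ x, 0 ≤ ρ x) (y : Vec k) :
    condExpect hk V ρ ((domain ρ).indicator f) y = condExpect hk V ρ f y := by
  simp only [condExpect, mul_condDensity_indicator hρ]

lemma IsRegularPoint.ofReal_condDensity (hρ : IsRegularDensity ρ) {y : Vec k}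
    (h : IsRegularPoint hk V ρ y) (z : Vec (n - k)) :
    ENNReal.ofReal (condDensity hk V ρ y z)
      = ENNReal.ofReal (ρ (assemble hk V y z)) * (sliceMass hk V ρ y)⁻¹ := by
  have hm : marginalDensity hk V ρ y = (sliceMass hk V ρ y).toReal := by
    have hmz : Measurable fun z => ρ (assemble hk V y z) :=
      hρ.measurable.comp (measurable_assemble₂ measurable_const measurable_id)
    exact integral_eq_lintegral_of_nonneg_ae (ae_of_all _ fun z => hρ.nonneg _)
      hmz.aestronglyMeasurable
  rw [condDensity, if_pos h.mem, hm,
    ENNReal.ofReal_div_of_pos (ENNReal.toReal_pos h.ne_zero h.ne_top), ENNReal.ofReal_toReal h.ne_top, div_eq_mul_inv]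

lemma measurable_marginalDensity (hρ : Measurable ρ) : Measurable (marginalDensity hk V ρ) := by
  have h : Measurable fun p : Vec k × Vec (n - k) => ρ (assemble hk V p.1 p.2) :=
    hρ.comp (measurable_assemble₂ measurable_fst measurable_snd)
  exact h.stronglyMeasurable.integral_prod_right'.measurable

lemma isOpen_activeDomain (hV : V ∈ Matrix.orthogonalGroup (Fin n) ℝ)
    (hρ : IsOpen (domain ρ)) : IsOpen (activeDomain hk V ρ) := by
  let L : Vec n →L[ℝ] Vec k := LinearMap.toContinuousLinearMap
    { toFun := active hk V, map_add' := mulE_add _, map_smul' := mulE_smul _ }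
  have hs : Function.Surjective L := fun y => ⟨assemble hk V y 0, active_assemble hk hV y 0⟩
  exact L.isOpenMap hs _ hρ

lemma measurable_condDensity (hV : V ∈ Matrix.orthogonalGroup (Fin n) ℝ)
    (hρ : IsRegularDensity ρ) :
    Measurable fun p : Vec k × Vec (n - k) => condDensity hk V ρ p.1 p.2 := by
  refine Measurable.ite ((isOpen_activeDomain hV hρ.isOpen).measurableSet.preimage measurable_fst)
    ?_ measurable_const
  exact (hρ.measurable.comp (measurable_assemble₂ measurable_fst measurable_snd)).div
    ((measurable_marginalDensity hρ.measurable).comp measurable_fst)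

lemma measurable_condExpect (hV : V ∈ Matrix.orthogonalGroup (Fin n) ℝ)
    (hρ : IsRegularDensity ρ) {F : Vec n → ℝ} (hF : Measurable F) :
    Measurable (condExpect hk V ρ F) := by
  have h : Measurable fun p : Vec k × Vec (n - k) =>
      F (assemble hk V p.1 p.2) * condDensity hk V ρ p.1 p.2 :=
    (hF.comp (measurable_assemble₂ measurable_fst measurable_snd)).mul
      (measurable_condDensity hV hρ)
  exact h.stronglyMeasurable.integral_prod_right'.measurable

lemma lintegral_condDensity (hV : V ∈ Matrix.orthogonalGroup (Fin n) ℝ)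
    (hρ : IsRegularDensity ρ) {y : Vec k} (h : IsRegularPoint hk V ρ y)
    {G : Vec (n - k) → ℝ≥0∞} (hG : Measurable G) :
    ∫⁻ z, G z ∂(densityMeasure (condDensity hk V ρ y))
      = (sliceMass hk V ρ y)⁻¹ * ∫⁻ z, G z * ENNReal.ofReal (ρ (assemble hk V y z)) := by
  have hm : Measurable fun z => ENNReal.ofReal (condDensity hk V ρ y z) :=
    ((measurable_condDensity hV hρ).comp measurable_prodMk_left).ennreal_ofReal
  rw [densityMeasure, lintegral_withDensity_eq_lintegral_mul _ hm hG,
    ← lintegral_const_mul' _ _ (ENNReal.inv_ne_top.2 h.ne_zero)]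
  refine lintegral_congr fun z => ?_
  rw [Pi.mul_apply, h.ofReal_condDensity hρ]; ring

lemma IsRegularPoint.isProbabilityMeasure (hV : V ∈ Matrix.orthogonalGroup (Fin n) ℝ)
    (hρ : IsRegularDensity ρ) {y : Vec k} (h : IsRegularPoint hk V ρ y) :
    IsProbabilityMeasure (densityMeasure (condDensity hk V ρ y)) := by
  refine ⟨?_⟩
  rw [← lintegral_one, lintegral_condDensity hV hρ h measurable_const]
  simp only [one_mul]
  exact ENNReal.inv_mul_cancel h.ne_zero h.ne_top

lemma condDensity_nonneg (hρ : ∀ x, 0 ≤ ρ x) (y : Vec k) (z : Vec (n - k)) :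
    0 ≤ condDensity hk V ρ y z := by
  unfold condDensity
  split_ifs
  · exact div_nonneg (hρ _) (integral_nonneg fun _ => hρ _)
  · exact le_rfl

lemma condExpect_eq_integral (hV : V ∈ Matrix.orthogonalGroup (Fin n) ℝ)
    (hρ : IsRegularDensity ρ) (F : Vec n → ℝ) (y : Vec k) :
    condExpect hk V ρ F y
      = ∫ z, F (assemble hk V y z) ∂(densityMeasure (condDensity hk V ρ y)) := by
  have hm : Measurable fun z => condDensity hk V ρ y z :=
    (measurable_condDensity hV hρ).comp measurable_prodMk_left
  rw [integral_densityMeasure hm (condDensity_nonneg hρ.nonneg y), condExpect]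
  simp_rw [mul_comm]

/-- The pair integral over the slice at `y`, weighted by the density of the active variable. -/
noncomputable def slicePairEnergy (hk : k ≤ n) (V : Matrix (Fin n) (Fin n) ℝ) (ρ F : Vec n → ℝ)
    (y : Vec k) : ℝ≥0∞ :=
  (sliceMass hk V ρ y)⁻¹ * ∫⁻ z, ∫⁻ z',
      ENNReal.ofReal ((F (assemble hk V y z) - F (assemble hk V y z')) ^ 2) *
        (ENNReal.ofReal (ρ (assemble hk V y z)) * ENNReal.ofReal (ρ (assemble hk V y z')))

lemma measurable_lintegral_lintegral {α β : Type*} [MeasurableSpace α] [MeasurableSpace β]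
    {μ : Measure β} [SFinite μ] {Φ : α → β → β → ℝ≥0∞}
    (hΦ : Measurable fun p : α × β × β => Φ p.1 p.2.1 p.2.2) :
    Measurable fun a => ∫⁻ b, ∫⁻ b', Φ a b b' ∂μ ∂μ := by
  have h2 : Measurable fun p : (α × β) × β => Φ p.1.1 p.1.2 p.2 :=
    hΦ.comp (by fun_prop : Measurable fun p : (α × β) × β => (p.1.1, p.1.2, p.2))
  have h3 : Measurable fun p : α × β => ∫⁻ b', Φ p.1 p.2 b' ∂μ := h2.lintegral_prod_right'
  exact h3.lintegral_prod_right'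

lemma measurable_slicePairEnergy (hρ : Measurable ρ) {F : Vec n → ℝ} (hF : Measurable F) :
    Measurable (slicePairEnergy hk V ρ F) := by
  have h := measurable_lintegral_lintegral (μ := volume)
    (Φ := fun (y : Vec k) (z z' : Vec (n - k)) =>
      ENNReal.ofReal ((F (assemble hk V y z) - F (assemble hk V y z')) ^ 2) *
        (ENNReal.ofReal (ρ (assemble hk V y z)) * ENNReal.ofReal (ρ (assemble hk V y z'))))
    (measurable_pairIntegrand_right (hk := hk) (W := V) hρ hF)
  have h' : Measurable fun y => (sliceMass hk V ρ y)⁻¹ := (measurable_sliceMass hρ).inv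
  exact h'.mul h

lemma lintegral_slicePairEnergy (hρ : Measurable ρ) {F : Vec n → ℝ} (hF : Measurable F) :
    ∫⁻ y, slicePairEnergy hk V ρ F y = pairEnergy hk V ρ F :=
  (pairEnergy_eq hρ hF).symm

/-- Double integrals against the normalization `ν` of a density `r` of mass `c`. -/
lemma lintegral_lintegral_eq_of_density {β : Type*} [MeasurableSpace β] {μ ν : Measure β}
    [SFinite μ] {c : ℝ≥0∞} {r : β → ℝ≥0∞} {D : β → β → ℝ≥0∞} (hc0 : c ≠ 0) (hc : c ≠ ⊤)
    (hD : Measurable (Function.uncurry D)) (hr : Measurable r)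
    (hν : ∀ H : β → ℝ≥0∞, Measurable H → ∫⁻ z, H z ∂ν = c⁻¹ * ∫⁻ z, H z * r z ∂μ) :
    c⁻¹ * ∫⁻ z, ∫⁻ z', D z z' * (r z * r z') ∂μ ∂μ = c * ∫⁻ z, ∫⁻ z', D z z' ∂ν ∂ν := by
  have hz : ∀ z, Measurable (D z) := fun z => hD.comp measurable_prodMk_left
  have hm : Measurable (Function.uncurry fun z z' => D z z' * r z') :=
    hD.mul (hr.comp measurable_snd)
  have hI : Measurable fun z => ∫⁻ z', D z z' * r z' ∂μ := hm.lintegral_prod_right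
  have h1 : ∀ z, ∫⁻ z', D z z' ∂ν = c⁻¹ * ∫⁻ z', D z z' * r z' ∂μ := fun z => hν _ (hz z)
  have h2 : ∀ z, ∫⁻ z', D z z' * (r z * r z') ∂μ = (∫⁻ z', D z z' * r z' ∂μ) * r z := fun z => by
    have hzr : Measurable fun z' => D z z' * r z' := (hz z).mul hr
    rw [← lintegral_mul_const _ hzr]
    refine lintegral_congr fun z' => ?_
    rw [mul_assoc, mul_comm (r z)]
  have hIr : Measurable fun z => (∫⁻ z', D z z' * r z' ∂μ) * r z := hI.mul hr
  simp only [h1, h2]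
  rw [hν _ (hI.const_mul _), ← mul_assoc, ENNReal.mul_inv_cancel hc0 hc, one_mul,
    ← lintegral_const_mul _ hIr]
  exact lintegral_congr fun z => (mul_assoc _ _ _).symm

lemma measurable_sq_sub_comp {β : Type*} [MeasurableSpace β] {G : β → ℝ} (hG : Measurable G) :
    Measurable (Function.uncurry fun z z' => ENNReal.ofReal ((G z - G z') ^ 2)) :=
  (((hG.comp measurable_fst).sub (hG.comp measurable_snd)).pow_const 2).ennreal_ofReal

/-- The pair integral over a slice in terms of two independent points drawn from the conditional
distribution. -/
lemma slicePairEnergy_eq (hV : V ∈ Matrix.orthogonalGroup (Fin n) ℝ)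
    (hρ : IsRegularDensity ρ) {F : Vec n → ℝ} (hF : Measurable F) {y : Vec k}
    (h : IsRegularPoint hk V ρ y) :
    slicePairEnergy hk V ρ F y = sliceMass hk V ρ y *
      ∫⁻ z, ∫⁻ z', ENNReal.ofReal ((F (assemble hk V y z) - F (assemble hk V y z')) ^ 2)
        ∂(densityMeasure (condDensity hk V ρ y)) ∂(densityMeasure (condDensity hk V ρ y)) := by
  exact lintegral_lintegral_eq_of_density h.ne_zero h.ne_top
    (measurable_sq_sub_comp (hF.comp (measurable_assemble₂ measurable_const measurable_id)))
    (hρ.measurable.comp (measurable_assemble₂ measurable_const measurable_id)).ennreal_ofReal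
    fun G hG => lintegral_condDensity hV hρ h hG

/-- A function with finite pair integral is square integrable: this needs no integrability to
begin with. -/
lemma memLp_two_of_pair {α : Type*} [MeasurableSpace α] {ν : Measure α} [IsProbabilityMeasure ν]
    {F : α → ℝ} (hF : Measurable F)
    (h : ∫⁻ z, ∫⁻ z', ENNReal.ofReal ((F z - F z') ^ 2) ∂ν ∂ν ≠ ⊤) : MemLp F 2 ν := by
  have hpm : Measurable fun p : α × α => ENNReal.ofReal ((F p.1 - F p.2) ^ 2) :=
    (((hF.comp measurable_fst).sub (hF.comp measurable_snd)).pow_const 2).ennreal_ofReal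
  obtain ⟨z, hz⟩ := (ae_lt_top hpm.lintegral_prod_right' h).exists
  have h1 : MemLp (fun z' => F z - F z') 2 ν := by
    have hm : Measurable fun z' => F z - F z' := measurable_const.sub hF
    rw [memLp_two_iff_integrable_sq hm.aestronglyMeasurable]
    exact ⟨(hm.pow_const 2).aestronglyMeasurable,
      (hasFiniteIntegral_iff_ofReal (ae_of_all _ fun _ => sq_nonneg _)).2 hz⟩
  have h2 := (memLp_const (F z)).sub h1
  refine h2.ae_eq (ae_of_all _ fun z' => ?_)
  simp

/-- The marginal distribution of the active variable. -/
lemma map_active_densityMeasure (hV : V ∈ Matrix.orthogonalGroup (Fin n) ℝ) (hρ : Measurable ρ) :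
    (densityMeasure ρ).map (active hk V) = volume.withDensity (sliceMass hk V ρ) := by
  have ham : Measurable (active hk V) := (continuous_active hk).measurable
  ext s hs
  have hms : MeasurableSet (active hk V ⁻¹' s) := ham hs
  rw [Measure.map_apply ham hs, densityMeasure, withDensity_apply _ hms, withDensity_apply _ hs,
    ← lintegral_indicator hms, ← lintegral_indicator hs,
    ← lintegral_lintegral_assemble (hk := hk) hV (hρ.ennreal_ofReal.indicator hms)]
  refine lintegral_congr fun y => ?_
  by_cases hy : y ∈ s
  · rw [Set.indicator_of_mem hy, sliceMass]
    refine lintegral_congr fun z => ?_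
    rw [Set.indicator_of_mem]
    rwa [Set.mem_preimage, active_assemble hk hV]
  · rw [Set.indicator_of_notMem hy]
    rw [← lintegral_zero]
    refine lintegral_congr fun z => ?_
    rw [Set.indicator_of_notMem]
    rwa [Set.mem_preimage, active_assemble hk hV]

lemma ae_isRegularPoint (hV : V ∈ Matrix.orthogonalGroup (Fin n) ℝ) (hρ : IsRegularDensity ρ) :
    ∀ᵐ y ∂(volume.withDensity (sliceMass hk V ρ)), IsRegularPoint hk V ρ y := by
  have hm := measurable_sliceMass (hk := hk) (W := V) hρ.measurable
  rw [ae_withDensity_iff hm]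
  have hfin : ∫⁻ y, sliceMass hk V ρ y ≠ ⊤ := by
    have := lintegral_lintegral_assemble (hk := hk) hV hρ.measurable.ennreal_ofReal
    rw [show ∫⁻ y, sliceMass hk V ρ y = _ from this]
    exact ((hasFiniteIntegral_iff_ofReal (ae_of_all _ hρ.nonneg)).1
      hρ.integrable.hasFiniteIntegral).ne
  filter_upwards [ae_lt_top hm hfin] with y hy h0
  refine ⟨?_, h0, hy.ne⟩
  by_contra hmem
  refine h0 ?_
  rw [sliceMass, ← lintegral_zero]
  refine lintegral_congr fun z => ENNReal.ofReal_of_nonpos (not_lt.1 fun hz => hmem ?_)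
  exact ⟨assemble hk V y z, hz, active_assemble hk hV y z⟩

end Conditional

/-! ### The error of the Monte Carlo sum -/

section MonteCarlo

/-- The sample mean of `N` independent samples is unbiased, so its mean squared error is its
variance, namely `1 / N` times that of a single sample. -/
lemma lintegral_sq_sub_sampleMean {α Ω : Type*} [MeasurableSpace α] [MeasurableSpace Ω]
    {ν : Measure α} {P : Measure Ω} [IsProbabilityMeasure ν] [IsProbabilityMeasure P] {N : ℕ}
    (hN : 0 < N) {Z : Fin N → Ω → α} (hZ : ∀ j, Measurable (Z j)) (hlaw : ∀ j, P.map (Z j) = ν)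
    (hind : iIndepFun Z P) {F : α → ℝ} (hFm : Measurable F) (hF : MemLp F 2 ν) :
    ∫⁻ o, ENNReal.ofReal ((∫ z, F z ∂ν - 1 / (N : ℝ) * ∑ j, F (Z j o)) ^ 2) ∂P
      = ENNReal.ofReal (Var[F; ν] / N) := by
  have hN' : (N : ℝ) ≠ 0 := by positivity
  have hmem : ∀ j, MemLp (F ∘ Z j) 2 P := fun j => by
    have := hlaw j ▸ hF
    exact this.comp_of_map (hZ j).aemeasurable
  have hmean : ∀ j, ∫ o, F (Z j o) ∂P = ∫ z, F z ∂ν := fun j => by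
    rw [← hlaw j, integral_map (hZ j).aemeasurable hFm.aestronglyMeasurable]
  have hvar : ∀ j, Var[F ∘ Z j; P] = Var[F; ν] := fun j => by
    rw [← hlaw j, variance_map hFm.aemeasurable (hZ j).aemeasurable]
  have hsum : MemLp (fun o => ∑ j, F (Z j o)) 2 P := memLp_finsetSum _ fun j _ => hmem j
  have hS : MemLp (fun o => 1 / (N : ℝ) * ∑ j, F (Z j o)) 2 P := hsum.const_mul _
  have hES : ∫ o, 1 / (N : ℝ) * ∑ j, F (Z j o) ∂P = ∫ z, F z ∂ν := by
    have hint : ∀ j, Integrable (fun o => F (Z j o)) P := fun j => (hmem j).integrable one_le_two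
    rw [integral_const_mul, integral_finsetSum _ fun j _ => hint j]
    simp only [hmean]
    simp only [Finset.sum_const, Finset.card_univ, Fintype.card_fin, nsmul_eq_mul]
    field_simp
  have hVS : Var[fun o => 1 / (N : ℝ) * ∑ j, F (Z j o); P] = Var[F; ν] / N := by
    rw [variance_const_mul]
    have h1 := IndepFun.variance_sum (μ := P) (s := Finset.univ) (X := fun j => F ∘ Z j)
      (fun j _ => hmem j) fun i _ j _ hij => (hind.indepFun hij).comp hFm hFm
    have h2 : (fun o => ∑ j, F (Z j o)) = ∑ j, F ∘ Z j := by ext o; simp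
    rw [h2, h1]
    simp only [hvar, Finset.sum_const, Finset.card_univ, Fintype.card_fin, nsmul_eq_mul]
    field_simp
  rw [← hVS, variance_eq_integral hS.aemeasurable, hES, ofReal_integral_eq_lintegral_ofReal]
  · exact lintegral_congr fun o => by rw [← neg_sub, neg_sq]
  · exact (hS.sub (memLp_const _)).integrable_sq
  · exact ae_of_all _ fun _ => sq_nonneg _

end MonteCarlo

/-! ### The mean squared error -/

section MeanSquaredError

variable {n k N : ℕ} {hk : k ≤ n} {V : Matrix (Fin n) (Fin n) ℝ} {ρ f : Vec n → ℝ}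
  {Ω : Type*} [MeasurableSpace Ω] {P : Measure Ω} {Z : Fin N → Vec k → Ω → Vec (n - k)}

/-- A jointly measurable family indexed by a measurable set, extended by zero. -/
lemma measurable_zeroExtend {α β : Type*} [MeasurableSpace α] [MeasurableSpace β] [Zero β]
    {Y : Set α} (hY : MeasurableSet Y) {S : α → Ω → β}
    (hS : Measurable fun p : Y × Ω => S p.1 p.2) :
    Measurable fun p : α × Ω => Y.indicator (fun y => S y p.2) p.1 := by
  classical
  have hs : MeasurableSet (Prod.fst ⁻¹' Y : Set (α × Ω)) := hY.preimage measurable_fst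
  have h1 : Measurable fun q : (Prod.fst ⁻¹' Y : Set (α × Ω)) => S q.1.1 q.1.2 :=
    hS.comp (((measurable_fst.comp measurable_subtype_coe).subtype_mk (h := fun q => q.2)).prodMk
      (measurable_snd.comp measurable_subtype_coe))
  have h2 := Measurable.dite h1
    (measurable_const : Measurable fun _ : ((Prod.fst ⁻¹' Y : Set (α × Ω))ᶜ : Set (α × Ω)) =>
      (0 : β)) hs
  convert h2 using 2 with p
  simp [Set.indicator_apply]

lemma IsConditionalSample.measurable_apply (hZ : IsConditionalSample hk V ρ P Z) (j : Fin N)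
    {y : Vec k} (hy : y ∈ activeDomain hk V ρ) : Measurable (Z j y) :=
  (hZ.measurable j).comp (measurable_prodMk_left (x := (⟨y, hy⟩ : activeDomain hk V ρ)))

/-- Almost every sample lies in the domain, where `f` is measurable. -/
lemma IsConditionalSample.ae_mem_domain (hV : V ∈ Matrix.orthogonalGroup (Fin n) ℝ)
    (hρ : IsRegularDensity ρ) (hZ : IsConditionalSample hk V ρ P Z) (j : Fin N)
    {y : Vec k} (hy : y ∈ activeDomain hk V ρ) :
    ∀ᵐ t ∂P, assemble hk V y (Z j y t) ∈ domain ρ := by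
  have hm : Measurable fun z => ENNReal.ofReal (condDensity hk V ρ y z) :=
    ((measurable_condDensity hV hρ).comp measurable_prodMk_left).ennreal_ofReal
  have h : ∀ᵐ z ∂(densityMeasure (condDensity hk V ρ y)), assemble hk V y z ∈ domain ρ := by
    rw [densityMeasure, ae_withDensity_iff hm]
    refine ae_of_all _ fun z hz => ?_
    by_contra hmem
    exact hz (by rw [condDensity_eq_zero hρ.nonneg hmem, ENNReal.ofReal_zero])
  rw [← hZ.law j y hy] at h
  exact ae_of_ae_map (hZ.measurable_apply j hy).aemeasurable h

/-- A measurable version of the squared error `(g(y) - g_N(y, ω))²`: the function is replaced by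
zero off the domain and the samples by zero off the active domain. -/
noncomputable def sqErrorVersion (hk : k ≤ n) (V : Matrix (Fin n) (Fin n) ℝ) (ρ F : Vec n → ℝ)
    (Z : Fin N → Vec k → Ω → Vec (n - k)) (p : Vec k × Ω) : ℝ :=
  (condExpect hk V ρ F p.1 - 1 / (N : ℝ) * ∑ j, F (assemble hk V p.1
    ((activeDomain hk V ρ).indicator (fun y => Z j y p.2) p.1))) ^ 2

omit [MeasurableSpace Ω] in
lemma sqErrorVersion_nonneg (F : Vec n → ℝ) (p : Vec k × Ω) : 0 ≤ sqErrorVersion hk V ρ F Z p :=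
  sq_nonneg _

lemma measurable_assemble_sample (hV : V ∈ Matrix.orthogonalGroup (Fin n) ℝ)
    (hρ : IsRegularDensity ρ) (hZ : IsConditionalSample hk V ρ P Z) (j : Fin N) :
    Measurable fun p : Vec k × Ω => assemble hk V p.1
      ((activeDomain hk V ρ).indicator (fun y => Z j y p.2) p.1) :=
  measurable_assemble₂ measurable_fst
    (measurable_zeroExtend (isOpen_activeDomain hV hρ.isOpen).measurableSet (hZ.measurable j))

lemma measurable_sqErrorVersion (hV : V ∈ Matrix.orthogonalGroup (Fin n) ℝ)
    (hρ : IsRegularDensity ρ) (hZ : IsConditionalSample hk V ρ P Z) {F : Vec n → ℝ}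
    (hF : Measurable F) : Measurable (sqErrorVersion hk V ρ F Z) := by
  refine Measurable.pow_const (Measurable.sub ((measurable_condExpect hV hρ hF).comp
    measurable_fst) (Measurable.const_mul ?_ _)) 2
  exact Finset.measurable_fun_sum _ fun j _ => hF.comp (measurable_assemble_sample hV hρ hZ j)

/-- The squared error agrees almost everywhere with its measurable version. -/
lemma sq_error_ae_eq [SFinite P] (hV : V ∈ Matrix.orthogonalGroup (Fin n) ℝ)
    (hρ : IsRegularDensity ρ) (hZ : IsConditionalSample hk V ρ P Z) :
    ∀ᵐ p ∂((volume.withDensity (sliceMass hk V ρ)).prod P),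
      (condExpect hk V ρ f p.1 - monteCarlo hk V f Z p.1 p.2) ^ 2
        = sqErrorVersion hk V ρ ((domain ρ).indicator f) Z p := by
  have hY : MeasurableSet (activeDomain hk V ρ) := (isOpen_activeDomain hV hρ.isOpen).measurableSet
  have hD : MeasurableSet (domain ρ) := hρ.isOpen.measurableSet
  have hset : MeasurableSet {p : Vec k × Ω | p.1 ∈ activeDomain hk V ρ ∧ ∀ j, assemble hk V p.1
      ((activeDomain hk V ρ).indicator (fun y => Z j y p.2) p.1) ∈ domain ρ} := by
    rw [Set.ofPred_and, Set.ofPred_forall]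
    exact (hY.preimage measurable_fst).inter
      (MeasurableSet.iInter fun j => hD.preimage (measurable_assemble_sample hV hρ hZ j))
  have hae : ∀ᵐ p ∂((volume.withDensity (sliceMass hk V ρ)).prod P),
      p.1 ∈ activeDomain hk V ρ ∧ ∀ j, assemble hk V p.1
        ((activeDomain hk V ρ).indicator (fun y => Z j y p.2) p.1) ∈ domain ρ := by
    refine (Measure.ae_prod_iff_ae_ae hset).2 ?_
    filter_upwards [ae_isRegularPoint hV hρ] with y hy
    filter_upwards [ae_all_iff.2 fun j => hZ.ae_mem_domain hV hρ j hy.mem] with t ht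
    refine ⟨hy.mem, fun j => ?_⟩
    rw [Set.indicator_of_mem hy.mem]
    exact ht j
  filter_upwards [hae] with p hp
  rw [sqErrorVersion, condExpect_indicator hρ.nonneg, monteCarlo]
  congr 3
  refine Finset.sum_congr rfl fun j _ => ?_
  have h := hp.2 j
  rw [Set.indicator_of_mem hp.1] at h ⊢
  rw [Set.indicator_of_mem h]

/-- Finite pair energy makes almost every slice square integrable. -/
lemma ae_memLp_slice (hV : V ∈ Matrix.orthogonalGroup (Fin n) ℝ) (hρ : IsRegularDensity ρ)
    {F : Vec n → ℝ} (hF : Measurable F) (hE : pairEnergy hk V ρ F ≠ ⊤) :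
    ∀ᵐ y ∂(volume.withDensity (sliceMass hk V ρ)), IsRegularPoint hk V ρ y ∧
      MemLp (fun z => F (assemble hk V y z)) 2 (densityMeasure (condDensity hk V ρ y)) := by
  have h1 : ∀ᵐ y ∂(volume : Measure (Vec k)), slicePairEnergy hk V ρ F y < ⊤ :=
    ae_lt_top (measurable_slicePairEnergy hρ.measurable hF)
      (by rwa [lintegral_slicePairEnergy hρ.measurable hF])
  filter_upwards [ae_isRegularPoint hV hρ, (withDensity_absolutelyContinuous _ _) h1] with y hy hfin
  refine ⟨hy, ?_⟩
  have := hy.isProbabilityMeasure hV hρ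
  refine memLp_two_of_pair (hF.comp (measurable_assemble₂ measurable_const measurable_id))
    fun htop => ?_
  rw [slicePairEnergy_eq hV hρ hF hy] at hfin
  exact absurd hfin (by
    simp only [not_lt, top_le_iff]
    exact (congrArg (sliceMass hk V ρ y * ·) htop).trans (ENNReal.mul_top hy.ne_zero))

/-- The mean squared error of `N` independent samples is `1 / N` times the conditional variance,
which is half the pair integral over the slice. -/
lemma lintegral_sqErrorVersion_le [IsProbabilityMeasure P]
    (hV : V ∈ Matrix.orthogonalGroup (Fin n) ℝ) (hρ : IsRegularDensity ρ) (hN : 0 < N)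
    (hZ : IsConditionalSample hk V ρ P Z) {F : Vec n → ℝ} (hF : Measurable F)
    (hE : pairEnergy hk V ρ F ≠ ⊤) :
    ∫⁻ y, ∫⁻ t, ENNReal.ofReal (sqErrorVersion hk V ρ F Z (y, t)) ∂P
        ∂(volume.withDensity (sliceMass hk V ρ))
      ≤ ENNReal.ofReal (1 / (2 * N)) * pairEnergy hk V ρ F := by
  have hN' : (0 : ℝ) < N := Nat.cast_pos.2 hN
  have hsm := measurable_sliceMass (hk := hk) (W := V) hρ.measurable
  have hT : Measurable (Function.uncurry fun y t =>
      ENNReal.ofReal (sqErrorVersion hk V ρ F Z (y, t))) :=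
    (measurable_sqErrorVersion hV hρ hZ hF).ennreal_ofReal
  have hI : Measurable fun y => ∫⁻ t, ENNReal.ofReal (sqErrorVersion hk V ρ F Z (y, t)) ∂P :=
    hT.lintegral_prod_right
  have hae := ae_memLp_slice hV hρ hF hE
  rw [ae_withDensity_iff hsm] at hae
  rw [lintegral_withDensity_eq_lintegral_mul _ hsm hI, ← lintegral_slicePairEnergy hρ.measurable hF,
    ← lintegral_const_mul _ (measurable_slicePairEnergy hρ.measurable hF)]
  refine lintegral_mono_ae ?_
  filter_upwards [hae] with y hy
  rw [Pi.mul_apply]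
  by_cases h0 : sliceMass hk V ρ y = 0
  · rw [h0, zero_mul]; exact zero_le
  obtain ⟨hreg, hL⟩ := hy h0
  have hP := hreg.isProbabilityMeasure hV hρ
  have hFm : Measurable fun z => F (assemble hk V y z) :=
    hF.comp (measurable_assemble₂ measurable_const measurable_id)
  have hmc := lintegral_sq_sub_sampleMean hN (fun j => hZ.measurable_apply j hreg.mem)
    (fun j => hZ.law j y hreg.mem) (hZ.indep y hreg.mem) hFm hL
  have heq : ∫⁻ t, ENNReal.ofReal (sqErrorVersion hk V ρ F Z (y, t)) ∂P
      = ENNReal.ofReal (Var[fun z => F (assemble hk V y z);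
          densityMeasure (condDensity hk V ρ y)] / N) := by
    rw [← hmc]
    refine lintegral_congr fun t => ?_
    simp only [sqErrorVersion, condExpect_eq_integral hV hρ, Set.indicator_of_mem hreg.mem]
  have hpair := lintegral_lintegral_sq_sub (densityMeasure (condDensity hk V ρ y)) hL
  rw [heq, slicePairEnergy_eq hV hρ hF hreg]
  refine le_of_eq ?_
  rw [mul_left_comm]
  refine congrArg (sliceMass hk V ρ y * ·) (Eq.trans ?_ (congrArg
    (ENNReal.ofReal (1 / (2 * N)) * ·) hpair.symm))
  rw [← ENNReal.ofReal_mul (by positivity)]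
  congr 1
  field_simp

lemma integrable_sq_error [IsProbabilityMeasure P]
    (hV : V ∈ Matrix.orthogonalGroup (Fin n) ℝ) (hρ : IsRegularDensity ρ) (hN : 0 < N)
    (hZ : IsConditionalSample hk V ρ P Z) (hF : Measurable ((domain ρ).indicator f))
    (hE : pairEnergy hk V ρ ((domain ρ).indicator f) ≠ ⊤) :
    Integrable (fun p : Vec k × Ω =>
        (condExpect hk V ρ f p.1 - monteCarlo hk V f Z p.1 p.2) ^ 2)
      ((volume.withDensity (sliceMass hk V ρ)).prod P) := by
  have hm := measurable_sqErrorVersion hV hρ hZ hF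
  refine Integrable.congr ?_ ((sq_error_ae_eq (f := f) hV hρ hZ).mono fun _ h => h.symm)
  refine ⟨hm.aestronglyMeasurable,
    (hasFiniteIntegral_iff_ofReal (ae_of_all _ (sqErrorVersion_nonneg _))).2 ?_⟩
  rw [lintegral_prod _ hm.ennreal_ofReal.aemeasurable]
  exact (lintegral_sqErrorVersion_le hV hρ hN hZ hF hE).trans_lt
    (ENNReal.mul_lt_top ENNReal.ofReal_lt_top hE.lt_top)

lemma integral_sq_error_le [IsProbabilityMeasure P]
    (hV : V ∈ Matrix.orthogonalGroup (Fin n) ℝ) (hρ : IsRegularDensity ρ) (hN : 0 < N)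
    (hZ : IsConditionalSample hk V ρ P Z) (hF : Measurable ((domain ρ).indicator f))
    {B : ℝ} (hB : 0 ≤ B) (hE : pairEnergy hk V ρ ((domain ρ).indicator f) ≤ ENNReal.ofReal B) :
    ∫ t, ∫ y, (condExpect hk V ρ f y - monteCarlo hk V f Z y t) ^ 2
        ∂(volume.withDensity (sliceMass hk V ρ)) ∂P ≤ 1 / (2 * N) * B := by
  have hE' := (hE.trans_lt ENNReal.ofReal_lt_top).ne
  have hm := measurable_sqErrorVersion hV hρ hZ hF
  rw [← integral_prod_symm _ (integrable_sq_error hV hρ hN hZ hF hE'),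
    integral_congr_ae (sq_error_ae_eq (f := f) hV hρ hZ),
    integral_eq_lintegral_of_nonneg_ae (ae_of_all _ (sqErrorVersion_nonneg _))
      hm.aestronglyMeasurable]
  refine ENNReal.toReal_le_of_le_ofReal (by positivity) ?_
  rw [lintegral_prod _ hm.ennreal_ofReal.aemeasurable, ENNReal.ofReal_mul (by positivity)]
  exact (lintegral_sqErrorVersion_le hV hρ hN hZ hF hE').trans (mul_le_mul_right hE _)

/-- The conditional expectation is an absolutely convergent integral for almost every `y`. -/
lemma ae_integrable_condExpect (hV : V ∈ Matrix.orthogonalGroup (Fin n) ℝ)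
    (hρ : IsRegularDensity ρ) (hF : Measurable ((domain ρ).indicator f))
    (hE : pairEnergy hk V ρ ((domain ρ).indicator f) ≠ ⊤) :
    ∀ᵐ y ∂(volume.withDensity (sliceMass hk V ρ)),
      Integrable fun z => f (assemble hk V y z) * condDensity hk V ρ y z := by
  filter_upwards [ae_memLp_slice hV hρ hF hE] with y ⟨hy, hL⟩
  have := hy.isProbabilityMeasure hV hρ
  have hm : Measurable fun z => ENNReal.ofReal (condDensity hk V ρ y z) :=
    ((measurable_condDensity hV hρ).comp measurable_prodMk_left).ennreal_ofReal
  have hi := hL.integrable one_le_two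
  rw [densityMeasure, integrable_withDensity_iff hm (ae_of_all _ fun _ => ENNReal.ofReal_lt_top)]
    at hi
  refine hi.congr (ae_of_all _ fun z => ?_)
  simp only [ENNReal.toReal_ofReal (condDensity_nonneg hρ.nonneg y z),
    mul_condDensity_indicator hρ.nonneg]

/-- The constant of the slicewise Poincaré inequality. For a convex set it is proportional to
the squared diameter; `1` is added so that it is positive in dimension `0` as well. -/
lemma exists_poincare_constant (hρ : IsUniformOnConvex ρ ∨ IsStdNormal ρ) :
    ∃ C : ℝ, 0 < C ∧ (IsStdNormal ρ → C = 1) ∧ IsRegularDensity ρ ∧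
      ∀ (k : ℕ) (hk : k ≤ n) (V : Matrix (Fin n) (Fin n) ℝ), V ∈ Matrix.orthogonalGroup (Fin n) ℝ →
        Nonempty (CutoffExhaustion hk V ρ C) := by
  by_cases h : IsStdNormal ρ
  · exact ⟨1, one_pos, fun _ => rfl, h.isRegularDensity,
      fun k hk V hV => h.exists_cutoffExhaustion hV⟩
  · have hu := hρ.resolve_right h
    refine ⟨Metric.diam (domain ρ) ^ 2 * 2 ^ n / 2 + 1, by positivity, fun h' => absurd h' h,
      hu.isRegularDensity, fun k hk V hV => hu.exists_cutoffExhaustion hV (by linarith)⟩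

end MeanSquaredError

end ActiveSubspace

theorem mainTheorem2 (n : ℕ) (ρ : Vec n → ℝ) (hρ : IsUniformOnConvex ρ ∨ IsStdNormal ρ) :
    ∃ C : ℝ, 0 < C ∧ (IsStdNormal ρ → C = 1) ∧
      ∀ (f : Vec n → ℝ), IsAdmissible ρ f →
      ∀ (k : ℕ) (_ : 1 ≤ k) (hkn : k < n)
        (W What : Matrix (Fin n) (Fin n) ℝ) (lam : Fin n → ℝ),
      IsEigenbasis ρ f W lam →
      What ∈ Matrix.orthogonalGroup (Fin n) ℝ →
      ∀ ε : ℝ, 0 < ε →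
      ‖Matrix.toEuclideanCLM (n := Fin n) (𝕜 := ℝ) (W - What)‖ ≤ ε →
      ∀ (N : ℕ), 0 < N →
      ∀ {Ω : Type*} [MeasurableSpace Ω] (P : Measure Ω) [IsProbabilityMeasure P]
        (X : Ω → Vec n), Measurable X → P.map X = densityMeasure ρ →
      ∀ (Z : Fin N → Vec k → Ω → Vec (n - k)),
      IsConditionalSample hkn.le What ρ P Z →
      -- the conditional expectation and the mean squared errors are well defined
      (∀ᵐ y ∂(P.map fun ω => active hkn.le What (X ω)),
        Integrable fun z => f (assemble hkn.le What y z) * condDensity hkn.le What ρ y z) ∧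
      Integrable (fun p : Vec n × Ω =>
        (ridge hkn.le What (condExpect hkn.le What ρ f) p.1
          - ridge hkn.le What (fun y => monteCarlo hkn.le What f Z y p.2) p.1) ^ 2)
        ((P.map X).prod P) ∧
      -- the mean squared error in terms of `X` and in terms of the active variable
      ∫ ω, ∫ x, (ridge hkn.le What (condExpect hkn.le What ρ f) x
          - ridge hkn.le What (fun y => monteCarlo hkn.le What f Z y ω) x) ^ 2 ∂(P.map X) ∂P
        = ∫ ω, ∫ y, (condExpect hkn.le What ρ f y - monteCarlo hkn.le What f Z y ω) ^ 2
            ∂(P.map fun ω' => active hkn.le What (X ω')) ∂P ∧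
      -- the bound
      ∫ ω, ∫ y, (condExpect hkn.le What ρ f y - monteCarlo hkn.le What f Z y ω) ^ 2
            ∂(P.map fun ω' => active hkn.le What (X ω')) ∂P
        ≤ C / N * (ε * √(∑ i ∈ {i : Fin n | (i : ℕ) < k}, lam i)
            + √(∑ i ∈ {i : Fin n | k ≤ (i : ℕ)}, lam i)) ^ 2 := by
  obtain ⟨C, hC, hnormal, hreg, hex⟩ := exists_poincare_constant hρ
  refine ⟨C, hC, hnormal, ?_⟩
  intro f hf k _ hkn W V lam hW hV ε hε hWV N hN Ω _ P _ X hX hlaw Z hZ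
  have hF := hf.measurable_indicator hreg.measurable
  have hactive : Measurable (active hkn.le V) := (continuous_active hkn.le).measurable
  have hmap : (densityMeasure ρ).map (active hkn.le V)
      = volume.withDensity (sliceMass hkn.le V ρ) := map_active_densityMeasure hV hreg.measurable
  have hmapY : P.map (fun ω => active hkn.le V (X ω))
      = volume.withDensity (sliceMass hkn.le V ρ) := by
    rw [← hmap, ← hlaw, Measure.map_map hactive hX]; rfl
  have hE : pairEnergy hkn.le V ρ ((domain ρ).indicator f) ≤ ENNReal.ofReal (2 * C *
      (ε * √(∑ i ∈ {i : Fin n | (i : ℕ) < k}, lam i)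
        + √(∑ i ∈ {i : Fin n | k ≤ (i : ℕ)}, lam i)) ^ 2) := by
    obtain ⟨E⟩ := hex k hkn.le V hV
    rw [ENNReal.ofReal_mul (by positivity)]
    exact (E.pairEnergy_le hV hreg hf).trans
      (mul_le_mul_right (lintegral_inactiveGrad_le hreg hf hW hV hε.le hWV) _)
  have hE' := (hE.trans_lt ENNReal.ofReal_lt_top).ne
  have hint := integrable_sq_error hV hreg hN hZ hF hE'
  rw [hmapY, hlaw]
  have hpres : MeasurePreserving (Prod.map (active hkn.le V) (id : Ω → Ω))
      ((densityMeasure ρ).prod P) ((volume.withDensity (sliceMass hkn.le V ρ)).prod P) := by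
    have : SFinite (densityMeasure ρ) := by unfold densityMeasure; infer_instance
    exact MeasurePreserving.prod ⟨hactive, hmap⟩ (MeasurePreserving.id P)
  refine ⟨ae_integrable_condExpect hV hreg hF hE', hpres.integrable_comp_of_integrable hint, ?_, ?_⟩
  · refine integral_congr_ae ?_
    filter_upwards [hint.prod_left_ae] with ω hω
    rw [← hmap] at hω ⊢
    exact (integral_map hactive.aemeasurable hω.aestronglyMeasurable).symm
  · refine (integral_sq_error_le hV hreg hN hZ hF (by positivity) hE).trans_eq ?_
    field_simp
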